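/- **Setting.** Let $m\ge 1$ and let $(X,D)$ take values in $\mathbb{R}^m\times\{0,1\}$. Put $p_w=\mathbb{P}(D=w)$ and $e(x)=\mathbb{P}(D=1\mid X=x)$. Let $(X_i,D_i)_{i=1}^n$ be i.i.d. copies of $(X,D)$ and let $n_w=\#\{i: D_i=w\}$. For $w\in\{0,1\}$ and $M\in\{1,\dots,n\}$ let $\mathcal J^w_M(i)$ be the set of indices $j$ with $D_j=w$ and $\#\{l: D_l=w,\ \|X_l-X_i\|\le\|X_j-X_i\|\}\le M$ (the $M$ nearest neighbours of $X_i$ among the units with label $w$). For a unit $i$ with $D_i=w$ let $K^w_M(i)=\#\{j: D_j=1-w,\ i\in\mathcal J^w_M(j)\}$. Conventions: $x/0=0$. **Assumptions.** Fix a set $\mathbb{X}\subset\mathbb{R}^m$ and constants $0<g_{\min}\le g_{\max}$, $0<g_{w,\min}\le g_{w,\max}$ ($w=0,1$), $L>0$, $a\in(0,1)$, $H>0$, $C_0>0$, $C_1>0$ with $$C_0\le \max_{w=0,1}\Big(\frac{g_{w,\min}}4\Big)^{m+1}\frac{V_m}{2L^m},$$ where $V_m$ is the volume of the unit ball of $\mathbb{R}^m$.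 Let $r_{\mathrm{ratio}}=\max_{w=0,1} g_{w,\min}/g_{w,\max}$ and fix $r_0\in[r_{\mathrm{ratio}},1]$. Let $n\ge 9$, $1\le M\le n$, $\eta\in(0,1/2]$, $M\le C_0n\eta$, $n\eta^2\ge C_1$, and assume: 1. $\mathbb{X}$ is compact and convex and is the support of $X$; $X$ has a Lebesgue density $g$ with $g_{\min}\le g\le g_{\max}$ on $\mathbb{X}$. 2. $\eta\le e(x)\le 1-\eta$ for almost all $x\in\mathbb{X}$. 3. For $w=0,1$ the conditional law of $X$ given $D=w$, with support $S_w$, has a Lebesgue density $g_w$ with $g_{w,\min}\le g_w\le g_{w,\max}$ on $S_w$; and $|g_0(x)-g_0(z)|\vee|g_1(x)-g_1(z)|\le L\|x-z\|$ for all $x,z\in S_0$ and for all $x,z\in S_1$. 4. For $w=0,1$, $z\in S_{1-w}$ and $0<\delta\le\operatorname{diam}(S_w)$, $\lambda(B(z,\delta)\cap S_w)\ge a\,\lambda(B(z,\delta))$, where $\lambda$ is Lebesgue measure and $B(z,\delta)$ is the closed ball. 5. The surface areas of $S_0$ and $S_1$ are at most $H$. **Bound.** Define $$\rho=e^{-(1-\log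 2)M}+e^{M-r_0n\eta-M\log M+M\log(r_0n\eta)},\qquad \delta_{H_1}=\frac1{n^2\eta^4}+\Big(\frac n{M\eta}\Big)^2\rho^2,$$ $$\delta_{H_2}=\Big(\frac M{n\eta}\Big)^{1/m}+\frac1{n\eta}+\frac nM\rho,\qquad \delta_{H_3}=\Big(\frac n{M\eta}\Big)^2e^{-(1-\log2)M},$$ $$\mathcal B_n(M,\eta)=\frac1{\eta^2}\Big(\frac M{n\eta}\Big)^{1/m}+\delta_{H_1}+(\delta_{H_2}+1)\frac1{\eta^2M}+\delta_{H_3},$$ and the errors $$\mathcal E_0=\mathbb{E}\Big[\Big(\frac{n_1}{n_0}\Big)^2\,\mathbb{E}\Big(\Big(\frac{n_0}{n_1}\frac{K^0_M(1)}M-\frac{p_0}{p_1}\frac{e(X_1)}{1-e(X_1)}\Big)^2\Big|\,D_1,\dots,D_n\Big)\mathbf 1(n_0>0)\,\Big|\,D_1=0\Big],$$ $$\mathcal E_1=\mathbb{E}\Big[\Big(\frac{n_0}{n_1}\Big)^2\,\mathbb{E}\Big(\Big(\frac{n_1}{n_0}\frac{K^1_M(1)}M-\frac{p_1}{p_0}\frac{1-e(X_1)}{e(X_1)}\Big)^2\Big|\,D_1,\dots,D_n\Big)\mathbf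 1(n_1>0)\,\Big|\,D_1=1\Big].$$ **Lemma.** (i) There is a finite constant $C$, depending only on $m$, $\mathbb{X}$ and the fixed constants above, and not on $n$, $M$, $\eta$ or the law of $(X,D)$, such that under the assumptions above the squared errors are integrable and $$\mathcal E_0\le C\,\mathcal B_n(M,\eta),\qquad \mathcal E_1\le C\,\mathcal B_n(M,\eta).$$ (ii) For every $\eta_0>0$ there is a finite constant $C$ (depending in addition on $\eta_0$) such that for every sequence of integers $M=M_n$, eventually $\ge1$, with $M_n^{-1}\log n\to0$ and $n^{-1}M_n\log n\to0$, the following holds for all sufficiently large $n$ and all $\eta\ge\eta_0$ for which the above assumptions on $(n,M_n,\eta)$ hold: $$\mathcal B_n(M_n,\eta)\le C\big((M_n/n)^{1/m}+M_n^{-1}\big),$$ and, for every law of $(X,D)$ satisfying the above assumptions, $\mathcal E_0$ and $\mathcal E_1$ are at most $C\big((M_n/n)^{1/m}+M_n^{-1}\big)$. -/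

import Mathlib

open MeasureTheory ProbabilityTheory Filter Topology

noncomputable section

namespace Matching

/-- The covariate space `ℝ^m` with the Euclidean distance. -/
abbrev Cov (m : ℕ) : Type := EuclideanSpace ℝ (Fin m)

/-! ### Nearest-neighbour matching on a labelled point configuration -/

/-- `n_w`: the number of units with label `w`. -/
def groupSize {n : ℕ} (d : Fin n → Fin 2) (w : Fin 2) : ℕ :=
  (Finset.univ.filter fun j => d j = w).card

open Classical in
/-- `J^w_M(i)`: the indices of the `M` nearest neighbours of `x i` among the points with
label `w`, i.e. the `j` with `d j = w` such that at most `M` points with label `w` are at least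
as close to `x i` as `x j` is. -/
def nnIndexSet {m n : ℕ} (M : ℕ) (w : Fin 2) (i : Fin n)
    (x : Fin n → Cov m) (d : Fin n → Fin 2) : Finset (Fin n) :=
  Finset.univ.filter fun j => d j = w ∧
    (Finset.univ.filter fun l => d l = w ∧ dist (x l) (x i) ≤ dist (x j) (x i)).card ≤ M

open Classical in
/-- `K^w_M(i)`: the number of units `j` with the label opposite to `w` such that `i` belongs to
`J^w_M(j)`. (In `Fin 2`, `1 - w` is the label opposite to `w`.) -/
def matchedTimes {m n : ℕ} (M : ℕ) (w : Fin 2) (i : Fin n)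
    (x : Fin n → Cov m) (d : Fin n → Fin 2) : ℕ :=
  (Finset.univ.filter fun j => d j = 1 - w ∧ i ∈ nnIndexSet M w j x d).card

/-- The density-ratio estimator at unit `i`: `(n_w / n_{1-w}) * K^w_M(i) / M`. -/
def ratioEstimator {m n : ℕ} (M : ℕ) (w : Fin 2) (i : Fin n)
    (x : Fin n → Cov m) (d : Fin n → Fin 2) : ℝ :=
  (groupSize d w : ℝ) / (groupSize d (1 - w) : ℝ) * ((matchedTimes M w i x d : ℝ) / (M : ℝ))

/-! ### The population: the law `Q` of the pair `(X, D)` -/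

/-- `P(D = w)`. -/
def labelProb {m : ℕ} (Q : Measure (Cov m × Fin 2)) (w : Fin 2) : ℝ :=
  Q.real (Set.univ ×ˢ {w})

/-- The propensity score `e(x) = P(D = 1 | X = x)`. -/
def propensity {m : ℕ} (Q : Measure (Cov m × Fin 2)) [IsFiniteMeasure Q] (x : Cov m) : ℝ :=
  (Q.condKernel x).real {1}

/-- The conditional law of `X` given `D = w`. -/
def covLaw {m : ℕ} (Q : Measure (Cov m × Fin 2)) (w : Fin 2) : Measure (Cov m) :=
  (ProbabilityTheory.cond Q (Set.univ ×ˢ {w})).map Prod.fst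

/-- The density ratio that the estimator with label `w` targets:
`P(D=0)/P(D=1) * e/(1-e)` for `w = 0` and `P(D=1)/P(D=0) * (1-e)/e` for `w = 1`. -/
def densityRatio {m : ℕ} (Q : Measure (Cov m × Fin 2)) [IsFiniteMeasure Q]
    (w : Fin 2) (x : Cov m) : ℝ :=
  if w = 0 then labelProb Q 0 / labelProb Q 1 * (propensity Q x / (1 - propensity Q x))
  else labelProb Q 1 / labelProb Q 0 * ((1 - propensity Q x) / propensity Q x)

/-- The assumptions on the data distribution. Here `gmin, gmax` bound the density of `X`,
`gLow w, gUp w` bound the density of `X` given `D = w`, and the supports of these laws are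
topological supports. Surface area is the `(m-1)`-dimensional Hausdorff measure of the
boundary. -/
structure DataAssumptions {m : ℕ} (Q : Measure (Cov m × Fin 2)) [IsFiniteMeasure Q]
    (𝕏 : Set (Cov m)) (gmin gmax : ℝ) (gLow gUp : Fin 2 → ℝ) (L a H η : ℝ) : Prop where
  compact : IsCompact 𝕏
  convex : Convex ℝ 𝕏
  support_eq : Q.fst.support = 𝕏
  density : ∃ g : Cov m → ℝ, Measurable g ∧
    Q.fst = volume.withDensity (fun x => ENNReal.ofReal (g x)) ∧
    ∀ x ∈ 𝕏, gmin ≤ g x ∧ g x ≤ gmax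
  overlap : ∀ᵐ x ∂Q.fst, η ≤ propensity Q x ∧ propensity Q x ≤ 1 - η
  condDensity : ∀ w : Fin 2, ∃ g : Cov m → ℝ, Measurable g ∧
    covLaw Q w = volume.withDensity (fun x => ENNReal.ofReal (g x)) ∧
    (∀ v : Fin 2, ∀ x ∈ (covLaw Q v).support, ∀ z ∈ (covLaw Q v).support,
      |g z - g x| ≤ L * ‖x - z‖) ∧
    ∀ x ∈ (covLaw Q w).support, gLow w ≤ g x ∧ g x ≤ gUp w
  ballVolume : ∀ w : Fin 2, ∀ z ∈ (covLaw Q (1 - w)).support, ∀ δ : ℝ,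
    0 < δ → δ ≤ Metric.diam (covLaw Q w).support →
      ENNReal.ofReal a * volume (Metric.closedBall z δ) ≤
        volume (Metric.closedBall z δ ∩ (covLaw Q w).support)
  surfaceArea : ∀ w : Fin 2,
    Measure.hausdorffMeasure ((m : ℝ) - 1) (frontier (covLaw Q w).support) ≤ ENNReal.ofReal H

/-- `(X_i, D_i)`, `i < n`, are independent copies with common law `Q`. -/
structure IsSample {Ω : Type*} [MeasurableSpace Ω] (P : Measure Ω) {m n : ℕ}
    (X : Fin n → Ω → Cov m) (D : Fin n → Ω → Fin 2) (Q : Measure (Cov m × Fin 2)) : Prop where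
  measurable_cov : ∀ i, Measurable (X i)
  measurable_label : ∀ i, Measurable (D i)
  indep : iIndepFun (fun i ω => (X i ω, D i ω)) P
  law : ∀ i, P.map (fun ω => (X i ω, D i ω)) = Q

/-! ### The error -/

/-- The squared error of the density-ratio estimator at unit `i`. -/
def sqError {Ω : Type*} {m n : ℕ} (X : Fin n → Ω → Cov m) (D : Fin n → Ω → Fin 2)
    (Q : Measure (Cov m × Fin 2)) [IsFiniteMeasure Q]
    (M : ℕ) (w : Fin 2) (i : Fin n) (ω : Ω) : ℝ :=
  (ratioEstimator M w i (fun j => X j ω) (fun j => D j ω) - densityRatio Q w (X i ω)) ^ 2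

/-- The σ-algebra generated by `D_1, …, D_n`. -/
abbrev labelSigma {Ω : Type*} {n : ℕ} (D : Fin n → Ω → Fin 2) : MeasurableSpace Ω :=
  MeasurableSpace.comap (fun ω j => D j ω) inferInstance

/-- The expectation, given that unit `i` has label `w`, of
`(n_{1-w} / n_w)^2 * E((estimator - density ratio)^2 | D_1, …, D_n) * 1(n_w > 0)`. -/
def meanError {Ω : Type*} [MeasurableSpace Ω] (P : Measure Ω) {m n : ℕ}
    (X : Fin n → Ω → Cov m) (D : Fin n → Ω → Fin 2)
    (Q : Measure (Cov m × Fin 2)) [IsFiniteMeasure Q]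
    (M : ℕ) (w : Fin 2) (i : Fin n) : ℝ :=
  ∫ ω, ((groupSize (fun j => D j ω) (1 - w) : ℝ) / (groupSize (fun j => D j ω) w : ℝ)) ^ 2 *
      (P[sqError X D Q M w i | labelSigma D]) ω *
      (if 0 < groupSize (fun j => D j ω) w then 1 else 0)
    ∂(ProbabilityTheory.cond P {ω | D i ω = w})

/-! ### The bound -/

/-- The larger of the two ratios `g_{w,min} / g_{w,max}`. -/
def rRatio (gLow gUp : Fin 2 → ℝ) : ℝ := max (gLow 0 / gUp 0) (gLow 1 / gUp 1)

/-- `e^{-(1-log 2) M} + e^{M - r₀ n η - M log M + M log (r₀ n η)}`. -/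
def expTerm (r₀ : ℝ) (n M : ℕ) (η : ℝ) : ℝ :=
  Real.exp (-(1 - Real.log 2) * M) +
    Real.exp (M - r₀ * n * η - M * Real.log M + M * Real.log (r₀ * n * η))

def deltaH1 (r₀ : ℝ) (n M : ℕ) (η : ℝ) : ℝ :=
  1 / ((n : ℝ) ^ 2 * η ^ 4) + ((n : ℝ) / (M * η)) ^ 2 * expTerm r₀ n M η ^ 2

def deltaH2 (m : ℕ) (r₀ : ℝ) (n M : ℕ) (η : ℝ) : ℝ :=
  ((M : ℝ) / (n * η)) ^ (1 / (m : ℝ)) + 1 / (n * η) + (n : ℝ) / M * expTerm r₀ n M η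

def deltaH3 (n M : ℕ) (η : ℝ) : ℝ :=
  ((n : ℝ) / (M * η)) ^ 2 * Real.exp (-(1 - Real.log 2) * M)

/-- The non-asymptotic upper bound (without the multiplicative constant). -/
def errorBound (m : ℕ) (r₀ : ℝ) (n M : ℕ) (η : ℝ) : ℝ :=
  1 / η ^ 2 * ((M : ℝ) / (n * η)) ^ (1 / (m : ℝ)) + deltaH1 r₀ n M η +
    (deltaH2 m r₀ n M η + 1) * (1 / (η ^ 2 * M)) + deltaH3 n M η

/-- The simplified upper bound `(M/n)^{1/m} + M^{-1}`. -/
def simpleBound (m n M : ℕ) : ℝ := ((M : ℝ) / n) ^ (1 / (m : ℝ)) + 1 / (M : ℝ)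

/-- `V_m`: the volume of the unit ball of `ℝ^m`. -/
def unitBallVolume (m : ℕ) : ℝ := (volume : Measure (Cov m)).real (Metric.closedBall 0 1)

/-- The constraints that tie together the sample size, the number of neighbours and `η`. -/
structure SizeAssumptions (C₀ C₁ : ℝ) (n M : ℕ) (η : ℝ) : Prop where
  nine_le : 9 ≤ n
  one_le : 1 ≤ M
  le_n : M ≤ n
  eta_pos : 0 < η
  eta_le : η ≤ 1 / 2
  le_C₀ : (M : ℝ) ≤ C₀ * n * η
  C₁_le : C₁ ≤ n * η ^ 2

end Matching

end

/-!
The estimator is compared with its target first for fixed labels, and the labels are averaged out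
at the end.

*Population.* Overlap gives each label a conditional probability of at least `η` almost everywhere,
so the conditional laws `ν` and `ν'` of the covariate given the label `w` and the opposite label
are mutually absolutely continuous with the law of the covariate, and all these laws have the same
support `𝕏` (`support_covLaw`). By Bayes' formula the target of the estimator is the ratio
`r = g' / g` of their densities (`exists_densityPair`).

*Fixed labels.* Let `i` have label `w`, let `N + 1` be the size of its group and `N'` the size of
the other one. Put `c = N' / (N + 1)`, `τ = M / (N + 1)` and `A = ∫ r ^ 2 dν`. The weight in the
mean error turns the squared error into `(K / M - c * r (X i)) ^ 2`, where `K` counts the units `j`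
of the other group that have `i` among their `M` nearest neighbours. Given `X i = x` and `X j = y`
this happens with probability `binTail N M (ballMass ν x y)`, because fewer than `M` of the `N`
other units with label `w` may be as close to `y` as `x` is. As a function of the ball mass this is
the survival function of a beta density, so the layer-cake formula (`integral_mul_binTail`) reduces
the moments of `K` to the region of those `y` with `ballMass ν x y ≤ t`, the catchment region of
`x`, and to three moments of the beta distribution.

* For fixed `y` the ball mass of a random `x` is uniformly distributed (`real_ballMass_le`), so the
  matching probability is exactly `τ` (`integral_binTail_ballMass`), and the mixed moment of `K`
  and `r (X i)` is bounded below with leading term `A * τ` (`le_integral_ratio_mul_binTail`).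
* Two units are both matched to `i` with probability at most the binomial tail at the larger of the
  two ball masses, whose distribution function at `t` is the second moment of the catchment mass.
  Away from the boundary of `𝕏` the catchment mass is at most `t * r x` up to a relative error
  `O(t ^ (1 / m))`, since the densities are Lipschitz (`catchment_le_of_interior`). Near the
  boundary it is `O(t)`, and the layer where this is needed has volume `O(t ^ (1 / m))`, since `𝕏`
  is a convex body (`volume_boundary_layer_le`). Hence the leading term `A * τ ^ 2`
  (`integral_binTail_max_le`).

In the expansion of the square the three leading terms `c ^ 2 * A`, `-2 * c ^ 2 * A`, `c ^ 2 * A`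
cancel, and `c / M + c ^ 2 * O(1 / M + τ ^ (1 / m))` is left (`integral_sq_matchedTimes_sub_le`).

*Averaging.* The mean error is an average over the label vectors with `d i = w`
(`meanError_eq_sum`), and there the third inverse moment of the group size is under control
(`sum_labels_one_add_cube_le`). This gives the order `η⁻² * ((M / (n η)) ^ (1 / m) + 1 / M)`, which
is part of the asserted bound, whose other terms are nonnegative (`le_errorBound`).

*Asymptotics.* If `log n / M` and `M log n / n` tend to zero and `η` is bounded below, the two
exponential terms are eventually at most `n⁻⁴` (`expTerm_le`), which beats the powers of `n` in
front of them (`errorBound_le_simpleBound`).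
-/

namespace Matching

/-! ### Binomial tails and beta integrals -/

/-- The probability that a binomial variable with `N` trials and success probability `p` is
smaller than `M`. -/
noncomputable def binTail (N M : ℕ) (p : ℝ) : ℝ :=
  ∑ l ∈ Finset.range M, (N.choose l : ℝ) * p ^ l * (1 - p) ^ (N - l)

/-- The density of the `M`-th smallest of `N` independent uniform variables on `[0, 1]`. -/
noncomputable def betaDens (N M : ℕ) (t : ℝ) : ℝ :=
  M * (N.choose M : ℝ) * t ^ (M - 1) * (1 - t) ^ (N - M)

/-- The derivatives of the summands telescope. -/
lemma hasDerivAt_binTail (N M : ℕ) (hM : M ≤ N) (p : ℝ) :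
    HasDerivAt (binTail N M) (-betaDens N M p) p := by
  induction M with
  | zero =>
    have h : binTail N 0 = fun _ => 0 := by funext q; simp [binTail]
    rw [h]
    simpa [betaDens] using hasDerivAt_const p (0 : ℝ)
  | succ M ih =>
    have h1 := ih (by omega)
    have hpow : HasDerivAt (fun p : ℝ => p ^ M) (M * p ^ (M - 1)) p := hasDerivAt_pow M p
    have hsub : HasDerivAt (fun p : ℝ => 1 - p) (-1) p := by
      simpa using (hasDerivAt_id p).const_sub 1
    have hsubpow : HasDerivAt (fun p : ℝ => (1 - p) ^ (N - M))
        (((N - M : ℕ) : ℝ) * (1 - p) ^ (N - M - 1) * (-1)) p := hsub.fun_pow (N - M)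
    have h2 := (hpow.const_mul (N.choose M : ℝ)).mul hsubpow
    have h3 := h1.add h2
    have hfun : binTail N (M + 1) =
        binTail N M + (fun p : ℝ => (N.choose M : ℝ) * p ^ M) * fun p => (1 - p) ^ (N - M) := by
      funext q; simp [binTail, Finset.sum_range_succ]
    rw [hfun]
    refine h3.congr_deriv ?_
    have hc : ((M + 1 : ℕ) : ℝ) * (N.choose (M + 1) : ℝ) =
        (N.choose M : ℝ) * ((N - M : ℕ) : ℝ) := by
      rw [mul_comm]; exact_mod_cast Nat.choose_succ_right_eq N M
    simp only [betaDens]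
    rw [show M + 1 - 1 = M from rfl, show N - (M + 1) = N - M - 1 by omega, hc]
    ring

lemma continuous_betaDens (N M : ℕ) : Continuous (betaDens N M) := by
  unfold betaDens; fun_prop

lemma betaDens_nonneg (N M : ℕ) {t : ℝ} (h0 : 0 ≤ t) (h1 : t ≤ 1) : 0 ≤ betaDens N M t := by
  have : 0 ≤ 1 - t := by linarith
  unfold betaDens; positivity

lemma binTail_eq_integral {N M : ℕ} (hM : M ≤ N) (p : ℝ) :
    binTail N M p = ∫ t in p..1, betaDens N M t := by
  have h := intervalIntegral.integral_eq_sub_of_hasDerivAt (a := p) (b := 1)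
    (fun x _ => hasDerivAt_binTail N M hM x)
    ((continuous_betaDens N M).neg.intervalIntegrable p 1)
  have h1 : binTail N M 1 = 0 := by
    refine Finset.sum_eq_zero fun l hl => ?_
    have : N - l ≠ 0 := by have := Finset.mem_range.1 hl; omega
    simp [this]
  rw [h1, intervalIntegral.integral_neg] at h
  linarith

lemma integral_pow_mul_one_sub_pow (a b : ℕ) :
    ∫ t in (0 : ℝ)..1, t ^ a * (1 - t) ^ b =
      (a.factorial : ℝ) * b.factorial / (a + b + 1).factorial := by
  induction b generalizing a with
  | zero =>
    simp only [pow_zero, mul_one, integral_pow, Nat.factorial_zero, Nat.cast_one, add_zero,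
      Nat.factorial_succ]
    have : (a.factorial : ℝ) ≠ 0 := by exact_mod_cast a.factorial_ne_zero
    push_cast; field_simp
    simp [zero_pow (Nat.succ_ne_zero a)]
  | succ b ih =>
    -- integrate the derivative of `t ^ (a + 1) * (1 - t) ^ (b + 1)`
    have hd : ∀ t : ℝ, HasDerivAt (fun t : ℝ => t ^ (a + 1) * (1 - t) ^ (b + 1))
        ((a + 1) * (t ^ a * (1 - t) ^ (b + 1)) - (b + 1) * (t ^ (a + 1) * (1 - t) ^ b)) t := by
      intro t
      have h1 : HasDerivAt (fun t : ℝ => t ^ (a + 1)) (((a + 1 : ℕ) : ℝ) * t ^ a) t :=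
        hasDerivAt_pow (a + 1) t
      have hsub : HasDerivAt (fun p : ℝ => 1 - p) (-1) t := by
        simpa using (hasDerivAt_id t).const_sub 1
      have h2 : HasDerivAt (fun t : ℝ => (1 - t) ^ (b + 1))
          (((b + 1 : ℕ) : ℝ) * (1 - t) ^ b * (-1)) t := hsub.fun_pow (b + 1)
      refine (h1.mul h2).congr_deriv ?_
      push_cast; ring
    have hi : ∀ c d : ℕ, IntervalIntegrable (fun t : ℝ => t ^ c * (1 - t) ^ d) volume 0 1 :=
      fun c d => Continuous.intervalIntegrable (by fun_prop) _ _
    have h := intervalIntegral.integral_eq_sub_of_hasDerivAt (a := 0) (b := 1)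
      (fun t _ => hd t) (Continuous.intervalIntegrable (by fun_prop) _ _)
    rw [intervalIntegral.integral_sub ((hi _ _).const_mul _) ((hi _ _).const_mul _),
      intervalIntegral.integral_const_mul, intervalIntegral.integral_const_mul, ih] at h
    simp only [one_pow, sub_self, ne_eq, Nat.add_eq_zero_iff, one_ne_zero, and_false,
      not_false_eq_true, zero_pow, mul_zero, sub_zero, zero_mul] at h
    have ha : ((a : ℝ) + 1) ≠ 0 := by positivity
    have hf : (((a + 1 + b + 1).factorial : ℕ) : ℝ) ≠ 0 := by exact_mod_cast Nat.factorial_ne_zero _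
    have h' : ∫ t in (0 : ℝ)..1, t ^ a * (1 - t) ^ (b + 1) =
        (b + 1) * (((a + 1).factorial : ℝ) * b.factorial / (a + 1 + b + 1).factorial) /
          (a + 1) := by
      rw [eq_div_iff ha]; linarith
    rw [h', show a + (b + 1) + 1 = a + 1 + b + 1 by ring, Nat.factorial_succ a,
      Nat.factorial_succ b]
    push_cast; field_simp

/-- The moments of the beta distribution with parameters `M` and `N - M + 1`. -/
lemma integral_betaDens_mul_pow {N M : ℕ} (hM : 1 ≤ M) (hMN : M ≤ N) (q : ℕ) :
    ∫ t in (0 : ℝ)..1, betaDens N M t * t ^ q =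
      M * (N.choose M : ℝ) *
        (((M - 1 + q).factorial : ℝ) * (N - M).factorial / (N + q).factorial) := by
  have h : ∀ t : ℝ, betaDens N M t * t ^ q =
      M * (N.choose M : ℝ) * (t ^ (M - 1 + q) * (1 - t) ^ (N - M)) := by
    intro t; simp only [betaDens, pow_add]; ring
  simp_rw [h]
  rw [intervalIntegral.integral_const_mul, integral_pow_mul_one_sub_pow,
    show M - 1 + q + (N - M) + 1 = N + q by omega]

lemma integral_betaDens {N M : ℕ} (hM : 1 ≤ M) (hMN : M ≤ N) :
    ∫ t in (0 : ℝ)..1, betaDens N M t * t ^ 0 = 1 := by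
  rw [integral_betaDens_mul_pow hM hMN]
  have h := Nat.choose_mul_factorial_mul_factorial hMN
  have h2 : (M : ℝ) * ((M - 1).factorial : ℝ) = M.factorial := by
    exact_mod_cast Nat.mul_factorial_pred (by omega)
  have h3 : (N.choose M : ℝ) * M.factorial * (N - M).factorial = N.factorial := by exact_mod_cast h
  have hf : ((N.factorial : ℕ) : ℝ) ≠ 0 := by exact_mod_cast Nat.factorial_ne_zero _
  simp only [add_zero]
  rw [mul_div_assoc', div_eq_one_iff_eq hf, ← h3, ← h2]; ring

lemma integral_betaDens_mul_pow_succ {N M : ℕ} (hM : 1 ≤ M) (hMN : M ≤ N) (q : ℕ) :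
    ∫ t in (0 : ℝ)..1, betaDens N M t * t ^ (q + 1) =
      (M + q) / (N + q + 1) * ∫ t in (0 : ℝ)..1, betaDens N M t * t ^ q := by
  rw [integral_betaDens_mul_pow hM hMN, integral_betaDens_mul_pow hM hMN]
  obtain ⟨k, rfl⟩ : ∃ k, M = k + 1 := ⟨M - 1, by omega⟩
  rw [show k + 1 - 1 + (q + 1) = (k + q) + 1 by omega, show k + 1 - 1 + q = k + q by omega,
    ← add_assoc N q 1, Nat.factorial_succ (k + q), Nat.factorial_succ (N + q)]
  have hf : (((N + q).factorial : ℕ) : ℝ) ≠ 0 := by exact_mod_cast Nat.factorial_ne_zero _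
  push_cast; field_simp; ring

lemma integral_betaDens_mul_id {N M : ℕ} (hM : 1 ≤ M) (hMN : M ≤ N) :
    ∫ t in (0 : ℝ)..1, betaDens N M t * t = M / (N + 1) := by
  have h := integral_betaDens_mul_pow_succ hM hMN 0
  rw [integral_betaDens hM hMN] at h
  simpa using h

lemma integral_betaDens_mul_sq_le {N M : ℕ} (hM : 1 ≤ M) (hMN : M ≤ N) :
    ∫ t in (0 : ℝ)..1, betaDens N M t * t ^ 2 ≤ (M / (N + 1)) ^ 2 * (1 + 1 / M) := by
  have h := integral_betaDens_mul_pow_succ hM hMN 1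
  simp only [pow_one, one_add_one_eq_two, integral_betaDens_mul_id hM hMN] at h
  rw [h]
  have hM' : (0 : ℝ) < M := by exact_mod_cast hM
  have : ((M : ℝ) + (1 : ℕ)) / (N + (1 : ℕ) + 1) ≤ (M + 1) / (N + 1) := by
    push_cast
    exact div_le_div_of_nonneg_left (by positivity) (by positivity) (by linarith)
  calc _ ≤ ((M : ℝ) + 1) / (N + 1) * (M / (N + 1)) :=
        mul_le_mul_of_nonneg_right this (by positivity)
    _ = _ := by field_simp

lemma integral_betaDens_mul_cube_le {N M : ℕ} (hM : 1 ≤ M) (hMN : M ≤ N) :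
    ∫ t in (0 : ℝ)..1, betaDens N M t * t ^ 3 ≤ 6 * (M / (N + 1)) ^ 3 := by
  have h := integral_betaDens_mul_pow_succ hM hMN 2
  have h2 := integral_betaDens_mul_sq_le hM hMN
  rw [show (2 + 1 : ℕ) = 3 from rfl] at h
  rw [h]
  have hM' : (1 : ℝ) ≤ M := by exact_mod_cast hM
  have e1 : ((M : ℝ) + (2 : ℕ)) / (N + (2 : ℕ) + 1) ≤ 3 * M / (N + 1) := by
    push_cast
    exact div_le_div₀ (by positivity) (by linarith) (by positivity) (by linarith)
  have e2 : (1 : ℝ) / M ≤ 1 := by rw [div_le_one (by positivity)]; exact hM'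
  calc _ ≤ (3 * (M : ℝ) / (N + 1)) * ((M / (N + 1)) ^ 2 * (1 + 1)) := by
        refine mul_le_mul e1 (h2.trans ?_) ?_ (by positivity)
        · gcongr
        · refine intervalIntegral.integral_nonneg zero_le_one fun t ht => ?_
          exact mul_nonneg (betaDens_nonneg _ _ ht.1 ht.2) (by positivity)
    _ = _ := by ring

/-! ### Counting points of an independent sample in a set -/

lemma measurable_card_filter {Ω ι : Type*} [MeasurableSpace Ω] [Fintype ι]
    {S : ι → Set Ω} [∀ x, DecidablePred fun l => x ∈ S l] (hS : ∀ l, MeasurableSet (S l)) :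
    Measurable fun x => (Finset.univ.filter fun l => x ∈ S l).card := by
  simp only [Finset.card_filter]
  exact Finset.measurable_sum _ fun l _ => Measurable.ite (hS l) measurable_const measurable_const

open Classical in
/-- The number of points of an i.i.d. sample that fall into `S` is binomial. -/
lemma pi_real_card_lt {E ι : Type*} [MeasurableSpace E] [Fintype ι] (ν : Measure E)
    [IsProbabilityMeasure ν] {S : Set E} (hS : MeasurableSet S) (M : ℕ) :
    (Measure.pi fun _ : ι => ν).real {W | (Finset.univ.filter fun l => W l ∈ S).card < M} =
      binTail (Fintype.card ι) M (ν.real S) := by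
  -- split the event according to which points fall into `S`
  set box : Finset ι → Set (ι → E) := fun T => Set.univ.pi fun l => if l ∈ T then S else Sᶜ
  have hbox : ∀ T W, W ∈ box T ↔ (Finset.univ.filter fun l => W l ∈ S) = T := by
    intro T W
    simp only [box, Set.mem_univ_pi, Finset.ext_iff, Finset.mem_filter, Finset.mem_univ, true_and]
    refine forall_congr' fun l => ?_
    by_cases h : l ∈ T <;> simp [h]
  have hmeas : ∀ T, MeasurableSet (box T) := fun T =>
    MeasurableSet.univ_pi fun l => by
      by_cases h : l ∈ T <;> simp [h, hS, hS.compl]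
  have hval : ∀ T, (Measure.pi fun _ : ι => ν).real (box T) =
      ν.real S ^ T.card * (1 - ν.real S) ^ (Fintype.card ι - T.card) := by
    intro T
    simp only [box, Measure.real, Measure.pi_pi, ENNReal.toReal_prod]
    have : ∀ l, (ν (if l ∈ T then S else Sᶜ)).toReal =
        if l ∈ T then ν.real S else 1 - ν.real S := by
      intro l
      by_cases h : l ∈ T
      · simp [h, Measure.real]
      · simpa [h, Measure.real] using probReal_compl_eq_one_sub (μ := ν) hS
    simp only [this]
    rw [Finset.prod_ite]
    simp only [Finset.prod_const, Finset.filter_univ_mem]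
    congr 2
    rw [Finset.filter_not, Finset.filter_univ_mem, Finset.card_univ_sdiff]
  have hset : {W : ι → E | (Finset.univ.filter fun l => W l ∈ S).card < M} =
      ⋃ T ∈ Finset.univ.filter (fun T : Finset ι => T.card < M), box T := by
    ext W
    simp only [Set.mem_ofPred_eq, Set.mem_iUnion, Finset.mem_filter, Finset.mem_univ, true_and,
      hbox, exists_prop, exists_eq_right']
  rw [hset, measureReal_biUnion_finset _ fun T _ => hmeas T]
  · have hsplit : (Finset.univ.filter fun T : Finset ι => T.card < M) =
        (Finset.range M).biUnion fun l => Finset.powersetCard l Finset.univ := by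
      ext T; simp [Finset.mem_powersetCard]
    rw [hsplit, Finset.sum_biUnion]
    · refine Finset.sum_congr rfl fun l _ => ?_
      rw [Finset.sum_congr rfl fun T hT => by rw [hval T, (Finset.mem_powersetCard.1 hT).2],
        Finset.sum_const, Finset.card_powersetCard, nsmul_eq_mul, Finset.card_univ, mul_assoc]
    · intro a _ b _ hab
      exact Finset.pairwise_disjoint_powersetCard _ hab
  · intro T _ T' _ hTT
    refine Set.disjoint_left.2 fun W h1 h2 => hTT ?_
    rw [← (hbox T W).1 h1, (hbox T' W).1 h2]

section Catch

variable {E : Type*} [PseudoMetricSpace E] [MeasurableSpace E]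

/-- The mass of the closed ball around `y` that has `x` on its boundary. -/
noncomputable def ballMass (ν : Measure E) (x y : E) : ℝ :=
  ν.real (Metric.closedBall y (dist x y))

lemma ballMass_nonneg (ν : Measure E) (x y : E) : 0 ≤ ballMass ν x y := measureReal_nonneg

lemma ballMass_le_one (ν : Measure E) [IsProbabilityMeasure ν] (x y : E) : ballMass ν x y ≤ 1 :=
  measureReal_le_one

open Classical in
/-- For a configuration `W`, the event that fewer than `M` of its points lie at least as close to
`y` as `x` does; in other words, `x` becomes one of the `M` nearest neighbours of `y` once it is
added to `W`. -/
def catchSet {ι : Type*} [Fintype ι] (M : ℕ) (x y : E) : Set (ι → E) :=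
  {W | (Finset.univ.filter fun l => W l ∈ Metric.closedBall y (dist x y)).card < M}

lemma pi_real_catchSet {ι : Type*} [Fintype ι] [BorelSpace E] (ν : Measure E)
    [IsProbabilityMeasure ν] (M : ℕ) (x y : E) : (Measure.pi fun _ : ι => ν).real (catchSet M x y) =
      binTail (Fintype.card ι) M (ballMass ν x y) :=
  pi_real_card_lt ν Metric.isClosed_closedBall.measurableSet M

variable [BorelSpace E] [SecondCountableTopology E]

lemma measurable_ballMass (ν : Measure E) [IsProbabilityMeasure ν] :
    Measurable fun q : E × E => ballMass ν q.1 q.2 := by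
  have hs : MeasurableSet {r : (E × E) × E | dist r.2 r.1.2 ≤ dist r.1.1 r.1.2} :=
    measurableSet_le (by fun_prop) (by fun_prop)
  exact (measurable_measure_prodMk_left (ν := ν) hs).ennreal_toReal

lemma measurableSet_ballMass_le_right (ν : Measure E) [IsProbabilityMeasure ν] (y : E) (t : ℝ) :
    MeasurableSet {x | ballMass ν x y ≤ t} := by
  have h : Measurable fun x => ballMass ν x y :=
    (measurable_ballMass ν).comp (measurable_id.prodMk measurable_const)
  exact measurableSet_le h measurable_const

lemma measurableSet_catchSet {Ω ι : Type*} [MeasurableSpace Ω] [Fintype ι] (M : ℕ)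
    {x y : Ω → E} {W : Ω → ι → E} (hx : Measurable x) (hy : Measurable y) (hW : Measurable W) :
    MeasurableSet {ω | W ω ∈ catchSet M (x ω) (y ω)} := by
  classical
  have hS : ∀ l, MeasurableSet {ω | W ω l ∈ Metric.closedBall (y ω) (dist (x ω) (y ω))} :=
    fun l => measurableSet_le (((measurable_pi_apply l).comp hW).dist hy) (hx.dist hy)
  have h := measurableSet_lt (measurable_card_filter hS) (measurable_const (a := M))
  convert h using 1
  ext ω
  simp only [catchSet, Set.mem_ofPred_eq]

end Catch

section Law

variable {E ι : Type*} [MeasurableSpace E] [Fintype ι]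
  (ρ : ι → Measure E) [∀ j, IsProbabilityMeasure (ρ j)]

lemma iIndepFun_eval : iIndepFun (fun (j : ι) (x : ι → E) => x j) (Measure.pi ρ) :=
  iIndepFun_pi (X := fun _ => id) fun _ => aemeasurable_id

lemma map_eval_pi (j : ι) : (Measure.pi ρ).map (fun x => x j) = ρ j :=
  (measurePreserving_eval ρ j).map_eq

lemma map_pair_pi {i j : ι} (hij : i ≠ j) :
    (Measure.pi ρ).map (fun x => (x i, x j)) = (ρ i).prod (ρ j) := by
  rw [((iIndepFun_eval ρ).indepFun hij).map_prod_eq_prod_map_map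
    (measurable_pi_apply i).aemeasurable (measurable_pi_apply j).aemeasurable, map_eval_pi,
    map_eval_pi]

lemma map_triple_pi {i j k : ι} (hij : i ≠ j) (hik : i ≠ k) (hjk : j ≠ k) :
    (Measure.pi ρ).map (fun x => (x i, x j, x k)) = (ρ i).prod ((ρ j).prod (ρ k)) := by
  have h := ((iIndepFun_eval ρ).indepFun_prodMk (fun i => measurable_pi_apply i) j k i
    hij.symm hik.symm).symm
  rw [h.map_prod_eq_prod_map_map (measurable_pi_apply i).aemeasurable
    ((measurable_pi_apply j).prodMk (measurable_pi_apply k)).aemeasurable, map_eval_pi,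
    map_pair_pi ρ hjk]

/-- The restriction of an independent family to a set of indices is independent. -/
lemma map_restrict_pi (A : Finset ι) :
    (Measure.pi ρ).map (fun x (l : A) => x l) = Measure.pi fun l : A => ρ l := by
  have h := (iIndepFun_eval ρ).precomp (g := fun l : A => (l : ι)) Subtype.val_injective
  have hm : ∀ l : A, AEMeasurable (fun x : ι → E => x l) (Measure.pi ρ) :=
    fun l => (measurable_pi_apply (l : ι)).aemeasurable
  rw [(iIndepFun_iff_map_fun_eq_pi_map hm).1 h]
  congr 1
  funext l
  exact map_eval_pi ρ l

/-- A function of some coordinates is independent of the remaining ones. -/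
lemma map_prodMk_restrict_pi {F : Type*} [MeasurableSpace F] {S A : Finset ι} (hSA : Disjoint S A)
    {z : (S → E) → F} (hz : Measurable z) :
    (Measure.pi ρ).map (fun x => (z (fun s : S => x s), fun l : A => x l)) =
      ((Measure.pi ρ).map fun x => z (fun s : S => x s)).prod (Measure.pi fun l : A => ρ l) := by
  have h := (iIndepFun_eval ρ).indepFun_finset S A hSA (fun i => measurable_pi_apply i)
  have h2 : IndepFun (fun x : ι → E => z (fun s : S => x s)) (fun x (l : A) => x l)
      (Measure.pi ρ) := h.comp hz measurable_id
  have hS : Measurable fun (x : ι → E) (s : S) => x s :=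
    measurable_pi_lambda _ fun s => measurable_pi_apply _
  have hA : Measurable fun (x : ι → E) (l : A) => x l :=
    measurable_pi_lambda _ fun l => measurable_pi_apply _
  have h3 : AEMeasurable (fun x : ι → E => z (fun s : S => x s)) (Measure.pi ρ) :=
    (hz.comp hS).aemeasurable
  rw [h2.map_prod_eq_prod_map_map h3 hA.aemeasurable, map_restrict_pi]

end Law

/-! ### The geometry of a convex body carrying two Lipschitz densities -/

lemma unitBallVolume_pos (m : ℕ) : 0 < unitBallVolume m :=
  ENNReal.toReal_pos (Metric.measure_closedBall_pos _ _ one_pos).ne' measure_closedBall_lt_top.ne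

lemma volume_real_closedBall {m : ℕ} (x : Cov m) {s : ℝ} (hs : 0 ≤ s) :
    (volume : Measure (Cov m)).real (Metric.closedBall x s) = unitBallVolume m * s ^ m := by
  rw [unitBallVolume, Measure.real, Measure.real, Measure.addHaar_closedBall' volume x hs,
    finrank_euclideanSpace_fin, ENNReal.toReal_mul, ENNReal.toReal_ofReal (by positivity), mul_comm]

/-- In a convex body containing a ball of radius `ρ`, the points at distance at most `ε` from the
complement have volume `O(ε)`: the homothetic copy of the body with ratio `1 - ε / ρ` consists
of points that are centres of balls of radius `ε` inside the body. -/
lemma volume_boundary_layer_le {m : ℕ} (hm : 1 ≤ m) {𝕏 : Set (Cov m)} (hc : IsCompact 𝕏)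
    (hconv : Convex ℝ 𝕏) {z : Cov m} {ρ : ℝ} (hρ : 0 < ρ) (hball : Metric.closedBall z ρ ⊆ 𝕏)
    {ε : ℝ} (hε : 0 ≤ ε) :
    (volume : Measure (Cov m)).real {x | x ∈ 𝕏 ∧ ¬ Metric.closedBall x ε ⊆ 𝕏} ≤
      m / ρ * (volume : Measure (Cov m)).real 𝕏 * ε := by
  have hfin : (volume : Measure (Cov m)) 𝕏 ≠ ⊤ := hc.measure_lt_top.ne
  have hm' : (1 : ℝ) ≤ m := by exact_mod_cast hm
  set s := ε / ρ with hs
  have hεs : ε = s * ρ := by rw [hs]; field_simp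
  have hs0 : 0 ≤ s := by positivity
  rcases le_or_gt 1 s with h1 | h1
  · calc _ ≤ (volume : Measure (Cov m)).real 𝕏 := measureReal_mono (fun x hx => hx.1) hfin
      _ ≤ (m * s) * (volume : Measure (Cov m)).real 𝕏 :=
        le_mul_of_one_le_left measureReal_nonneg (by nlinarith)
      _ = _ := by rw [hs]; ring
  · set T := AffineMap.homothety z (1 - s) '' 𝕏
    have hzX : z ∈ 𝕏 := hball (Metric.mem_closedBall_self hρ.le)
    have hT : ∀ x ∈ T, Metric.closedBall x ε ⊆ 𝕏 := by
      rintro x ⟨p, hp, rfl⟩ y hy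
      rcases hs0.eq_or_lt with h0 | h0
      · have : ε = 0 := by rw [hεs, ← h0, zero_mul]
        rw [this, Metric.closedBall_zero, Set.mem_singleton_iff] at hy
        rw [hy, ← h0]; simpa using hp
      · set v := y - AffineMap.homothety z (1 - s) p
        have hv : ‖v‖ ≤ s * ρ := by
          rw [← hεs, ← dist_eq_norm]; exact hy
        have hq : z + s⁻¹ • v ∈ 𝕏 := by
          refine hball ?_
          rw [mem_closedBall_iff_norm, add_sub_cancel_left, norm_smul, Real.norm_of_nonneg
            (by positivity), inv_mul_le_iff₀ h0]
          exact hv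
        have := hconv hp hq (by linarith : 0 ≤ 1 - s) hs0 (by ring)
        convert this using 1
        have hy' : y = AffineMap.homothety z (1 - s) p + v := by simp [v]
        rw [hy', smul_add, smul_smul, mul_inv_cancel₀ h0.ne', one_smul,
          AffineMap.homothety_apply, vsub_eq_sub, vadd_eq_add, smul_sub, sub_smul, one_smul,
          sub_smul, one_smul]
        abel
    have hTX : T ⊆ 𝕏 := fun x hx => hT x hx (Metric.mem_closedBall_self hε)
    have hTm : MeasurableSet T :=
      (hc.image (AffineMap.homothety_continuous z (1 - s))).isClosed.measurableSet
    have hTv : (volume : Measure (Cov m)).real T =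
        (1 - s) ^ m * (volume : Measure (Cov m)).real 𝕏 := by
      rw [Measure.real, Measure.addHaar_image_homothety, finrank_euclideanSpace_fin,
        ENNReal.toReal_mul, ENNReal.toReal_ofReal (abs_nonneg _),
        abs_of_nonneg (pow_nonneg (by linarith) m), Measure.real]
    have hbern : 1 - m * s ≤ (1 - s) ^ m := by
      have := one_add_mul_le_pow (a := -s) (by linarith) m
      rw [← sub_eq_add_neg] at this
      linarith
    calc _ ≤ (volume : Measure (Cov m)).real (𝕏 \ T) :=
          measureReal_mono (fun x hx => ⟨hx.1, fun h => hx.2 (hT x h)⟩)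
            (measure_ne_top_of_subset Set.sdiff_subset hfin)
      _ = (volume : Measure (Cov m)).real 𝕏 - (volume : Measure (Cov m)).real T :=
          measureReal_sdiff hTX hTm hfin
      _ ≤ (m * s) * (volume : Measure (Cov m)).real 𝕏 := by
          rw [hTv]
          nlinarith [measureReal_nonneg (μ := (volume : Measure (Cov m))) (s := 𝕏)]
      _ = _ := by rw [hs]; ring

/-- Two probability measures `ν`, `ν'` carried by `𝕏`, with densities `g`, `g'` that lie in
`[l, u]` and are `L`-Lipschitz on `𝕏`, where the balls centred in `𝕏` keep a fraction `a` of
their volume inside `𝕏`, and the points at distance at most `ε` from the outside of `𝕏` have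
volume at most `b * ε`. -/
structure DensityPair {m : ℕ} (𝕏 : Set (Cov m)) (ν ν' : Measure (Cov m)) (g g' : Cov m → ℝ)
    (l u L a b : ℝ) : Prop where
  one_le_dim : 1 ≤ m
  l_pos : 0 < l
  L_pos : 0 < L
  a_pos : 0 < a
  b_nonneg : 0 ≤ b
  compact : IsCompact 𝕏
  prob : IsProbabilityMeasure ν
  prob' : IsProbabilityMeasure ν'
  meas : Measurable g
  meas' : Measurable g'
  dens : ν = volume.withDensity fun x => ENNReal.ofReal (g x)
  dens' : ν' = volume.withDensity fun x => ENNReal.ofReal (g' x)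
  null : ν 𝕏ᶜ = 0
  null' : ν' 𝕏ᶜ = 0
  bounds : ∀ x ∈ 𝕏, l ≤ g x ∧ g x ≤ u
  bounds' : ∀ x ∈ 𝕏, l ≤ g' x ∧ g' x ≤ u
  lip : ∀ x ∈ 𝕏, ∀ z ∈ 𝕏, |g z - g x| ≤ L * dist x z
  lip' : ∀ x ∈ 𝕏, ∀ z ∈ 𝕏, |g' z - g' x| ≤ L * dist x z
  ball : ∀ z ∈ 𝕏, ∀ δ : ℝ, 0 < δ → δ ≤ Metric.diam 𝕏 →
    ENNReal.ofReal a * volume (Metric.closedBall z δ) ≤ volume (Metric.closedBall z δ ∩ 𝕏)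
  layer : ∀ ε : ℝ, 0 ≤ ε →
    (volume : Measure (Cov m)).real {x | x ∈ 𝕏 ∧ ¬ Metric.closedBall x ε ⊆ 𝕏} ≤ b * ε

section WithDensity

variable {E : Type*} [MeasurableSpace E] {ν vol : Measure E} {g : E → ℝ}

lemma withDensity_real_le (hd : ν = vol.withDensity fun x => ENNReal.ofReal (g x)) {T : Set E}
    (hT : MeasurableSet T) (hfin : vol T ≠ ⊤) {c : ℝ} (hc : 0 ≤ c) (hg : ∀ x ∈ T, g x ≤ c) :
    ν.real T ≤ c * vol.real T := by
  have h : ν T ≤ ENNReal.ofReal c * vol T := by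
    rw [hd, withDensity_apply _ hT, ← setLIntegral_const]
    exact setLIntegral_mono measurable_const fun x hx => ENNReal.ofReal_le_ofReal (hg x hx)
  have := ENNReal.toReal_mono (ENNReal.mul_ne_top ENNReal.ofReal_ne_top hfin) h
  rwa [ENNReal.toReal_mul, ENNReal.toReal_ofReal hc] at this

lemma le_withDensity_real [IsFiniteMeasure ν]
    (hd : ν = vol.withDensity fun x => ENNReal.ofReal (g x)) (hgm : Measurable g) {T : Set E}
    (hT : MeasurableSet T) {c : ℝ} (hc : 0 ≤ c) (hg : ∀ x ∈ T, c ≤ g x) :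
    c * vol.real T ≤ ν.real T := by
  have h : ENNReal.ofReal c * vol T ≤ ν T := by
    rw [hd, withDensity_apply _ hT, ← setLIntegral_const]
    exact setLIntegral_mono hgm.ennreal_ofReal fun x hx => ENNReal.ofReal_le_ofReal (hg x hx)
  have := ENNReal.toReal_mono (measure_ne_top ν T) h
  rwa [ENNReal.toReal_mul, ENNReal.toReal_ofReal hc] at this

end WithDensity

namespace DensityPair

variable {m : ℕ} {𝕏 : Set (Cov m)} {ν ν' : Measure (Cov m)} {g g' : Cov m → ℝ}
  {l u L a b : ℝ}

lemma u_pos (h : DensityPair 𝕏 ν ν' g g' l u L a b) : 0 < u := by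
  have := h.prob
  have hne : 𝕏.Nonempty := by
    by_contra hne
    rw [Set.not_nonempty_iff_eq_empty] at hne
    have := h.null
    simp [hne] at this
  obtain ⟨x, hx⟩ := hne
  exact h.l_pos.trans_le ((h.bounds x hx).1.trans (h.bounds x hx).2)

lemma measurableSet (h : DensityPair 𝕏 ν ν' g g' l u L a b) : MeasurableSet 𝕏 :=
  h.compact.isClosed.measurableSet

lemma real_inter (h : DensityPair 𝕏 ν ν' g g' l u L a b) (T : Set (Cov m)) :
    ν.real (T ∩ 𝕏) = ν.real T := by
  rw [Measure.real, Measure.real, measure_inter_conull h.null]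

lemma real_inter' (h : DensityPair 𝕏 ν ν' g g' l u L a b) (T : Set (Cov m)) :
    ν'.real (T ∩ 𝕏) = ν'.real T := by
  rw [Measure.real, Measure.real, measure_inter_conull h.null']

/-- Balls centred in `𝕏` have mass bounded below, because they keep a fraction of their volume
inside `𝕏`. -/
lemma mul_pow_dist_le_ballMass (h : DensityPair 𝕏 ν ν' g g' l u L a b) {x y : Cov m}
    (hx : x ∈ 𝕏) (hy : y ∈ 𝕏) : l * a * unitBallVolume m * dist x y ^ m ≤ ballMass ν x y := by
  have := h.prob
  have hm : m ≠ 0 := by have := h.one_le_dim; omega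
  rcases dist_nonneg.eq_or_lt (a := (0 : ℝ)) (b := dist x y) with h0 | h0
  · rw [← h0]; simpa [hm] using ballMass_nonneg ν x y
  have hball := h.ball y hy (dist x y) h0 (Metric.dist_le_diam_of_mem h.compact.isBounded hx hy)
  have hfin : (volume : Measure (Cov m)) (Metric.closedBall y (dist x y) ∩ 𝕏) ≠ ⊤ :=
    measure_ne_top_of_subset Set.inter_subset_left measure_closedBall_lt_top.ne
  have h1 := ENNReal.toReal_mono hfin hball
  rw [ENNReal.toReal_mul, ENNReal.toReal_ofReal h.a_pos.le] at h1
  have h2 := le_withDensity_real h.dens h.meas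
    (Metric.isClosed_closedBall.measurableSet.inter h.measurableSet) h.l_pos.le
    (T := Metric.closedBall y (dist x y) ∩ 𝕏) fun z hz => (h.bounds z hz.2).1
  rw [h.real_inter] at h2
  have h3 := volume_real_closedBall y h0.le
  simp only [Measure.real] at h2 h3
  rw [h3] at h1
  calc _ = l * (a * (unitBallVolume m * dist x y ^ m)) := by ring
    _ ≤ _ := mul_le_mul_of_nonneg_left h1 h.l_pos.le
    _ ≤ _ := h2

end DensityPair

/-- The radius at which the lower bound `l * a * V_m * s ^ m` for the mass of a ball of radius
`s` equals `t`. -/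
noncomputable def massRadius (m : ℕ) (l a t : ℝ) : ℝ :=
  (t / (l * a * unitBallVolume m)) ^ (1 / (m : ℝ))

lemma massRadius_nonneg {m : ℕ} {l a t : ℝ} (hl : 0 < l) (ha : 0 < a) (ht : 0 ≤ t) :
    0 ≤ massRadius m l a t := by
  have := unitBallVolume_pos m
  unfold massRadius; positivity

lemma massRadius_pow {m : ℕ} (hm : 1 ≤ m) {l a t : ℝ} (hl : 0 < l) (ha : 0 < a) (ht : 0 ≤ t) :
    massRadius m l a t ^ m = t / (l * a * unitBallVolume m) := by
  have := unitBallVolume_pos m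
  rw [massRadius, one_div]
  exact Real.rpow_inv_natCast_pow (by positivity) (by omega)

lemma massRadius_mono {m : ℕ} {l a t s : ℝ} (hl : 0 < l) (ha : 0 < a) (ht : 0 ≤ t) (hts : t ≤ s) :
    massRadius m l a t ≤ massRadius m l a s := by
  have := unitBallVolume_pos m
  unfold massRadius
  gcongr

namespace DensityPair

variable {m : ℕ} {𝕏 : Set (Cov m)} {ν ν' : Measure (Cov m)} {g g' : Cov m → ℝ}
  {l u L a b : ℝ}

/-- If the ball around `y` through `x` has mass at most `t`, then it has radius `O(t ^ (1 / m))`;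
this localizes the catchment region of `x`. -/
lemma dist_le_massRadius (h : DensityPair 𝕏 ν ν' g g' l u L a b) {x y : Cov m}
    (hx : x ∈ 𝕏) (hy : y ∈ 𝕏) {t : ℝ} (ht : 0 ≤ t) (hxy : ballMass ν x y ≤ t) :
    dist x y ≤ massRadius m l a t := by
  have hV := unitBallVolume_pos m
  have hκ : 0 < l * a * unitBallVolume m := mul_pos (mul_pos h.l_pos h.a_pos) hV
  refine le_of_pow_le_pow_left₀ (n := m) (by have := h.one_le_dim; omega)
    (massRadius_nonneg h.l_pos h.a_pos ht) ?_
  rw [massRadius_pow h.one_le_dim h.l_pos h.a_pos ht, le_div_iff₀ hκ, mul_comm]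
  exact (h.mul_pow_dist_le_ballMass hx hy).trans hxy

/-- The crude bound for the mass of a catchment region, valid up to the boundary of `𝕏`. -/
lemma catchment_le (h : DensityPair 𝕏 ν ν' g g' l u L a b) {x : Cov m} (hx : x ∈ 𝕏) {t : ℝ}
    (ht : 0 ≤ t) : ν'.real {y | ballMass ν x y ≤ t} ≤ u / (l * a) * t := by
  have := h.prob
  have := h.prob'
  have hV := unitBallVolume_pos m
  have hl := h.l_pos
  have ha := h.a_pos
  have hu := h.u_pos
  rw [← h.real_inter']
  have hsub : {y | ballMass ν x y ≤ t} ∩ 𝕏 ⊆ Metric.closedBall x (massRadius m l a t) ∩ 𝕏 := by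
    rintro y ⟨hy, hyX⟩
    refine ⟨?_, hyX⟩
    rw [Metric.mem_closedBall, dist_comm]
    exact h.dist_le_massRadius hx hyX ht hy
  have hfin : (volume : Measure (Cov m)) (Metric.closedBall x (massRadius m l a t)) ≠ ⊤ :=
    measure_closedBall_lt_top.ne
  calc _ ≤ ν'.real (Metric.closedBall x (massRadius m l a t) ∩ 𝕏) := measureReal_mono hsub
    _ ≤ u * (volume : Measure (Cov m)).real (Metric.closedBall x (massRadius m l a t) ∩ 𝕏) :=
      withDensity_real_le h.dens' (Metric.isClosed_closedBall.measurableSet.inter h.measurableSet)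
        (measure_ne_top_of_subset Set.inter_subset_left hfin) hu.le
        fun z hz => (h.bounds' z hz.2).2
    _ ≤ u * (volume : Measure (Cov m)).real (Metric.closedBall x (massRadius m l a t)) := by
      gcongr
      exact Set.inter_subset_left
    _ = _ := by
      rw [volume_real_closedBall x (massRadius_nonneg hl ha ht),
        massRadius_pow h.one_le_dim hl ha ht]
      field_simp

/-- The constant in the interior bound for the mass of a catchment region. -/
noncomputable def interiorConst (m : ℕ) (l u L a : ℝ) : ℝ :=
  (2 * L * u / (l * a) + L + 2 * L ^ 2 * massRadius m l a 1 / (l * a)) / l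

/-- Away from the boundary, the region of those `y` for which the ball around `y` through `x` has
mass at most `t` is contained in a ball around `x` of volume about `t / g x`, and hence its
`ν'`-mass is about `t * (g' x / g x)`. -/
lemma catchment_le_of_interior (h : DensityPair 𝕏 ν ν' g g' l u L a b) {x : Cov m} {t : ℝ}
    (ht : 0 ≤ t) (ht1 : t ≤ 1) (hx : Metric.closedBall x (2 * massRadius m l a t) ⊆ 𝕏) :
    ν'.real {y | ballMass ν x y ≤ t} ≤
      t * (g' x / g x) + interiorConst m l u L a * massRadius m l a t * t := by
  have := h.prob
  have := h.prob'
  have hV := unitBallVolume_pos m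
  have hl := h.l_pos
  have ha := h.a_pos
  have hu := h.u_pos
  have hL := h.L_pos
  have hm : m ≠ 0 := by have := h.one_le_dim; omega
  set V := unitBallVolume m with hVdef
  set σ := massRadius m l a t with hσ
  have hσ0 : 0 ≤ σ := massRadius_nonneg hl ha ht
  have hσpow : σ ^ m = t / (l * a * V) := massRadius_pow h.one_le_dim hl ha ht
  have hxX : x ∈ 𝕏 := hx (Metric.mem_closedBall_self (by positivity))
  have hgx : 0 < g x := hl.trans_le (h.bounds x hxX).1
  have hg'x : 0 < g' x := hl.trans_le (h.bounds' x hxX).1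
  set q := (t + 2 * L * σ * t / (l * a)) / (g x * V) with hq
  have hq0 : 0 ≤ q := by positivity
  set s := q ^ (1 / (m : ℝ)) with hs
  have hs0 : 0 ≤ s := by positivity
  have hspow : s ^ m = q := by
    rw [hs, one_div]; exact Real.rpow_inv_natCast_pow hq0 hm
  have hsub : {y | ballMass ν x y ≤ t} ∩ 𝕏 ⊆
      Metric.closedBall x s ∩ Metric.closedBall x σ ∩ 𝕏 := by
    rintro y ⟨hy, hyX⟩
    have hyσ : dist x y ≤ σ := h.dist_le_massRadius hxX hyX ht hy
    refine ⟨⟨?_, by rwa [Metric.mem_closedBall, dist_comm]⟩, hyX⟩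
    rw [Metric.mem_closedBall, dist_comm]
    refine le_of_pow_le_pow_left₀ hm hs0 ?_
    rw [hspow, hq, le_div_iff₀ (by positivity)]
    set d := dist x y
    have hd0 : 0 ≤ d := dist_nonneg
    have hBsub : Metric.closedBall y d ⊆ 𝕏 := by
      refine fun z hz => hx ?_
      rw [Metric.mem_closedBall] at hz ⊢
      have := dist_triangle z y x
      rw [dist_comm y x] at this
      linarith
    have hdens : (g x - 2 * L * d) * (V * d ^ m) ≤ t := by
      rcases le_or_gt (g x - 2 * L * d) 0 with hneg | hpos
      · exact (mul_nonpos_of_nonpos_of_nonneg hneg (by positivity)).trans ht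
      · refine le_trans ?_ hy
        rw [hVdef, ← volume_real_closedBall y hd0]
        refine le_withDensity_real h.dens h.meas Metric.isClosed_closedBall.measurableSet hpos.le
          fun z hz => ?_
        have h1 := abs_le.1 (h.lip x hxX z (hBsub hz))
        have h2 : dist x z ≤ 2 * d := by
          have := dist_triangle x y z
          rw [Metric.mem_closedBall, dist_comm] at hz
          linarith
        nlinarith [h1.1]
    have hdm : V * d ^ m ≤ t / (l * a) := by
      have : d ^ m ≤ σ ^ m := pow_le_pow_left₀ hd0 hyσ m
      rw [hσpow] at this
      calc V * d ^ m ≤ V * (t / (l * a * V)) := by gcongr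
        _ = _ := by field_simp
    have : 2 * L * d * (V * d ^ m) ≤ 2 * L * σ * (t / (l * a)) := by gcongr
    calc d ^ m * (g x * V) = (g x - 2 * L * d) * (V * d ^ m) + 2 * L * d * (V * d ^ m) := by ring
      _ ≤ t + 2 * L * σ * (t / (l * a)) := add_le_add hdens this
      _ = _ := by ring
  rw [← h.real_inter']
  have hfin : (volume : Measure (Cov m)) (Metric.closedBall x s) ≠ ⊤ :=
    measure_closedBall_lt_top.ne
  have hbound : ν'.real {y | ballMass ν x y ≤ t} ≤ (g' x + L * σ) * (V * q) := by
    rw [← h.real_inter']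
    calc _ ≤ ν'.real (Metric.closedBall x s ∩ Metric.closedBall x σ ∩ 𝕏) := measureReal_mono hsub
      _ ≤ (g' x + L * σ) * (volume : Measure (Cov m)).real
            (Metric.closedBall x s ∩ Metric.closedBall x σ ∩ 𝕏) := by
        refine withDensity_real_le h.dens' ((Metric.isClosed_closedBall.measurableSet.inter
          Metric.isClosed_closedBall.measurableSet).inter h.measurableSet)
          (measure_ne_top_of_subset (fun z hz => hz.1.1) hfin) (by positivity) fun z hz => ?_
        have h1 := abs_le.1 (h.lip' x hxX z hz.2)
        have h2 : dist x z ≤ σ := by rw [dist_comm]; exact hz.1.2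
        nlinarith [h1.2]
      _ ≤ (g' x + L * σ) * (volume : Measure (Cov m)).real (Metric.closedBall x s) := by
        gcongr
        exact fun z hz => hz.1.1
      _ = _ := by rw [volume_real_closedBall x hs0, hspow]
  rw [h.real_inter']
  refine hbound.trans ?_
  have hσ1 : σ ≤ massRadius m l a 1 := massRadius_mono hl ha ht ht1
  set σ₁ := massRadius m l a 1
  have e1 : (g' x + L * σ) * (V * q) = t * (g' x / g x) +
      (2 * L * g' x / (l * a) + L + 2 * L ^ 2 * σ / (l * a)) / g x * (σ * t) := by
    rw [hq]; field_simp; ring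
  have e2 : (2 * L * g' x / (l * a) + L + 2 * L ^ 2 * σ / (l * a)) / g x ≤
      interiorConst m l u L a := by
    unfold interiorConst
    have := (h.bounds' x hxX).2
    have h3 := (h.bounds x hxX).1
    have hσ₁ : 0 ≤ σ₁ := massRadius_nonneg hl ha zero_le_one
    exact div_le_div₀ (by positivity) (by gcongr) hl h3
  rw [e1, mul_assoc (interiorConst m l u L a)]
  gcongr

end DensityPair

/-! ### The distribution of the mass of a random ball -/

lemma continuous_real_closedBall {E : Type*} [PseudoMetricSpace E] [MeasurableSpace E]
    [BorelSpace E] (ν : Measure E) [IsFiniteMeasure ν] (y : E)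
    (hsph : ∀ s, ν (Metric.sphere y s) = 0) :
    Continuous fun s => ν.real (Metric.closedBall y s) := by
  have hF : (fun s => ν.real (Metric.closedBall y s)) =
      fun s => ∫ x, (Metric.closedBall y s).indicator (1 : E → ℝ) x ∂ν := by
    funext s
    rw [integral_indicator_one Metric.isClosed_closedBall.measurableSet]
  rw [hF, continuous_iff_continuousAt]
  intro s₀
  refine continuousAt_of_dominated (bound := fun _ => 1) ?_ ?_ (integrable_const _) ?_
  · exact Eventually.of_forall fun s => ((measurable_const.indicator
      Metric.isClosed_closedBall.measurableSet).aestronglyMeasurable)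
  · refine Eventually.of_forall fun s => Eventually.of_forall fun x => ?_
    by_cases h : x ∈ Metric.closedBall y s <;> simp [h]
  · have : ∀ᵐ x ∂ν, x ∉ Metric.sphere y s₀ := measure_eq_zero_iff_ae_notMem.1 (hsph s₀)
    filter_upwards [this] with x hx
    rw [Metric.mem_sphere] at hx
    rcases lt_or_gt_of_ne hx with h | h
    · refine (continuousAt_const (y := (1 : ℝ))).congr ?_
      filter_upwards [lt_mem_nhds h] with s hs
      rw [Set.indicator_of_mem (Metric.mem_closedBall.2 hs.le), Pi.one_apply]
    · refine (continuousAt_const (y := (0 : ℝ))).congr ?_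
      filter_upwards [gt_mem_nhds h] with s hs
      rw [Set.indicator_of_notMem (by rw [Metric.mem_closedBall]; linarith)]

/-- The mass of the ball around `y` through a random point is uniformly distributed. -/
lemma real_ballMass_le_eq {E : Type*} [PseudoMetricSpace E] [MeasurableSpace E]
    [BorelSpace E] (ν : Measure E) [IsProbabilityMeasure ν] (y : E)
    (hsph : ∀ s, ν (Metric.sphere y s) = 0) {D : ℝ} (hD : ν (Metric.closedBall y D)ᶜ = 0)
    {t : ℝ} (ht : 0 ≤ t) (ht1 : t ≤ 1) : ν.real {x | ballMass ν x y ≤ t} = t := by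
  rcases ht1.eq_or_lt with rfl | ht1
  · have : {x | ballMass ν x y ≤ 1} = Set.univ := by
      ext x; simpa using ballMass_le_one ν x y
    rw [this, probReal_univ]
  set F := fun s => ν.real (Metric.closedBall y s) with hF
  have hFc : Continuous F := continuous_real_closedBall ν y hsph
  have hmono : Monotone F := fun s s' hs =>
    measureReal_mono (Metric.closedBall_subset_closedBall hs)
  have hF0 : F (-1) = 0 := by simp [hF]
  have hFD : F D = 1 := by
    have h := probReal_compl_eq_one_sub (μ := ν)
      (Metric.isClosed_closedBall (x := y) (ε := D)).measurableSet
    rw [Measure.real, hD, ENNReal.toReal_zero] at h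
    simp only [hF]; linarith
  have hD1 : -1 ≤ D := by
    by_contra hlt
    have := hmono (not_le.1 hlt).le
    rw [hF0, hFD] at this
    linarith
  obtain ⟨s₁, hs₁, hFs₁⟩ : t ∈ F '' Set.Icc (-1) D :=
    intermediate_value_Icc hD1 hFc.continuousOn ⟨by rw [hF0]; exact ht, by rw [hFD]; exact ht1.le⟩
  -- `s₀` is the `t`-quantile of the distance to `y`, the largest one
  obtain ⟨s₀, hs₀, hmax⟩ := (isCompact_Icc.inter_right
    (isClosed_le hFc continuous_const)).exists_isGreatest (s := Set.Icc (-1) D ∩ {s | F s ≤ t})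
    ⟨s₁, hs₁, hFs₁.le⟩
  have hFs₀ : F s₀ = t := le_antisymm hs₀.2 (hFs₁ ▸ hmono (hmax ⟨hs₁, hFs₁.le⟩))
  have hset : {x | ballMass ν x y ≤ t} ∩ Metric.closedBall y D =
      Metric.closedBall y s₀ ∩ Metric.closedBall y D := by
    ext x
    simp only [Set.mem_inter_iff, Set.mem_ofPred_eq, Metric.mem_closedBall, and_congr_left_iff]
    intro hx
    refine ⟨fun h => hmax ⟨⟨by linarith [dist_nonneg (x := x) (y := y)], hx⟩, h⟩, fun h => ?_⟩
    exact (hmono h).trans hs₀.2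
  have h1 : ν.real ({x | ballMass ν x y ≤ t} ∩ Metric.closedBall y D) =
      ν.real {x | ballMass ν x y ≤ t} := by
    rw [Measure.real, Measure.real, measure_inter_conull hD]
  have h2 : ν.real (Metric.closedBall y s₀ ∩ Metric.closedBall y D) = F s₀ := by
    rw [Measure.real, measure_inter_conull hD]; rfl
  rw [← h1, hset, h2, hFs₀]

namespace DensityPair

variable {m : ℕ} {𝕏 : Set (Cov m)} {ν ν' : Measure (Cov m)} {g g' : Cov m → ℝ}
  {l u L a b : ℝ}

/-- Spheres are null sets, so the ball mass of a random point is uniformly distributed. -/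
lemma real_ballMass_le (h : DensityPair 𝕏 ν ν' g g' l u L a b) {y : Cov m} {t : ℝ}
    (ht : 0 ≤ t) (ht1 : t ≤ 1) : ν.real {x | ballMass ν x y ≤ t} = t := by
  have := h.prob
  have : Nontrivial (Cov m) := Module.nontrivial_of_finrank_pos (R := ℝ) (by
    rw [finrank_euclideanSpace_fin]; exact h.one_le_dim)
  obtain ⟨D, hD⟩ := h.compact.isBounded.subset_closedBall y
  refine real_ballMass_le_eq ν y (fun s => ?_) (measure_mono_null (Set.compl_subset_compl.2 hD)
    h.null) ht ht1
  have hac : ν ≪ volume := h.dens ▸ withDensity_absolutelyContinuous _ _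
  exact hac (Measure.addHaar_sphere volume y s)

/-- The density ratio `g' / g` on `𝕏`, extended by zero. -/
noncomputable def ratio (𝕏 : Set (Cov m)) (g g' : Cov m → ℝ) : Cov m → ℝ :=
  𝕏.indicator fun x => g' x / g x

lemma measurable_ratio (h : DensityPair 𝕏 ν ν' g g' l u L a b) : Measurable (ratio 𝕏 g g') :=
  (h.meas'.div h.meas).indicator h.measurableSet

lemma ratio_nonneg (h : DensityPair 𝕏 ν ν' g g' l u L a b) (x : Cov m) :
    0 ≤ ratio 𝕏 g g' x := by
  refine Set.indicator_nonneg (fun x hx => ?_) x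
  exact div_nonneg (h.l_pos.le.trans (h.bounds' x hx).1) (h.l_pos.le.trans (h.bounds x hx).1)

lemma ratio_le (h : DensityPair 𝕏 ν ν' g g' l u L a b) (x : Cov m) :
    ratio 𝕏 g g' x ≤ u / l := by
  have hu := h.u_pos
  have hl := h.l_pos
  refine Set.indicator_apply_le' (fun hx => ?_) fun _ => by positivity
  exact div_le_div₀ hu.le (h.bounds' x hx).2 hl (h.bounds x hx).1

/-- The density ratio is Lipschitz on `𝕏`. -/
lemma ratio_sub_le (h : DensityPair 𝕏 ν ν' g g' l u L a b) {x y : Cov m} (hx : x ∈ 𝕏)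
    (hy : y ∈ 𝕏) :
    ratio 𝕏 g g' y - (L / l + u * L / l ^ 2) * dist x y ≤ ratio 𝕏 g g' x := by
  have hl := h.l_pos
  have hL := h.L_pos
  have hu := h.u_pos
  have hgx : 0 < g x := hl.trans_le (h.bounds x hx).1
  have hgy : 0 < g y := hl.trans_le (h.bounds y hy).1
  have h1 : g' y ≤ g' x + L * dist x y := by linarith [(abs_le.1 (h.lip' x hx y hy)).2]
  have h2 : g x ≤ g y + L * dist x y := by
    linarith [(abs_le.1 (h.lip x hx y hy)).1]
  have hd : 0 ≤ dist x y := dist_nonneg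
  rw [ratio, Set.indicator_of_mem hx, Set.indicator_of_mem hy]
  have e : g' y / g y - g' x / g x = (g' y - g' x) / g y + g' x * (g x - g y) / (g x * g y) := by
    field_simp; ring
  have e1 : (g' y - g' x) / g y ≤ L * dist x y / l :=
    div_le_div₀ (by positivity) (by linarith) hl (h.bounds y hy).1
  have e2 : g' x * (g x - g y) / (g x * g y) ≤ u * (L * dist x y) / (l * l) := by
    refine div_le_div₀ (by positivity) ?_ (by positivity)
      (mul_le_mul (h.bounds x hx).1 (h.bounds y hy).1 hl.le hgx.le)
    have : 0 < g' x := hl.trans_le (h.bounds' x hx).1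
    calc g' x * (g x - g y) ≤ g' x * (L * dist x y) :=
          mul_le_mul_of_nonneg_left (by linarith) this.le
      _ ≤ _ := mul_le_mul_of_nonneg_right (h.bounds' x hx).2 (by positivity)
  have e3 : (L / l + u * L / l ^ 2) * dist x y =
      L * dist x y / l + u * (L * dist x y) / (l * l) := by
    field_simp
  rw [e3]; linarith

lemma ae_mem (h : DensityPair 𝕏 ν ν' g g' l u L a b) : ∀ᵐ x ∂ν, x ∈ 𝕏 :=
  ae_iff.2 h.null

lemma ae_mem' (h : DensityPair 𝕏 ν ν' g g' l u L a b) : ∀ᵐ x ∂ν', x ∈ 𝕏 :=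
  ae_iff.2 h.null'

lemma measurableSet_closedBall_subset {𝕏 : Set (Cov m)} (hc : IsClosed 𝕏) (ε : ℝ) :
    MeasurableSet {x | Metric.closedBall x ε ⊆ 𝕏} := by
  have : {x | Metric.closedBall x ε ⊆ 𝕏} =
      ⋂ v ∈ Metric.closedBall (0 : Cov m) ε, (fun x => x + v) ⁻¹' 𝕏 := by
    ext x
    simp only [Set.mem_ofPred_eq, Set.mem_iInter, Set.mem_preimage]
    refine ⟨fun hx v hv => hx (by simpa [dist_eq_norm] using hv), fun hx y hy => ?_⟩
    simpa using hx (y - x) (by simpa [dist_eq_norm] using hy)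
  rw [this]
  exact (isClosed_biInter fun v _ => hc.preimage (by fun_prop)).measurableSet

/-- The layer near the boundary of `𝕏`, where the interior bound for catchment regions fails, has
small mass. -/
lemma real_layer_le (h : DensityPair 𝕏 ν ν' g g' l u L a b) {ε : ℝ} (hε : 0 ≤ ε) :
    ν.real {x | ¬ Metric.closedBall x ε ⊆ 𝕏} ≤ u * (b * ε) := by
  have := h.prob
  have hm : MeasurableSet {x | ¬ Metric.closedBall x ε ⊆ 𝕏} :=
    (measurableSet_closedBall_subset h.compact.isClosed ε).compl
  rw [← h.real_inter]
  have hs : {x | ¬ Metric.closedBall x ε ⊆ 𝕏} ∩ 𝕏 =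
      {x | x ∈ 𝕏 ∧ ¬ Metric.closedBall x ε ⊆ 𝕏} := by ext x; simp [and_comm]
  refine (withDensity_real_le h.dens (hm.inter h.measurableSet)
    (measure_ne_top_of_subset Set.inter_subset_right h.compact.measure_lt_top.ne) h.u_pos.le
    fun x hx => (h.bounds x hx.2).2).trans ?_
  rw [hs]
  exact mul_le_mul_of_nonneg_left (h.layer ε hε) h.u_pos.le

lemma measurable_catchment (ν ν' : Measure (Cov m)) [IsProbabilityMeasure ν]
    [IsProbabilityMeasure ν'] (t : ℝ) :
    Measurable fun x => ν'.real {y | ballMass ν x y ≤ t} := by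
  have hs : MeasurableSet {q : Cov m × Cov m | ballMass ν q.1 q.2 ≤ t} :=
    measurableSet_le (measurable_ballMass ν) measurable_const
  exact (measurable_measure_prodMk_left (ν := ν') hs).ennreal_toReal

/-- The constant in the bound for the second moment of the mass of a catchment region. -/
noncomputable def squareConst (m : ℕ) (l u L a b : ℝ) : ℝ :=
  2 * (u / l) * interiorConst m l u L a + interiorConst m l u L a ^ 2 * massRadius m l a 1 +
    (u / (l * a)) ^ 2 * (u * (b * 2))

lemma interiorConst_nonneg (h : DensityPair 𝕏 ν ν' g g' l u L a b) :
    0 ≤ interiorConst m l u L a := by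
  have hl := h.l_pos
  have ha := h.a_pos
  have hu := h.u_pos
  have hL := h.L_pos
  have := massRadius_nonneg (m := m) hl ha zero_le_one
  unfold interiorConst; positivity

lemma squareConst_nonneg (h : DensityPair 𝕏 ν ν' g g' l u L a b) :
    0 ≤ squareConst m l u L a b := by
  have hl := h.l_pos
  have ha := h.a_pos
  have hu := h.u_pos
  have := h.b_nonneg
  have := h.interiorConst_nonneg
  have := massRadius_nonneg (m := m) hl ha zero_le_one
  unfold squareConst; positivity

/-- The second moment of the catchment mass: the interior bound holds outside the boundary layer of
width `2 * massRadius m l a t`, and the crude bound inside it. -/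
lemma integral_catchment_sq_le (h : DensityPair 𝕏 ν ν' g g' l u L a b) {t : ℝ}
    (ht : 0 ≤ t) (ht1 : t ≤ 1) :
    ∫ x, ν'.real {y | ballMass ν x y ≤ t} ^ 2 ∂ν ≤
      (∫ x, ratio 𝕏 g g' x ^ 2 ∂ν) * t ^ 2 +
        squareConst m l u L a b * massRadius m l a t * t ^ 2 := by
  have := h.prob
  have := h.prob'
  have hl := h.l_pos
  have ha := h.a_pos
  have hu := h.u_pos
  set σ := massRadius m l a t
  set K := interiorConst m l u L a with hK
  have hK0 : 0 ≤ K := h.interiorConst_nonneg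
  have hσ0 : 0 ≤ σ := massRadius_nonneg hl ha ht
  have hσ1 : σ ≤ massRadius m l a 1 := massRadius_mono hl ha ht ht1
  set c := 2 * (u / l) * K + K ^ 2 * massRadius m l a 1 with hc
  set B := {x | ¬ Metric.closedBall x (2 * σ) ⊆ 𝕏} with hB
  have hBm : MeasurableSet B := (measurableSet_closedBall_subset h.compact.isClosed _).compl
  have hr2 : Integrable (fun x => ratio 𝕏 g g' x ^ 2) ν := by
    refine Integrable.of_bound (h.measurable_ratio.pow_const 2).aestronglyMeasurable ((u / l) ^ 2)
      (Eventually.of_forall fun x => ?_)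
    rw [Real.norm_of_nonneg (by positivity)]
    exact pow_le_pow_left₀ (h.ratio_nonneg x) (h.ratio_le x) 2
  have hind : Integrable (B.indicator (1 : Cov m → ℝ)) ν :=
    (integrable_const (1 : ℝ)).indicator hBm
  have hpt : ∀ᵐ x ∂ν, ν'.real {y | ballMass ν x y ≤ t} ^ 2 ≤
      ratio 𝕏 g g' x ^ 2 * t ^ 2 + c * σ * t ^ 2 +
        (u / (l * a)) ^ 2 * t ^ 2 * B.indicator (1 : Cov m → ℝ) x := by
    filter_upwards [h.ae_mem] with x hx
    by_cases hxB : x ∈ B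
    · rw [Set.indicator_of_mem hxB, Pi.one_apply, mul_one, ← mul_pow]
      have h1 := pow_le_pow_left₀ measureReal_nonneg (h.catchment_le hx ht) 2
      have h2 : 0 ≤ c * σ * t ^ 2 := by
        have := massRadius_nonneg (m := m) hl ha zero_le_one
        positivity
      have h3 : 0 ≤ ratio 𝕏 g g' x ^ 2 * t ^ 2 := by positivity
      linarith
    · rw [Set.indicator_of_notMem hxB, mul_zero, add_zero]
      have hsub : Metric.closedBall x (2 * σ) ⊆ 𝕏 := by simpa [hB] using hxB
      have h1 := h.catchment_le_of_interior ht ht1 hsub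
      have hr : g' x / g x = ratio 𝕏 g g' x := by rw [ratio, Set.indicator_of_mem hx]
      rw [hr] at h1
      refine (pow_le_pow_left₀ measureReal_nonneg h1 2).trans ?_
      have hr0 := h.ratio_nonneg x
      have hr1 := h.ratio_le x
      set ρ := ratio 𝕏 g g' x
      have e : (t * ρ + K * σ * t) ^ 2 = ρ ^ 2 * t ^ 2 + (2 * ρ * K + K ^ 2 * σ) * σ * t ^ 2 := by
        ring
      rw [e, hc]
      gcongr
  calc _ ≤ ∫ x, (ratio 𝕏 g g' x ^ 2 * t ^ 2 + c * σ * t ^ 2 +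
        (u / (l * a)) ^ 2 * t ^ 2 * B.indicator (1 : Cov m → ℝ) x) ∂ν := by
        refine integral_mono_ae ?_ ?_ hpt
        · refine Integrable.of_bound ((measurable_catchment ν ν' t).pow_const 2).aestronglyMeasurable
            1 (Eventually.of_forall fun x => ?_)
          rw [Real.norm_of_nonneg (by positivity)]
          exact pow_le_one₀ measureReal_nonneg measureReal_le_one
        · exact ((hr2.mul_const _).add (integrable_const _)).add (hind.const_mul _)
    _ = (∫ x, ratio 𝕏 g g' x ^ 2 ∂ν) * t ^ 2 + c * σ * t ^ 2 +
        (u / (l * a)) ^ 2 * t ^ 2 * ν.real B := by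
        have hi1 : Integrable (fun x => ratio 𝕏 g g' x ^ 2 * t ^ 2) ν := hr2.mul_const _
        have hi2 : Integrable (fun x => ratio 𝕏 g g' x ^ 2 * t ^ 2 + c * σ * t ^ 2) ν :=
          hi1.add (integrable_const _)
        rw [integral_add hi2 (hind.const_mul _), integral_add hi1 (integrable_const _),
          integral_mul_const, integral_const_mul _ (B.indicator (1 : Cov m → ℝ)),
          integral_indicator_one hBm, integral_const, probReal_univ, one_smul]
    _ ≤ (∫ x, ratio 𝕏 g g' x ^ 2 ∂ν) * t ^ 2 + c * σ * t ^ 2 +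
        (u / (l * a)) ^ 2 * t ^ 2 * (u * (b * (2 * σ))) := by
        gcongr
        exact h.real_layer_le (by positivity)
    _ = _ := by rw [squareConst, ← hK, hc]; ring

/-- The points `x` with `ballMass ν x y ≤ t` have mass exactly `t` and are close to `y`, so the
ratio may be evaluated at `y`. -/
lemma le_integral_ratio_mul_indicator (h : DensityPair 𝕏 ν ν' g g' l u L a b) {y : Cov m}
    (hy : y ∈ 𝕏) {t : ℝ} (ht : 0 ≤ t) (ht1 : t ≤ 1) :
    ratio 𝕏 g g' y * t - (L / l + u * L / l ^ 2) * massRadius m l a t * t ≤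
      ∫ x, ratio 𝕏 g g' x * {x | ballMass ν x y ≤ t}.indicator 1 x ∂ν := by
  have := h.prob
  have hl := h.l_pos
  have hL := h.L_pos
  have hu := h.u_pos
  set S := {x | ballMass ν x y ≤ t} with hS
  have hSm : MeasurableSet S := measurableSet_ballMass_le_right ν y t
  have hind : Integrable (S.indicator (1 : Cov m → ℝ)) ν :=
    (integrable_const (1 : ℝ)).indicator hSm
  set c := ratio 𝕏 g g' y - (L / l + u * L / l ^ 2) * massRadius m l a t
  have hpt : ∀ᵐ x ∂ν, c * S.indicator (1 : Cov m → ℝ) x ≤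
      ratio 𝕏 g g' x * S.indicator 1 x := by
    filter_upwards [h.ae_mem] with x hx
    by_cases hxS : x ∈ S
    · rw [Set.indicator_of_mem hxS, Pi.one_apply, mul_one, mul_one]
      refine le_trans ?_ (h.ratio_sub_le hx hy)
      have := h.dist_le_massRadius hx hy ht hxS
      exact sub_le_sub_left (mul_le_mul_of_nonneg_left this (by positivity)) _
    · rw [Set.indicator_of_notMem hxS, mul_zero, mul_zero]
  have hint : Integrable (fun x => ratio 𝕏 g g' x * S.indicator (1 : Cov m → ℝ) x) ν :=
    hind.bdd_mul h.measurable_ratio.aestronglyMeasurable (c := u / l)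
      (Eventually.of_forall fun x => by
        rw [Real.norm_of_nonneg (h.ratio_nonneg x)]; exact h.ratio_le x)
  have := integral_mono_ae (hind.const_mul c) hint hpt
  rw [integral_const_mul, integral_indicator_one hSm, h.real_ballMass_le ht ht1] at this
  calc _ = c * t := by ring
    _ ≤ _ := this

/-- Since `g' = r * g`, both sides are `∫ g' ^ 2 / g`. -/
lemma integral_ratio_eq (h : DensityPair 𝕏 ν ν' g g' l u L a b) :
    ∫ x, ratio 𝕏 g g' x ∂ν' = ∫ x, ratio 𝕏 g g' x ^ 2 ∂ν := by
  rw [h.dens, h.dens',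
    integral_withDensity_eq_integral_toReal_smul h.meas'.ennreal_ofReal (by simp),
    integral_withDensity_eq_integral_toReal_smul h.meas.ennreal_ofReal (by simp)]
  refine integral_congr_ae (Eventually.of_forall fun x => ?_)
  by_cases hx : x ∈ 𝕏
  · have hg := h.l_pos.trans_le (h.bounds x hx).1
    have hg' := h.l_pos.trans_le (h.bounds' x hx).1
    simp only [ratio, Set.indicator_of_mem hx, smul_eq_mul, ENNReal.toReal_ofReal hg.le,
      ENNReal.toReal_ofReal hg'.le]
    field_simp
  · simp [ratio, Set.indicator_of_notMem hx]

end DensityPair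

/-! ### Averaging binomial tails -/

section LayerCake

variable {α : Type*} [MeasurableSpace α] {Q : Measure α} [IsProbabilityMeasure Q] {T h : α → ℝ}
  {c : ℝ}

lemma integrable_betaDens_mul_indicator (N M : ℕ) (hT : Measurable T) (hh : Measurable h)
    (hhc : ∀ q, |h q| ≤ c) :
    Integrable (fun z : α × ℝ => betaDens N M z.2 * (h z.1 * {q | T q ≤ z.2}.indicator 1 z.1))
      (Q.prod (volume.restrict (Set.Ioc 0 1))) := by
  have hS : MeasurableSet {z : α × ℝ | T z.1 ≤ z.2} :=
    measurableSet_le (hT.comp measurable_fst) measurable_snd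
  have h1 : Measurable fun z : α × ℝ => {q | T q ≤ z.2}.indicator (1 : α → ℝ) z.1 := by
    have : (fun z : α × ℝ => {q | T q ≤ z.2}.indicator (1 : α → ℝ) z.1) =
        {z : α × ℝ | T z.1 ≤ z.2}.indicator 1 := by
      funext z
      simp [Set.indicator_apply]
    rw [this]
    exact measurable_one.indicator hS
  obtain ⟨b, hb⟩ := isCompact_Icc.exists_bound_of_continuousOn
    (continuous_betaDens N M).continuousOn (s := Set.Icc (0 : ℝ) 1)
  have hb0 : 0 ≤ b := (norm_nonneg _).trans (hb 0 ⟨le_rfl, zero_le_one⟩)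
  have hmeas : Measurable fun z : α × ℝ =>
      betaDens N M z.2 * (h z.1 * {q | T q ≤ z.2}.indicator 1 z.1) :=
    ((continuous_betaDens N M).measurable.comp measurable_snd).mul
      ((hh.comp measurable_fst).mul h1)
  refine Integrable.of_bound hmeas.aestronglyMeasurable (b * c) ?_
  have hae : ∀ᵐ z ∂(Q.prod (volume.restrict (Set.Ioc (0 : ℝ) 1))), z.2 ∈ Set.Ioc (0 : ℝ) 1 :=
    Measure.quasiMeasurePreserving_snd.ae (ae_restrict_mem measurableSet_Ioc)
  filter_upwards [hae] with z hz
  rw [norm_mul, norm_mul]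
  have h2 : ‖{q | T q ≤ z.2}.indicator (1 : α → ℝ) z.1‖ ≤ 1 := by
    by_cases hq : z.1 ∈ {q | T q ≤ z.2}
    · rw [Set.indicator_of_mem hq]; simp
    · rw [Set.indicator_of_notMem hq]; simp
  have h3 : ‖h z.1‖ * ‖{q | T q ≤ z.2}.indicator (1 : α → ℝ) z.1‖ ≤ c :=
    (mul_le_of_le_one_right (norm_nonneg _) h2).trans (hhc z.1)
  exact mul_le_mul (hb z.2 ⟨hz.1.le, hz.2⟩) h3 (by positivity) hb0

/-- Layer-cake formula: since `binTail N M` is the survival function of the density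
`betaDens N M`, averages of `binTail N M (T q)` are averages over `t` of the distribution
function of `T`. -/
lemma integral_mul_binTail {N M : ℕ} (hMN : M ≤ N) (hT : Measurable T) (hT0 : ∀ q, 0 ≤ T q)
    (hT1 : ∀ q, T q ≤ 1) (hh : Measurable h) (hhc : ∀ q, |h q| ≤ c) :
    ∫ q, h q * binTail N M (T q) ∂Q =
      ∫ t in (0 : ℝ)..1, betaDens N M t * ∫ q, h q * {q | T q ≤ t}.indicator 1 q ∂Q := by
  have hint := integrable_betaDens_mul_indicator (Q := Q) N M hT hh hhc
  have hpt : ∀ q, h q * binTail N M (T q) =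
      ∫ t in Set.Ioc (0 : ℝ) 1, betaDens N M t * (h q * {q | T q ≤ t}.indicator 1 q) := by
    intro q
    have h1 : ∀ t, betaDens N M t * (h q * {q | T q ≤ t}.indicator (1 : α → ℝ) q) =
        h q * (Set.Ici (T q)).indicator (betaDens N M) t := by
      intro t
      by_cases ht : T q ≤ t
      · rw [Set.indicator_of_mem (show q ∈ {q | T q ≤ t} from ht),
          Set.indicator_of_mem (show t ∈ Set.Ici (T q) from ht), Pi.one_apply]; ring
      · rw [Set.indicator_of_notMem (show q ∉ {q | T q ≤ t} from ht),
          Set.indicator_of_notMem (show t ∉ Set.Ici (T q) from ht)]; ring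
    simp_rw [h1]
    rw [integral_const_mul, setIntegral_indicator measurableSet_Ici, binTail_eq_integral hMN,
      intervalIntegral.integral_of_le (hT1 q)]
    congr 1
    refine setIntegral_congr_set ?_
    have : Set.Ioc (0 : ℝ) 1 ∩ Set.Ici (T q) ⊆ Set.Icc (T q) 1 := fun t ht => ⟨ht.2, ht.1.2⟩
    have h2 : Set.Ioc (T q) 1 ⊆ Set.Ioc (0 : ℝ) 1 ∩ Set.Ici (T q) :=
      fun t ht => ⟨⟨(hT0 q).trans_lt ht.1, ht.2⟩, ht.1.le⟩
    exact (LE.le.eventuallyLE h2).antisymm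
      ((LE.le.eventuallyLE this).trans Ioc_ae_eq_Icc.symm.le)
  simp_rw [hpt]
  rw [integral_integral_swap hint, intervalIntegral.integral_of_le zero_le_one]
  simp_rw [integral_const_mul]

lemma intervalIntegrable_betaDens_mul (N M : ℕ) (hT : Measurable T) (hh : Measurable h)
    (hhc : ∀ q, |h q| ≤ c) :
    IntervalIntegrable (fun t => betaDens N M t * ∫ q, h q * {q | T q ≤ t}.indicator 1 q ∂Q)
      volume 0 1 := by
  rw [intervalIntegrable_iff_integrableOn_Ioc_of_le zero_le_one]
  have := (integrable_betaDens_mul_indicator (Q := Q) N M hT hh hhc).integral_prod_right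
  simp only [integral_const_mul] at this
  exact this

end LayerCake

lemma massRadius_eq {m : ℕ} {l a t : ℝ} (hl : 0 < l) (ha : 0 < a) (ht : 0 ≤ t) :
    massRadius m l a t = massRadius m l a 1 * t ^ (1 / (m : ℝ)) := by
  have := unitBallVolume_pos m
  rw [massRadius, massRadius, ← Real.mul_rpow (by positivity) ht]
  congr 1; ring

/-- Comparison of a small power at `t` with the same power at `τ`. -/
lemma rpow_inv_le_mul_one_add_div {m : ℕ} (hm : 1 ≤ m) {t τ : ℝ} (ht : 0 ≤ t) (hτ : 0 < τ) :
    t ^ (1 / (m : ℝ)) ≤ τ ^ (1 / (m : ℝ)) * (1 + t / τ) := by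
  have hm' : (1 : ℝ) ≤ m := by exact_mod_cast hm
  have h1 : t ≤ τ * (1 + t / τ) := by
    rw [mul_add, mul_one, mul_div_cancel₀ _ hτ.ne']; linarith
  have h2 : (1 : ℝ) ≤ 1 + t / τ := by linarith [div_nonneg ht hτ.le]
  calc t ^ (1 / (m : ℝ)) ≤ (τ * (1 + t / τ)) ^ (1 / (m : ℝ)) := by gcongr
    _ = τ ^ (1 / (m : ℝ)) * (1 + t / τ) ^ (1 / (m : ℝ)) := Real.mul_rpow hτ.le (by linarith)
    _ ≤ τ ^ (1 / (m : ℝ)) * (1 + t / τ) ^ (1 : ℝ) := by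
        refine mul_le_mul_of_nonneg_left (Real.rpow_le_rpow_of_exponent_le h2 ?_) (by positivity)
        rw [div_le_one (by linarith)]; exact hm'
    _ = _ := by rw [Real.rpow_one]

namespace DensityPair

variable {m : ℕ} {𝕏 : Set (Cov m)} {ν ν' : Measure (Cov m)} {g g' : Cov m → ℝ}
  {l u L a b : ℝ}

lemma massRadius_le (h : DensityPair 𝕏 ν ν' g g' l u L a b) {t τ : ℝ} (ht : 0 ≤ t) (hτ : 0 < τ) :
    massRadius m l a t ≤ massRadius m l a 1 * τ ^ (1 / (m : ℝ)) * (1 + t / τ) := by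
  rw [massRadius_eq h.l_pos h.a_pos ht, mul_assoc]
  exact mul_le_mul_of_nonneg_left (rpow_inv_le_mul_one_add_div h.one_le_dim ht hτ)
    (massRadius_nonneg h.l_pos h.a_pos zero_le_one)

/-- The probability that two units of opposite labels are matched is `M / (N + 1)`, whatever the
densities are. -/
lemma integral_binTail_ballMass (h : DensityPair 𝕏 ν ν' g g' l u L a b) {N M : ℕ} (hM : 1 ≤ M)
    (hMN : M ≤ N) :
    ∫ q, binTail N M (ballMass ν q.1 q.2) ∂(ν.prod ν') = M / (N + 1) := by
  have := h.prob
  have := h.prob'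
  have h1 := integral_mul_binTail (Q := ν.prod ν') (T := fun q => ballMass ν q.1 q.2)
    (h := fun _ => 1) (c := 1) hMN (measurable_ballMass ν) (fun q => ballMass_nonneg _ _ _)
    (fun q => ballMass_le_one _ _ _) measurable_const (fun q => by simp)
  simp only [one_mul] at h1
  rw [h1, ← integral_betaDens_mul_id hM hMN]
  refine intervalIntegral.integral_congr fun t ht => ?_
  rw [Set.uIcc_of_le zero_le_one] at ht
  have hS : MeasurableSet {q : Cov m × Cov m | ballMass ν q.1 q.2 ≤ t} :=
    measurableSet_le (measurable_ballMass ν) measurable_const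
  refine congrArg (betaDens N M t * ·) ?_
  rw [integral_indicator_one hS, Measure.real, Measure.prod_apply_symm hS]
  have : ∀ y, ν ((fun x => (x, y)) ⁻¹' {q : Cov m × Cov m | ballMass ν q.1 q.2 ≤ t}) =
      ENNReal.ofReal t := by
    intro y
    calc _ = ν {x | ballMass ν x y ≤ t} := rfl
      _ = ENNReal.ofReal (ν.real {x | ballMass ν x y ≤ t}) := by rw [ofReal_measureReal]
      _ = _ := by rw [h.real_ballMass_le ht.1 ht.2]
  simp only [this, lintegral_const, measure_univ, mul_one, ENNReal.toReal_ofReal ht.1]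

/-- The upper bound for the probability that a unit is matched to two given units. -/
lemma integral_binTail_max_le (h : DensityPair 𝕏 ν ν' g g' l u L a b) {N M : ℕ} (hM : 1 ≤ M)
    (hMN : M ≤ N) :
    ∫ q, binTail N M (max (ballMass ν q.1 q.2.1) (ballMass ν q.1 q.2.2)) ∂(ν.prod (ν'.prod ν')) ≤
      ((M : ℝ) / (N + 1)) ^ 2 * ((∫ x, ratio 𝕏 g g' x ^ 2 ∂ν) * (1 + 1 / M) +
        8 * squareConst m l u L a b * massRadius m l a 1 *
          ((M : ℝ) / (N + 1)) ^ (1 / (m : ℝ))) := by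
  have := h.prob
  have := h.prob'
  have hM' : (1 : ℝ) ≤ M := by exact_mod_cast hM
  set τ := (M : ℝ) / (N + 1) with hτ
  have hτ0 : 0 < τ := by positivity
  set A := ∫ x, ratio 𝕏 g g' x ^ 2 ∂ν
  have hA : 0 ≤ A := integral_nonneg fun x => by positivity
  set K := squareConst m l u L a b
  have hK : 0 ≤ K := h.squareConst_nonneg
  have hσ₁ := massRadius_nonneg (m := m) h.l_pos h.a_pos zero_le_one
  set σ₁ := massRadius m l a 1
  have hb12 : Measurable fun q : Cov m × Cov m × Cov m => ballMass ν q.1 q.2.1 :=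
    (measurable_ballMass ν).comp (f := fun q : Cov m × Cov m × Cov m => (q.1, q.2.1)) (by fun_prop)
  have hb13 : Measurable fun q : Cov m × Cov m × Cov m => ballMass ν q.1 q.2.2 :=
    (measurable_ballMass ν).comp (f := fun q : Cov m × Cov m × Cov m => (q.1, q.2.2)) (by fun_prop)
  set T := fun q : Cov m × Cov m × Cov m => max (ballMass ν q.1 q.2.1) (ballMass ν q.1 q.2.2)
  have hT : Measurable T := hb12.max hb13
  have h1 := integral_mul_binTail (Q := ν.prod (ν'.prod ν')) (T := T)
    (h := fun _ => 1) (c := 1) hMN hT (fun q => le_max_of_le_left (ballMass_nonneg _ _ _))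
    (fun q => max_le (ballMass_le_one _ _ _) (ballMass_le_one _ _ _)) measurable_const
    (fun q => by simp)
  have h2 := intervalIntegrable_betaDens_mul (Q := ν.prod (ν'.prod ν')) (T := T)
    (h := fun _ => 1) (c := 1) N M hT measurable_const (fun q => by simp)
  simp only [one_mul] at h1 h2
  -- the distribution function of the maximum is the second moment of the catchment mass
  have hcdf : ∀ t, ∫ q, {q | T q ≤ t}.indicator 1 q ∂(ν.prod (ν'.prod ν')) =
      ∫ x, ν'.real {y | ballMass ν x y ≤ t} ^ 2 ∂ν := by
    intro t
    have hS : MeasurableSet {q | T q ≤ t} := measurableSet_le hT measurable_const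
    rw [integral_indicator_one hS, Measure.real, Measure.prod_apply hS,
      integral_eq_lintegral_of_nonneg_ae (Eventually.of_forall fun x => by positivity)
        ((measurable_catchment ν ν' t).pow_const 2).aestronglyMeasurable]
    congr 1
    refine lintegral_congr fun x => ?_
    have : Prod.mk x ⁻¹' {q | T q ≤ t} =
        {y | ballMass ν x y ≤ t} ×ˢ {y | ballMass ν x y ≤ t} := by
      ext q; simp [T]
    rw [this, Measure.prod_prod, ENNReal.ofReal_pow measureReal_nonneg, ofReal_measureReal, sq]
  rw [h1]
  simp_rw [hcdf] at h2 ⊢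
  have hc : ∀ q : ℕ, IntervalIntegrable (fun t : ℝ => betaDens N M t * t ^ q) volume 0 1 :=
    fun q => ((continuous_betaDens N M).mul (by fun_prop)).intervalIntegrable _ _
  set B := K * (σ₁ * τ ^ (1 / (m : ℝ))) with hB
  have hB0 : 0 ≤ B := by positivity
  calc _ ≤ ∫ t in (0 : ℝ)..1, ((A + B) * (betaDens N M t * t ^ 2) +
        B / τ * (betaDens N M t * t ^ 3)) := by
        refine intervalIntegral.integral_mono_on zero_le_one h2
          (((hc 2).const_mul _).add ((hc 3).const_mul _)) fun t ht => ?_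
        have hβ := betaDens_nonneg N M ht.1 ht.2
        have h3 := h.integral_catchment_sq_le ht.1 ht.2
        have h4 : K * massRadius m l a t * t ^ 2 ≤ B * (1 + t / τ) * t ^ 2 := by
          have h5 : K * massRadius m l a t ≤ B * (1 + t / τ) := by
            rw [hB, mul_assoc K]
            exact mul_le_mul_of_nonneg_left (h.massRadius_le ht.1 hτ0) ‹0 ≤ K›
          exact mul_le_mul_of_nonneg_right h5 (by positivity)
        calc _ ≤ betaDens N M t * (A * t ^ 2 + B * (1 + t / τ) * t ^ 2) := by
              gcongr; linarith
          _ = _ := by ring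
    _ = (A + B) * (∫ t in (0 : ℝ)..1, betaDens N M t * t ^ 2) +
        B / τ * ∫ t in (0 : ℝ)..1, betaDens N M t * t ^ 3 := by
        rw [intervalIntegral.integral_add ((hc 2).const_mul _) ((hc 3).const_mul _),
          intervalIntegral.integral_const_mul, intervalIntegral.integral_const_mul]
    _ ≤ (A + B) * (τ ^ 2 * (1 + 1 / M)) + B / τ * (6 * τ ^ 3) := by
        gcongr
        · exact integral_betaDens_mul_sq_le hM hMN
        · exact integral_betaDens_mul_cube_le hM hMN
    _ = τ ^ 2 * (A * (1 + 1 / M) + B * (7 + 1 / M)) := by field_simp; ring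
    _ ≤ τ ^ 2 * (A * (1 + 1 / M) + B * (7 + 1)) := by
        gcongr
        rw [div_le_one (by linarith)]; exact hM'
    _ = _ := by rw [hB]; ring

/-- The lower bound for the mixed moment of the density ratio and the indicator of a match. -/
lemma le_integral_ratio_mul_binTail (h : DensityPair 𝕏 ν ν' g g' l u L a b) {N M : ℕ}
    (hM : 1 ≤ M) (hMN : M ≤ N) :
    (M : ℝ) / (N + 1) * ((∫ x, ratio 𝕏 g g' x ^ 2 ∂ν) -
        3 * (L / l + u * L / l ^ 2) * massRadius m l a 1 *
          ((M : ℝ) / (N + 1)) ^ (1 / (m : ℝ))) ≤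
      ∫ q, ratio 𝕏 g g' q.1 * binTail N M (ballMass ν q.1 q.2) ∂(ν.prod ν') := by
  have := h.prob
  have := h.prob'
  have hl := h.l_pos
  have hL := h.L_pos
  have hu := h.u_pos
  have hM' : (1 : ℝ) ≤ M := by exact_mod_cast hM
  set τ := (M : ℝ) / (N + 1) with hτ
  have hτ0 : 0 < τ := by positivity
  rw [← h.integral_ratio_eq]
  set A := ∫ x, ratio 𝕏 g g' x ∂ν'
  set K := L / l + u * L / l ^ 2 with hK
  have hK0 : 0 ≤ K := by positivity
  have hσ₁ := massRadius_nonneg (m := m) h.l_pos h.a_pos zero_le_one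
  set σ₁ := massRadius m l a 1
  have hrm : Measurable fun q : Cov m × Cov m => ratio 𝕏 g g' q.1 :=
    h.measurable_ratio.comp measurable_fst
  have hrb : ∀ q : Cov m × Cov m, |ratio 𝕏 g g' q.1| ≤ u / l := fun q => by
    rw [abs_of_nonneg (h.ratio_nonneg _)]; exact h.ratio_le _
  rw [integral_mul_binTail (Q := ν.prod ν') (T := fun q => ballMass ν q.1 q.2) hMN
    (measurable_ballMass ν) (fun q => ballMass_nonneg _ _ _) (fun q => ballMass_le_one _ _ _)
    hrm hrb]
  have h2 := intervalIntegrable_betaDens_mul (Q := ν.prod ν') (T := fun q => ballMass ν q.1 q.2)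
    N M (measurable_ballMass ν) hrm hrb
  have hr' : Integrable (ratio 𝕏 g g') ν' :=
    Integrable.of_bound h.measurable_ratio.aestronglyMeasurable (u / l)
      (Eventually.of_forall fun x => by
        rw [Real.norm_of_nonneg (h.ratio_nonneg x)]; exact h.ratio_le x)
  have hinner : ∀ t ∈ Set.Icc (0 : ℝ) 1, A * t - K * massRadius m l a t * t ≤
      ∫ q, ratio 𝕏 g g' q.1 * {q : Cov m × Cov m | ballMass ν q.1 q.2 ≤ t}.indicator 1 q
        ∂(ν.prod ν') := by
    intro t ht
    have hS : MeasurableSet {q : Cov m × Cov m | ballMass ν q.1 q.2 ≤ t} :=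
      measurableSet_le (measurable_ballMass ν) measurable_const
    have hint : Integrable (fun q : Cov m × Cov m => ratio 𝕏 g g' q.1 *
        {q : Cov m × Cov m | ballMass ν q.1 q.2 ≤ t}.indicator 1 q) (ν.prod ν') :=
      ((integrable_const (1 : ℝ)).indicator hS).bdd_mul hrm.aestronglyMeasurable (c := u / l)
        (Eventually.of_forall hrb)
    rw [integral_prod_symm _ hint]
    have h3 : ∫ y, (ratio 𝕏 g g' y * t - K * massRadius m l a t * t) ∂ν' =
        A * t - K * massRadius m l a t * t := by
      rw [integral_sub (hr'.mul_const _) (integrable_const _), integral_mul_const, integral_const,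
        probReal_univ, one_smul]
    rw [← h3]
    refine integral_mono_ae ((hr'.mul_const _).sub (integrable_const _))
      hint.integral_prod_right ?_
    filter_upwards [h.ae_mem'] with y hy
    exact h.le_integral_ratio_mul_indicator hy ht.1 ht.2
  have hc : ∀ q : ℕ, IntervalIntegrable (fun t : ℝ => betaDens N M t * t ^ q) volume 0 1 :=
    fun q => ((continuous_betaDens N M).mul (by fun_prop)).intervalIntegrable _ _
  set B := K * (σ₁ * τ ^ (1 / (m : ℝ))) with hB
  have hB0 : 0 ≤ B := by positivity
  calc τ * (A - 3 * K * σ₁ * τ ^ (1 / (m : ℝ))) = (A - B) * τ - B / τ * (τ ^ 2 * (1 + 1)) := by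
        rw [hB]; field_simp; ring
    _ ≤ (A - B) * τ - B / τ * (τ ^ 2 * (1 + 1 / M)) := by
        gcongr
        rw [div_le_one (by linarith)]; exact hM'
    _ ≤ (A - B) * (∫ t in (0 : ℝ)..1, betaDens N M t * t ^ 1) -
        B / τ * ∫ t in (0 : ℝ)..1, betaDens N M t * t ^ 2 := by
        simp only [pow_one, integral_betaDens_mul_id hM hMN]
        gcongr
        exact integral_betaDens_mul_sq_le hM hMN
    _ = ∫ t in (0 : ℝ)..1, ((A - B) * (betaDens N M t * t ^ 1) -
        B / τ * (betaDens N M t * t ^ 2)) := by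
        rw [intervalIntegral.integral_sub ((hc 1).const_mul _) ((hc 2).const_mul _),
          intervalIntegral.integral_const_mul, intervalIntegral.integral_const_mul]
    _ ≤ _ := by
        refine intervalIntegral.integral_mono_on zero_le_one
          (((hc 1).const_mul _).sub ((hc 2).const_mul _)) h2 fun t ht => ?_
        have hβ := betaDens_nonneg N M ht.1 ht.2
        have h4 : K * massRadius m l a t * t ≤ B * (1 + t / τ) * t := by
          have h5 : K * massRadius m l a t ≤ B * (1 + t / τ) := by
            rw [hB, mul_assoc K]
            exact mul_le_mul_of_nonneg_left (h.massRadius_le ht.1 hτ0) ‹0 ≤ K›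
          exact mul_le_mul_of_nonneg_right h5 ht.1
        calc _ = betaDens N M t * (A * t - B * (1 + t / τ) * t) := by ring
          _ ≤ betaDens N M t * (A * t - K * massRadius m l a t * t) := by gcongr
          _ ≤ _ := by gcongr; exact hinner t ht

end DensityPair

/-! ### The error of the estimator when the labels are fixed -/

section FixedLabels

variable {m n : ℕ} {d : Fin n → Fin 2} {i : Fin n} {w : Fin 2}

/-- The units with label `w` other than unit `i`. -/
def peers (d : Fin n → Fin 2) (w : Fin 2) (i : Fin n) : Finset (Fin n) :=
  Finset.univ.filter fun l => l ≠ i ∧ d l = w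

lemma groupSize_eq_card_peers_add_one (hi : d i = w) :
    groupSize d w = (peers d w i).card + 1 := by
  have : (Finset.univ.filter fun j => d j = w) = insert i (peers d w i) := by
    ext l
    by_cases h : l = i <;> simp [peers, h, hi]
  rw [groupSize, this, Finset.card_insert_of_notMem (by simp [peers])]

/-- Unit `i` itself is among the units counted in `nnIndexSet`, so *at most `M`* of all units with
label `w` becomes *fewer than `M`* of the peers of `i`. -/
lemma mem_nnIndexSet_iff (hi : d i = w) (M : ℕ) (j : Fin n) (x : Fin n → Cov m) :
    i ∈ nnIndexSet M w j x d ↔ (fun l : peers d w i => x l) ∈ catchSet M (x i) (x j) := by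
  classical
  simp only [nnIndexSet, catchSet, Finset.mem_filter, Finset.mem_univ, true_and, hi,
    Set.mem_ofPred_eq, Metric.mem_closedBall]
  have h1 : (Finset.univ.filter fun l => d l = w ∧ dist (x l) (x j) ≤ dist (x i) (x j)) =
      insert i ((peers d w i).filter fun l => dist (x l) (x j) ≤ dist (x i) (x j)) := by
    ext l
    by_cases h : l = i <;> simp [peers, h, hi]
  have h2 : (Finset.univ.filter fun l : peers d w i =>
      dist (x l) (x j) ≤ dist (x i) (x j)).card =
      ((peers d w i).filter fun l => dist (x l) (x j) ≤ dist (x i) (x j)).card := by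
    rw [Finset.card_filter, Finset.card_filter]
    exact Finset.sum_coe_sort (peers d w i)
      fun l => if dist (x l) (x j) ≤ dist (x i) (x j) then 1 else 0
  rw [h1, h2, Finset.card_insert_of_notMem (by simp [peers])]
  omega

/-- The configurations for which unit `i` is matched to unit `j`. -/
def matchSet (M : ℕ) (d : Fin n → Fin 2) (w : Fin 2) (i j : Fin n) : Set (Fin n → Cov m) :=
  {x | (fun l : peers d w i => x l) ∈ catchSet M (x i) (x j)}

lemma measurableSet_matchSet (M : ℕ) (d : Fin n → Fin 2) (w : Fin 2) (i j : Fin n) :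
    MeasurableSet (matchSet (m := m) M d w i j) :=
  measurableSet_catchSet M (measurable_pi_apply i) (measurable_pi_apply j)
    (measurable_pi_lambda _ fun _ => measurable_pi_apply _)

lemma matchedTimes_eq_sum (hi : d i = w) (M : ℕ) (x : Fin n → Cov m) :
    (matchedTimes M w i x d : ℝ) = ∑ j ∈ Finset.univ.filter (fun j => d j = 1 - w),
      (matchSet M d w i j).indicator 1 x := by
  classical
  simp only [matchedTimes, mem_nnIndexSet_iff hi]
  rw [← Finset.filter_filter, Finset.card_filter]
  push_cast
  refine Finset.sum_congr rfl fun j _ => ?_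
  rw [Set.indicator_apply]
  rfl

lemma matchedTimes_le_groupSize (M : ℕ) (w : Fin 2) (i : Fin n) (x : Fin n → Cov m)
    (d : Fin n → Fin 2) : matchedTimes M w i x d ≤ groupSize d (1 - w) := by
  rw [matchedTimes, groupSize]
  refine Finset.card_le_card fun j hj => ?_
  simp only [Finset.mem_filter, Finset.mem_univ, true_and] at hj ⊢
  exact hj.1

variable {ρ : Fin 2 → Measure (Cov m)}

lemma label_ne (w : Fin 2) : w ≠ 1 - w := by fin_cases w <;> decide

lemma pi_peers (d : Fin n → Fin 2) (w : Fin 2) (i : Fin n) :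
    (Measure.pi fun l : peers d w i => ρ (d l)) = Measure.pi fun _ : peers d w i => ρ w := by
  congr 1
  funext l
  have := l.2
  simp only [peers, Finset.mem_filter] at this
  rw [this.2.2]

variable [∀ v, IsProbabilityMeasure (ρ v)]

/-- Integrate out the peers of `i`: they are independent of the covariates of `i` and `j`, and the
number of those in a ball is binomial. -/
lemma integral_indicator_matchSet (hi : d i = w) {j : Fin n} (hj : d j = 1 - w) (M : ℕ)
    {f : Cov m → ℝ} (hf : Measurable f) {c : ℝ} (hfc : ∀ x, |f x| ≤ c) :
    ∫ x, f (x i) * (matchSet M d w i j).indicator 1 x ∂(Measure.pi fun k => ρ (d k)) =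
      ∫ q, f q.1 * binTail (peers d w i).card M (ballMass (ρ w) q.1 q.2)
        ∂((ρ w).prod (ρ (1 - w))) := by
  have hij : i ≠ j := fun h => label_ne w (by rw [← hj, ← h, hi])
  have hdisj : Disjoint {i, j} (peers d w i) := by
    rw [Finset.disjoint_left]
    intro k hk hk'
    simp only [peers, Finset.mem_filter, Finset.mem_univ, true_and] at hk'
    simp only [Finset.mem_insert, Finset.mem_singleton] at hk
    rcases hk with rfl | rfl
    · exact hk'.1 rfl
    · exact label_ne w (hk'.2.symm.trans hj)
  have hz : Measurable fun s : ({i, j} : Finset (Fin n)) → Cov m =>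
      (s ⟨i, by simp⟩, s ⟨j, by simp⟩) :=
    (measurable_pi_apply _).prodMk (measurable_pi_apply _)
  have hlaw := map_prodMk_restrict_pi (fun k => ρ (d k)) hdisj hz
  simp only [map_pair_pi (fun k => ρ (d k)) hij, pi_peers, hi, hj] at hlaw
  set F : (Cov m × Cov m) × (peers d w i → Cov m) → ℝ := fun z =>
    f z.1.1 * {z : (Cov m × Cov m) × (peers d w i → Cov m) |
      z.2 ∈ catchSet M z.1.1 z.1.2}.indicator 1 z with hF
  have hS : MeasurableSet {z : (Cov m × Cov m) × (peers d w i → Cov m) |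
      z.2 ∈ catchSet M z.1.1 z.1.2} :=
    measurableSet_catchSet M (by fun_prop) (by fun_prop) measurable_snd
  have hFm : Measurable F :=
    (hf.comp (measurable_fst.comp measurable_fst)).mul (measurable_one.indicator hS)
  have hFi : Integrable F (((ρ w).prod (ρ (1 - w))).prod (Measure.pi fun _ => ρ w)) :=
    ((integrable_const (1 : ℝ)).indicator hS).bdd_mul
      (hf.comp (measurable_fst.comp measurable_fst)).aestronglyMeasurable (c := c)
      (Eventually.of_forall fun z => hfc _)
  have hΦ : Measurable fun x : Fin n → Cov m => ((x i, x j), fun l : peers d w i => x l) :=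
    ((measurable_pi_apply i).prodMk (measurable_pi_apply j)).prodMk
      (measurable_pi_lambda _ fun _ => measurable_pi_apply _)
  calc _ = ∫ x, F ((x i, x j), fun l : peers d w i => x l) ∂(Measure.pi fun k => ρ (d k)) := rfl
    _ = ∫ z, F z ∂(((ρ w).prod (ρ (1 - w))).prod (Measure.pi fun _ => ρ w)) := by
      rw [← hlaw, integral_map hΦ.aemeasurable hFm.aestronglyMeasurable]
    _ = _ := by
      rw [integral_prod _ hFi]
      refine integral_congr_ae (Eventually.of_forall fun q => ?_)
      simp only [hF]
      rw [integral_const_mul]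
      congr 1
      have h1 : (fun W : peers d w i → Cov m =>
          {z : (Cov m × Cov m) × (peers d w i → Cov m) |
            z.2 ∈ catchSet M z.1.1 z.1.2}.indicator
              (1 : (Cov m × Cov m) × (peers d w i → Cov m) → ℝ) (q, W)) =
          (catchSet M q.1 q.2).indicator 1 := rfl
      have h2 : MeasurableSet (catchSet (ι := peers d w i) M q.1 q.2) :=
        measurable_prodMk_left hS
      rw [h1, integral_indicator_one h2, pi_real_catchSet, Fintype.card_coe]

/-- The intersection is contained in both events; its probability is bounded by that of the event
with the larger ball mass, which is the less likely one. -/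
lemma real_matchSet_inter_le (hi : d i = w) {j k : Fin n} (hj : d j = 1 - w) (hk : d k = 1 - w)
    (hjk : j ≠ k) (M : ℕ) :
    (Measure.pi fun k => ρ (d k)).real (matchSet M d w i j ∩ matchSet M d w i k) ≤
      ∫ q, binTail (peers d w i).card M
        (max (ballMass (ρ w) q.1 q.2.1) (ballMass (ρ w) q.1 q.2.2))
        ∂((ρ w).prod ((ρ (1 - w)).prod (ρ (1 - w)))) := by
  have hij : i ≠ j := fun h => label_ne w (by rw [← hj, ← h, hi])
  have hik : i ≠ k := fun h => label_ne w (by rw [← hk, ← h, hi])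
  have hdisj : Disjoint {i, j, k} (peers d w i) := by
    rw [Finset.disjoint_left]
    intro r hr hr'
    simp only [peers, Finset.mem_filter, Finset.mem_univ, true_and] at hr'
    simp only [Finset.mem_insert, Finset.mem_singleton] at hr
    rcases hr with rfl | rfl | rfl
    · exact hr'.1 rfl
    · exact label_ne w (hr'.2.symm.trans hj)
    · exact label_ne w (hr'.2.symm.trans hk)
  have hz : Measurable fun s : ({i, j, k} : Finset (Fin n)) → Cov m =>
      (s ⟨i, by simp⟩, s ⟨j, by simp⟩, s ⟨k, by simp⟩) :=
    (measurable_pi_apply _).prodMk ((measurable_pi_apply _).prodMk (measurable_pi_apply _))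
  have hlaw := map_prodMk_restrict_pi (fun k => ρ (d k)) hdisj hz
  simp only [map_triple_pi (fun k => ρ (d k)) hij hik hjk, pi_peers, hi, hj, hk] at hlaw
  set S : Set ((Cov m × Cov m × Cov m) × (peers d w i → Cov m)) :=
    {z | z.2 ∈ catchSet M z.1.1 z.1.2.1} ∩ {z | z.2 ∈ catchSet M z.1.1 z.1.2.2} with hSdef
  have hS : MeasurableSet S :=
    (measurableSet_catchSet M (by fun_prop) (by fun_prop) measurable_snd).inter
      (measurableSet_catchSet M (by fun_prop) (by fun_prop) measurable_snd)
  have hΦ : Measurable fun x : Fin n → Cov m => ((x i, x j, x k), fun l : peers d w i => x l) :=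
    ((measurable_pi_apply i).prodMk ((measurable_pi_apply j).prodMk (measurable_pi_apply k))).prodMk
      (measurable_pi_lambda _ fun _ => measurable_pi_apply _)
  have h1 : (Measure.pi fun k => ρ (d k)).real (matchSet M d w i j ∩ matchSet M d w i k) =
      (((ρ w).prod ((ρ (1 - w)).prod (ρ (1 - w)))).prod
        (Measure.pi fun _ : peers d w i => ρ w)).real S := by
    rw [← hlaw, Measure.real, Measure.real, Measure.map_apply hΦ hS]
    rfl
  have hSi : Integrable (S.indicator (1 : (Cov m × Cov m × Cov m) × (peers d w i → Cov m) → ℝ))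
      (((ρ w).prod ((ρ (1 - w)).prod (ρ (1 - w)))).prod (Measure.pi fun _ => ρ w)) :=
    (integrable_const (1 : ℝ)).indicator hS
  rw [h1, ← integral_indicator_one hS, integral_prod _ hSi]
  have hb12 : Measurable fun q : Cov m × Cov m × Cov m => ballMass (ρ w) q.1 q.2.1 :=
    (measurable_ballMass (ρ w)).comp (f := fun q : Cov m × Cov m × Cov m => (q.1, q.2.1))
      (by fun_prop)
  have hb13 : Measurable fun q : Cov m × Cov m × Cov m => ballMass (ρ w) q.1 q.2.2 :=
    (measurable_ballMass (ρ w)).comp (f := fun q : Cov m × Cov m × Cov m => (q.1, q.2.2))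
      (by fun_prop)
  set N := (peers d w i).card
  have hcont : Continuous (binTail N M) := by unfold binTail; fun_prop
  have hpt : ∀ q : Cov m × Cov m × Cov m,
      ∫ W, S.indicator (1 : (Cov m × Cov m × Cov m) × (peers d w i → Cov m) → ℝ) (q, W)
          ∂(Measure.pi fun _ : peers d w i => ρ w) ≤
        binTail N M (max (ballMass (ρ w) q.1 q.2.1) (ballMass (ρ w) q.1 q.2.2)) := by
    intro q
    have h2 : (fun W : peers d w i → Cov m =>
        S.indicator (1 : (Cov m × Cov m × Cov m) × (peers d w i → Cov m) → ℝ) (q, W)) =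
        (Prod.mk q ⁻¹' S).indicator 1 := rfl
    rw [h2, integral_indicator_one (measurable_prodMk_left hS)]
    have h3 : Fintype.card (peers d w i) = N := Fintype.card_coe _
    rcases max_choice (ballMass (ρ w) q.1 q.2.1) (ballMass (ρ w) q.1 q.2.2) with hmax | hmax
    · rw [hmax, ← h3, ← pi_real_catchSet]
      exact measureReal_mono fun W hW => hW.1
    · rw [hmax, ← h3, ← pi_real_catchSet]
      exact measureReal_mono fun W hW => hW.2
  refine integral_mono_ae hSi.integral_prod_left ?_
    (Eventually.of_forall hpt)
  obtain ⟨b, hb⟩ := isCompact_Icc.exists_bound_of_continuousOn hcont.continuousOn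
    (s := Set.Icc (0 : ℝ) 1)
  exact Integrable.of_bound (hcont.measurable.comp (hb12.max hb13)).aestronglyMeasurable b
    (Eventually.of_forall fun q => hb _ ⟨le_max_of_le_left (ballMass_nonneg _ _ _),
      max_le (ballMass_le_one _ _ _) (ballMass_le_one _ _ _)⟩)

/-- The constant in the bound for the mean squared error given the labels. -/
noncomputable def fixedLabelConst (m : ℕ) (l u L a b : ℝ) : ℝ :=
  2 * (1 + (u / l) ^ 2) + 8 * DensityPair.squareConst m l u L a b * massRadius m l a 1 +
    6 * (L / l + u * L / l ^ 2) * massRadius m l a 1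

/-- The cancellation of the leading terms in the expansion of the squared error. -/
lemma expansion_le {M c R e₁ e₂ θ A n' τ I₁ I₂ : ℝ} (hM : 0 < M) (hc : 0 ≤ c)
    (he₁ : 0 ≤ e₁) (he₂ : 0 ≤ e₂) (hθ : 0 ≤ θ) (hA : A ≤ R ^ 2) (hcτ : n' * τ = c * M)
    (hI₁ : I₁ ≤ n' * τ + n' ^ 2 * (τ ^ 2 * (A * (1 + 1 / M) + e₁ * θ)))
    (hI₂ : n' * (τ * (A - 3 * e₂ * θ)) ≤ I₂) :
    1 / M ^ 2 * I₁ - 2 * c / M * I₂ + c ^ 2 * A ≤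
      c / M + c ^ 2 * ((2 * (1 + R ^ 2) + e₁ + 6 * e₂) * (1 / M + θ)) := by
  have e1 : n' * τ + n' ^ 2 * (τ ^ 2 * (A * (1 + 1 / M) + e₁ * θ)) =
      c * M + (c * M) ^ 2 * (A * (1 + 1 / M) + e₁ * θ) := by rw [← hcτ]; ring
  have e2 : n' * (τ * (A - 3 * e₂ * θ)) = c * M * (A - 3 * e₂ * θ) := by rw [← hcτ]; ring
  rw [e1] at hI₁
  rw [e2] at hI₂
  calc _ ≤ 1 / M ^ 2 * (c * M + (c * M) ^ 2 * (A * (1 + 1 / M) + e₁ * θ)) -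
        2 * c / M * (c * M * (A - 3 * e₂ * θ)) + c ^ 2 * A := by gcongr
    _ = c / M + c ^ 2 * (A * (1 / M) + (e₁ + 6 * e₂) * θ) := by field_simp; ring
    _ ≤ c / M + c ^ 2 * ((2 * (1 + R ^ 2) + e₁ + 6 * e₂) * (1 / M) +
        (2 * (1 + R ^ 2) + e₁ + 6 * e₂) * θ) := by
        have h1 : A ≤ 2 * (1 + R ^ 2) + e₁ + 6 * e₂ := by linarith [sq_nonneg R]
        have h2 : e₁ + 6 * e₂ ≤ 2 * (1 + R ^ 2) + e₁ + 6 * e₂ := by linarith [sq_nonneg R]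
        gcongr
    _ = _ := by ring

/-- For fixed labels, expand the square. The second moment of the number of matches is bounded
above by pairs, the mixed moment is bounded below, and the leading terms cancel. -/
lemma integral_sq_matchedTimes_sub_le (hi : d i = w) {g g' : Cov m → ℝ} {𝕏 : Set (Cov m)}
    {l u L a b : ℝ} (h : DensityPair 𝕏 (ρ w) (ρ (1 - w)) g g' l u L a b) {M : ℕ} (hM : 1 ≤ M) :
    ∫ x, ((matchedTimes M w i x d : ℝ) / M - (groupSize d (1 - w) : ℝ) / groupSize d w *
        DensityPair.ratio 𝕏 g g' (x i)) ^ 2 ∂(Measure.pi fun k => ρ (d k)) ≤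
      (groupSize d (1 - w) : ℝ) / groupSize d w / M +
        ((groupSize d (1 - w) : ℝ) / groupSize d w) ^ 2 * (fixedLabelConst m l u L a b *
          (1 / M + ((M : ℝ) / groupSize d w) ^ (1 / (m : ℝ)))) := by
  set μ := Measure.pi fun k => ρ (d k) with hμ
  set r := DensityPair.ratio 𝕏 g g' with hr
  set c := (groupSize d (1 - w) : ℝ) / groupSize d w with hc
  have hc0 : 0 ≤ c := by positivity
  have hM' : (1 : ℝ) ≤ M := by exact_mod_cast hM
  have hNs := groupSize_eq_card_peers_add_one hi
  set N := (peers d w i).card with hN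
  have hN0 : (0 : ℝ) < groupSize d w := by rw [hNs]; positivity
  have hl := h.l_pos
  have hL := h.L_pos
  have hu := h.u_pos
  have hsq := h.squareConst_nonneg
  have hσ₁ := massRadius_nonneg (m := m) hl h.a_pos zero_le_one
  set τ := (M : ℝ) / groupSize d w with hτ
  have hτ0 : 0 < τ := by positivity
  set R := u / l with hR
  have hR0 : 0 ≤ R := by positivity
  set e₁ := 8 * DensityPair.squareConst m l u L a b * massRadius m l a 1 with he₁
  set e₂ := (L / l + u * L / l ^ 2) * massRadius m l a 1 with he₂
  have he₁0 : 0 ≤ e₁ := by positivity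
  have he₂0 : 0 ≤ e₂ := by positivity
  have hC : fixedLabelConst m l u L a b = 2 * (1 + R ^ 2) + e₁ + 6 * e₂ := by
    rw [fixedLabelConst, he₁, he₂]; ring
  set θ := τ ^ (1 / (m : ℝ)) with hθ
  have hθ0 : 0 ≤ θ := by positivity
  have hr0 : ∀ x, 0 ≤ r x := h.ratio_nonneg
  have hrR : ∀ x, r x ≤ R := h.ratio_le
  have hK : ∀ x : Fin n → Cov m, (matchedTimes M w i x d : ℝ) ≤ groupSize d (1 - w) := fun x =>
    Nat.cast_le.2 (matchedTimes_le_groupSize M w i x d)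
  rcases lt_or_ge N M with hlt | hMN
  · -- few units with label `w`: the crude bound by `c ^ 2` suffices, because `1 ≤ θ`
    have hNM : (groupSize d w : ℝ) ≤ M := by rw [hNs]; exact_mod_cast hlt
    have hθ1 : 1 ≤ θ := Real.one_le_rpow (by rw [hτ, one_le_div hN0]; exact hNM) (by positivity)
    have hpt : ∀ x : Fin n → Cov m,
        ((matchedTimes M w i x d : ℝ) / M - c * r (x i)) ^ 2 ≤ c ^ 2 * (1 + R ^ 2) := by
      intro x
      have h1 : (matchedTimes M w i x d : ℝ) / M ≤ c :=
        div_le_div₀ (by positivity) (hK x) hN0 hNM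
      have h2 : c * r (x i) ≤ c * R := mul_le_mul_of_nonneg_left (hrR _) hc0
      have h3 : 0 ≤ (matchedTimes M w i x d : ℝ) / M := by positivity
      have h4 : 0 ≤ c * r (x i) := mul_nonneg hc0 (hr0 _)
      nlinarith
    have h5 : ∫ x, ((matchedTimes M w i x d : ℝ) / M - c * r (x i)) ^ 2 ∂μ ≤
        c ^ 2 * (1 + R ^ 2) := by
      have := integral_mono_of_nonneg (μ := μ) (Eventually.of_forall fun x => by positivity)
        (integrable_const (c ^ 2 * (1 + R ^ 2))) (Eventually.of_forall hpt)
      simpa using this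
    refine h5.trans ?_
    have h6 : 1 + R ^ 2 ≤ fixedLabelConst m l u L a b * (1 / M + θ) := by
      rw [hC]
      have h7 : (1 : ℝ) ≤ 1 / M + θ := by
        have : (0 : ℝ) ≤ 1 / M := by positivity
        linarith
      have h8 : 1 + R ^ 2 ≤ 2 * (1 + R ^ 2) + e₁ + 6 * e₂ := by nlinarith [sq_nonneg R]
      exact h8.trans (le_mul_of_one_le_right (by positivity) h7)
    have h9 : 0 ≤ c / M := by positivity
    have := mul_le_mul_of_nonneg_left h6 (sq_nonneg c)
    linarith
  · have hτN : (M : ℝ) / (N + 1) = τ := by rw [hτ, hNs]; push_cast; rfl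
    set B := Finset.univ.filter (fun j => d j = 1 - w) with hB
    have hBcard : (B.card : ℝ) = groupSize d (1 - w) := rfl
    have hBmem : ∀ j ∈ B, d j = 1 - w := fun j hj => (Finset.mem_filter.1 hj).2
    set χ : Fin n → (Fin n → Cov m) → ℝ := fun j => (matchSet M d w i j).indicator 1 with hχ
    have hKsum : ∀ x, (matchedTimes M w i x d : ℝ) = ∑ j ∈ B, χ j x := matchedTimes_eq_sum hi M
    set A := ∫ x, r x ^ 2 ∂(ρ w) with hA
    have hrm : Measurable r := h.measurable_ratio
    have hrabs : ∀ x, |r x| ≤ R := fun x => by rw [abs_of_nonneg (hr0 x)]; exact hrR x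
    have hA1 : A ≤ R ^ 2 := by
      have := integral_mono_of_nonneg (μ := ρ w) (f := fun x => r x ^ 2)
        (Eventually.of_forall fun x => by positivity) (integrable_const (R ^ 2))
        (Eventually.of_forall fun x => pow_le_pow_left₀ (hr0 x) (hrR x) 2)
      simpa using this
    have hχi : ∀ j, Integrable (χ j) μ := fun j =>
      (integrable_const (1 : ℝ)).indicator (measurableSet_matchSet M d w i j)
    have hχχ : ∀ j k x, χ j x * χ k x = (matchSet M d w i j ∩ matchSet M d w i k).indicator 1 x :=
      fun j k x => by rw [Set.inter_indicator_one]; rfl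
    have hχχi : ∀ j k, Integrable (fun x => χ j x * χ k x) μ := fun j k => by
      simp_rw [hχχ]
      exact (integrable_const (1 : ℝ)).indicator
        ((measurableSet_matchSet M d w i j).inter (measurableSet_matchSet M d w i k))
    have hχr : ∀ j, Integrable (fun x => r (x i) * χ j x) μ := fun j =>
      (hχi j).bdd_mul (hrm.comp (measurable_pi_apply i)).aestronglyMeasurable (c := R)
        (Eventually.of_forall fun x => hrabs _)
    have hr2i : Integrable (fun x : Fin n → Cov m => r (x i) ^ 2) μ :=
      Integrable.of_bound ((hrm.comp (measurable_pi_apply i)).pow_const 2).aestronglyMeasurable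
        (R ^ 2) (Eventually.of_forall fun x => by
          rw [Real.norm_of_nonneg (by positivity)]
          exact pow_le_pow_left₀ (hr0 _) (hrR _) 2)
    -- the three integrals
    have hI1 : ∫ x, (∑ j ∈ B, χ j x) ^ 2 ∂μ ≤ groupSize d (1 - w) * τ +
        (groupSize d (1 - w) : ℝ) ^ 2 * (τ ^ 2 * (A * (1 + 1 / M) + e₁ * θ)) := by
      simp_rw [sq (∑ j ∈ B, χ j _), Finset.sum_mul_sum]
      rw [integral_finsetSum _ fun j _ => integrable_finsetSum _ fun k _ => hχχi j k]
      have hdiag : ∀ j ∈ B, ∫ x, χ j x * χ j x ∂μ = τ := fun j hj => by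
        have h1 := integral_indicator_matchSet (ρ := ρ) hi (hBmem j hj) M (f := fun _ => 1)
          measurable_const (c := 1) (fun x => by simp)
        have h2 := h.integral_binTail_ballMass hM hMN
        rw [hτN] at h2
        simp only [one_mul] at h1
        rw [← h1.trans h2]
        refine integral_congr_ae (Eventually.of_forall fun x => ?_)
        simp only [hχχ, Set.inter_self]
      have hoff : ∀ j ∈ B, ∀ k ∈ B, j ≠ k → ∫ x, χ j x * χ k x ∂μ ≤
          τ ^ 2 * (A * (1 + 1 / M) + e₁ * θ) := fun j hj k hk hjk => by
        simp_rw [hχχ]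
        rw [integral_indicator_one
          ((measurableSet_matchSet M d w i j).inter (measurableSet_matchSet M d w i k))]
        refine (real_matchSet_inter_le hi (hBmem j hj) (hBmem k hk) hjk M).trans ?_
        have := h.integral_binTail_max_le hM hMN
        rw [hτN] at this
        exact this
      have hA0 : 0 ≤ A := integral_nonneg fun x => by positivity
      set p := τ ^ 2 * (A * (1 + 1 / M) + e₁ * θ) with hp
      have hp0 : 0 ≤ p := by positivity
      calc _ ≤ ∑ j ∈ B, (τ + B.card * p) := by
            refine Finset.sum_le_sum fun j hj => ?_
            rw [integral_finsetSum _ fun k _ => hχχi j k]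
            calc _ ≤ ∑ k ∈ B, ((if k = j then τ else 0) + p) := by
                  refine Finset.sum_le_sum fun k hk => ?_
                  by_cases hjk : k = j
                  · rw [if_pos hjk, hjk, hdiag j hj]; linarith
                  · rw [if_neg hjk, zero_add]; exact hoff j hj k hk (Ne.symm hjk)
              _ = _ := by
                  rw [Finset.sum_add_distrib, Finset.sum_ite_eq' B j, if_pos hj, Finset.sum_const,
                    nsmul_eq_mul]
        _ = _ := by rw [Finset.sum_const, nsmul_eq_mul, hBcard]; ring
    have hI2 : groupSize d (1 - w) * (τ * (A - 3 * e₂ * θ)) ≤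
        ∫ x, (∑ j ∈ B, r (x i) * χ j x) ∂μ := by
      rw [integral_finsetSum _ fun j _ => hχr j, ← hBcard, ← nsmul_eq_mul, ← Finset.sum_const]
      refine Finset.sum_le_sum fun j hj => ?_
      rw [integral_indicator_matchSet (ρ := ρ) hi (hBmem j hj) M hrm hrabs]
      have := h.le_integral_ratio_mul_binTail hM hMN
      rw [hτN] at this
      refine le_trans (le_of_eq ?_) this
      rw [he₂]; ring
    have hI3 : ∫ x, r (x i) ^ 2 ∂μ = A := by
      have h1 := map_eval_pi (fun k => ρ (d k)) i
      rw [hA, ← hi, ← h1,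
        integral_map (measurable_pi_apply i).aemeasurable (hrm.pow_const 2).aestronglyMeasurable]
    have hexp : ∀ x, ((matchedTimes M w i x d : ℝ) / M - c * r (x i)) ^ 2 =
        1 / (M : ℝ) ^ 2 * (∑ j ∈ B, χ j x) ^ 2 - 2 * c / M * (∑ j ∈ B, r (x i) * χ j x) +
          c ^ 2 * r (x i) ^ 2 := fun x => by
      rw [hKsum, ← Finset.mul_sum]; field_simp; ring
    have hK2i : Integrable (fun x => (∑ j ∈ B, χ j x) ^ 2) μ := by
      simp_rw [sq (∑ j ∈ B, χ j _), Finset.sum_mul_sum]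
      exact integrable_finsetSum _ fun j _ => integrable_finsetSum _ fun k _ => hχχi j k
    have hKri : Integrable (fun x => ∑ j ∈ B, r (x i) * χ j x) μ :=
      integrable_finsetSum _ fun j _ => hχr j
    simp_rw [hexp]
    have hi12 : Integrable (fun x => 1 / (M : ℝ) ^ 2 * (∑ j ∈ B, χ j x) ^ 2 -
        2 * c / M * (∑ j ∈ B, r (x i) * χ j x)) μ := (hK2i.const_mul _).sub (hKri.const_mul _)
    rw [integral_add hi12 (hr2i.const_mul _),
      integral_sub (hK2i.const_mul _) (hKri.const_mul _), integral_const_mul, integral_const_mul,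
      integral_const_mul, hI3]
    have hcτ : groupSize d (1 - w) * τ = c * M := by rw [hτ, hc]; ring
    rw [hC]
    exact expansion_le (by linarith) hc0 he₁0 he₂0 hθ0 hA1 hcτ hI1 hI2

end FixedLabels

/-! ### Inverse moments of a group size -/

/-- A shift of the binomial coefficient absorbs the inverse third moment. -/
lemma choose_mul_div_cube_le (n k : ℕ) :
    (n.choose k : ℝ) * (((n + 1 : ℕ) : ℝ) / ((k + 1 : ℕ) : ℝ)) ^ 3 ≤
      6 * ((n + 3).choose (k + 3) : ℝ) := by
  have h1 : (((n + 1).choose (k + 1) : ℕ) : ℝ) * (k + 1) = (n + 1) * (n.choose k) := by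
    exact_mod_cast (Nat.add_one_mul_choose_eq n k).symm
  have h2 : (((n + 2).choose (k + 2) : ℕ) : ℝ) * (k + 2) = (n + 2) * ((n + 1).choose (k + 1)) := by
    exact_mod_cast (Nat.add_one_mul_choose_eq (n + 1) (k + 1)).symm
  have h3 : (((n + 3).choose (k + 3) : ℕ) : ℝ) * (k + 3) = (n + 3) * ((n + 2).choose (k + 2)) := by
    exact_mod_cast (Nat.add_one_mul_choose_eq (n + 2) (k + 2)).symm
  have e1 : (((n + 1).choose (k + 1) : ℕ) : ℝ) = (n + 1) * (n.choose k) / (k + 1) := by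
    rw [eq_div_iff (by positivity)]; exact h1
  have e2 : (((n + 2).choose (k + 2) : ℕ) : ℝ) = (n + 2) * ((n + 1).choose (k + 1)) / (k + 2) := by
    rw [eq_div_iff (by positivity)]; exact h2
  have e3 : (((n + 3).choose (k + 3) : ℕ) : ℝ) = (n + 3) * ((n + 2).choose (k + 2)) / (k + 3) := by
    rw [eq_div_iff (by positivity)]; exact h3
  rw [e3, e2, e1]
  have hk : (0 : ℝ) ≤ k := Nat.cast_nonneg k
  have hn : (0 : ℝ) ≤ n := Nat.cast_nonneg n
  have e4 :
      6 * (((n : ℝ) + 3) * ((n + 2) * ((n + 1) * (n.choose k) / (k + 1)) / (k + 2)) / (k + 3)) =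
      (n.choose k : ℝ) * ((n + 1) * ((n + 2) * (n + 3)) * 6 / ((k + 1) * ((k + 2) * (k + 3)))) := by
    field_simp
  rw [e4]
  refine mul_le_mul_of_nonneg_left ?_ (Nat.cast_nonneg _)
  push_cast
  rw [div_pow, div_le_div_iff₀ (by positivity) (by positivity)]
  have h5 : ((k : ℝ) + 2) * (k + 3) ≤ 6 * (k + 1) ^ 2 := by nlinarith
  have h6 : ((n : ℝ) + 1) ^ 2 ≤ (n + 2) * (n + 3) := by nlinarith
  calc ((n : ℝ) + 1) ^ 3 * (((k : ℝ) + 1) * ((k + 2) * (k + 3))) =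
        ((n : ℝ) + 1) ^ 2 * (((k : ℝ) + 2) * (k + 3)) * ((n + 1) * (k + 1)) := by ring
    _ ≤ (((n : ℝ) + 2) * (n + 3)) * (6 * ((k : ℝ) + 1) ^ 2) * ((n + 1) * (k + 1)) := by gcongr
    _ = _ := by ring

/-- The third moment of `(n + 1) * p / (k + 1)` for a binomial `k` with `n` trials is at most
`6`. -/
lemma sum_choose_mul_one_add_cube_le (n : ℕ) {p : ℝ} (hp : 0 < p) (hp1 : p ≤ 1) :
    ∑ k ∈ Finset.range (n + 1), (n.choose k : ℝ) * (p ^ (k + 1) * (1 - p) ^ (n - k) *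
      (1 + (((n + 1 : ℕ) : ℝ) * p / ((k + 1 : ℕ) : ℝ)) ^ 3)) ≤ 7 * p := by
  have hq : 0 ≤ 1 - p := by linarith
  have h1 : ∑ k ∈ Finset.range (n + 1), (n.choose k : ℝ) * (p ^ k * (1 - p) ^ (n - k)) = 1 := by
    have := add_pow p (1 - p) n
    rw [add_sub_cancel, one_pow] at this
    exact (Finset.sum_congr rfl fun k _ => by ring).trans this.symm
  have h2 : ∑ k ∈ Finset.range (n + 1),
      ((n + 3).choose (k + 3) : ℝ) * (p ^ (k + 3) * (1 - p) ^ (n - k)) ≤ 1 := by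
    have h := add_pow p (1 - p) (n + 3)
    rw [add_sub_cancel, one_pow, show n + 3 + 1 = 3 + (n + 1) by ring,
      Finset.sum_range_add] at h
    have h3 : (0 : ℝ) ≤ ∑ x ∈ Finset.range 3,
        p ^ x * (1 - p) ^ (n + 3 - x) * ((n + 3).choose x : ℝ) :=
      Finset.sum_nonneg fun x _ => by positivity
    have h4 : ∑ k ∈ Finset.range (n + 1),
        ((n + 3).choose (k + 3) : ℝ) * (p ^ (k + 3) * (1 - p) ^ (n - k)) =
        ∑ k ∈ Finset.range (n + 1), p ^ (3 + k) * (1 - p) ^ (n + 3 - (3 + k)) *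
          ((n + 3).choose (3 + k) : ℝ) :=
      Finset.sum_congr rfl fun k _ => by
        rw [add_comm 3 k, Nat.add_sub_add_right]; ring
    rw [h4]; linarith
  calc _ ≤ ∑ k ∈ Finset.range (n + 1), (p * ((n.choose k : ℝ) * (p ^ k * (1 - p) ^ (n - k))) +
        6 * p * (((n + 3).choose (k + 3) : ℝ) * (p ^ (k + 3) * (1 - p) ^ (n - k)))) := by
        refine Finset.sum_le_sum fun k _ => ?_
        have h := choose_mul_div_cube_le n k
        have e : (n.choose k : ℝ) * (p ^ (k + 1) * (1 - p) ^ (n - k) *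
            (1 + (((n + 1 : ℕ) : ℝ) * p / ((k + 1 : ℕ) : ℝ)) ^ 3)) =
            p * ((n.choose k : ℝ) * (p ^ k * (1 - p) ^ (n - k))) +
            (n.choose k : ℝ) * (((n + 1 : ℕ) : ℝ) / ((k + 1 : ℕ) : ℝ)) ^ 3 *
              (p ^ (k + 4) * (1 - p) ^ (n - k)) := by
          rw [mul_div_right_comm, mul_pow]; ring
        rw [e]
        have h5 : 0 ≤ p ^ (k + 4) * (1 - p) ^ (n - k) := by positivity
        have h6 := mul_le_mul_of_nonneg_right h h5
        have e2 : 6 * p * (((n + 3).choose (k + 3) : ℝ) * (p ^ (k + 3) * (1 - p) ^ (n - k))) =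
            6 * ((n + 3).choose (k + 3) : ℝ) * (p ^ (k + 4) * (1 - p) ^ (n - k)) := by ring
        rw [e2]
        linarith
    _ ≤ p * 1 + 6 * p * 1 := by
        rw [Finset.sum_add_distrib, ← Finset.mul_sum, ← Finset.mul_sum, h1]
        gcongr
    _ = _ := by ring

lemma eq_label_or (v w : Fin 2) : v = w ∨ v = 1 - w := by
  fin_cases v <;> fin_cases w <;> decide

lemma prod_label_eq {n : ℕ} (d : Fin n → Fin 2) (w : Fin 2) (p : Fin 2 → ℝ) :
    ∏ j, p (d j) = p w ^ groupSize d w * p (1 - w) ^ (n - groupSize d w) := by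
  have h1 : ∀ j, p (d j) = if d j = w then p w else p (1 - w) := fun j => by
    rcases eq_label_or (d j) w with h | h
    · rw [if_pos h, h]
    · rw [if_neg (fun h' => label_ne w (h'.symm.trans h)), h]
  have h2 : (Finset.univ.filter fun j => ¬ d j = w).card = n - groupSize d w := by
    rw [← Finset.compl_filter, Finset.card_compl, Fintype.card_fin]; rfl
  rw [Finset.prod_congr rfl fun j _ => h1 j, Finset.prod_ite, Finset.prod_const,
    Finset.prod_const, h2]
  rfl

/-- If the labels are independent with law `p`, then on the event that unit `i` has label `w` the
size of its group is `1` plus a binomial variable; in particular the third inverse moment is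
under control. -/
lemma sum_labels_one_add_cube_le {n : ℕ} (i : Fin n) (w : Fin 2) {p : Fin 2 → ℝ}
    (hp : 0 < p w) (hp1 : p w + p (1 - w) = 1) (hp' : 0 ≤ p (1 - w)) :
    ∑ d ∈ Finset.univ.filter (fun d : Fin n → Fin 2 => d i = w),
      (∏ j, p (d j)) * (1 + ((n : ℝ) * p w / groupSize d w) ^ 3) ≤ 7 * p w := by
  obtain ⟨n, rfl⟩ : ∃ k, n = k + 1 := ⟨n - 1, by have := i.pos; omega⟩
  set f : ℕ → ℝ := fun k => p w ^ (k + 1) * (1 - p w) ^ (n - k) *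
    (1 + (((n + 1 : ℕ) : ℝ) * p w / ((k + 1 : ℕ) : ℝ)) ^ 3) with hf
  have hsum : ∑ d ∈ Finset.univ.filter (fun d : Fin (n + 1) → Fin 2 => d i = w),
      (∏ j, p (d j)) * (1 + (((n + 1 : ℕ) : ℝ) * p w / groupSize d w) ^ 3) =
      ∑ T ∈ (Finset.univ.erase i).powerset, f T.card := by
    refine Finset.sum_bij' (fun d _ => peers d w i)
      (fun T _ j => if j = i ∨ j ∈ T then w else 1 - w) ?_ ?_ ?_ ?_ ?_
    · intro d _
      rw [Finset.mem_powerset]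
      intro j hj
      simp only [peers, Finset.mem_filter] at hj
      simp [hj.2.1]
    · intro T _
      simp
    · intro d hd
      have hdi : d i = w := (Finset.mem_filter.1 hd).2
      funext j
      by_cases hj : j = i
      · simp [hj, hdi]
      · rcases eq_label_or (d j) w with h | h
        · simp [peers, hj, h]
        · simp [peers, hj, h, (label_ne w).symm]
    · intro T hT
      have hi : i ∉ T := fun h => by
        have := Finset.mem_powerset.1 hT h
        simp at this
      ext j
      by_cases hj : j = i
      · simp [peers, hj, hi]
      · by_cases hjT : j ∈ T <;> simp [peers, hj, hjT, (label_ne w).symm]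
    · intro d hd
      have hdi : d i = w := (Finset.mem_filter.1 hd).2
      have h1 : 1 - p w = p (1 - w) := by linarith
      simp only [hf, h1]
      rw [prod_label_eq d w p, groupSize_eq_card_peers_add_one hdi, Nat.add_sub_add_right]
  rw [hsum, Finset.sum_powerset_apply_card, Finset.card_erase_of_mem (Finset.mem_univ i),
    Finset.card_univ, Fintype.card_fin, Nat.add_sub_cancel]
  simp only [nsmul_eq_mul]
  exact sum_choose_mul_one_add_cube_le n hp (by linarith)

/-! ### Reduction of the mean error to fixed labels -/

section Measurability

variable {m n : ℕ}

lemma measurable_matchedTimes (M : ℕ) (w : Fin 2) (i : Fin n) (d : Fin n → Fin 2) :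
    Measurable fun x : Fin n → Cov m => (matchedTimes M w i x d : ℝ) := by
  by_cases hi : d i = w
  · have : (fun x : Fin n → Cov m => (matchedTimes M w i x d : ℝ)) = fun x =>
        ∑ j ∈ Finset.univ.filter (fun j => d j = 1 - w),
          (matchSet M d w i j).indicator (1 : (Fin n → Cov m) → ℝ) x := by
      funext x; exact matchedTimes_eq_sum hi M x
    rw [this]
    exact Finset.measurable_sum _ fun j _ =>
      measurable_one.indicator (measurableSet_matchSet M d w i j)
  · have : ∀ x : Fin n → Cov m, matchedTimes M w i x d = 0 := fun x => by
      simp [matchedTimes, nnIndexSet, hi]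
    simp only [this]
    exact measurable_const

lemma groupSize_le (d : Fin n → Fin 2) (w : Fin 2) : groupSize d w ≤ n := by
  rw [groupSize]
  simpa using Finset.card_le_univ (Finset.univ.filter fun j => d j = w)

lemma abs_ratioEstimator_le (M : ℕ) (w : Fin 2) (i : Fin n) (x : Fin n → Cov m)
    (d : Fin n → Fin 2) : |ratioEstimator M w i x d| ≤ n * n := by
  have hdiv : ∀ a b : ℕ, (a : ℝ) / b ≤ a := fun a b => by
    rcases Nat.eq_zero_or_pos b with rfl | hb
    · simp
    · exact div_le_self (Nat.cast_nonneg a) (by exact_mod_cast hb)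
  rw [ratioEstimator, abs_of_nonneg (by positivity)]
  refine mul_le_mul ((hdiv _ _).trans (by exact_mod_cast groupSize_le d w))
    ((hdiv _ _).trans ?_) (by positivity) (by positivity)
  exact_mod_cast (matchedTimes_le_groupSize M w i x d).trans (groupSize_le d _)

lemma measurable_ratioEstimator {Ω : Type*} [MeasurableSpace Ω] (M : ℕ) (w : Fin 2) (i : Fin n)
    {X : Fin n → Ω → Cov m} {D : Fin n → Ω → Fin 2} (hX : ∀ j, Measurable (X j))
    (hD : ∀ j, Measurable (D j)) :
    Measurable fun ω => ratioEstimator M w i (fun j => X j ω) (fun j => D j ω) := by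
  set F : (Fin n → Cov m) × (Fin n → Fin 2) → ℝ := fun z => ratioEstimator M w i z.1 z.2 with hF
  have h : Measurable F := by
    refine measurable_from_prod_countable_left fun d => ?_
    rw [hF]
    simp only [ratioEstimator]
    exact ((measurable_matchedTimes M w i d).div_const _).const_mul _
  have hXD : Measurable fun ω => ((fun j => X j ω, fun j => D j ω) :
      (Fin n → Cov m) × (Fin n → Fin 2)) :=
    (measurable_pi_lambda _ hX).prodMk (measurable_pi_lambda _ hD)
  have h2 := h.comp hXD
  simp only [Function.comp_def, hF] at h2
  exact h2

lemma measurable_propensity (Q : Measure (Cov m × Fin 2)) [IsFiniteMeasure Q] :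
    Measurable (propensity Q) :=
  (Kernel.measurable_coe Q.condKernel (measurableSet_singleton 1)).ennreal_toReal

lemma measurable_densityRatio (Q : Measure (Cov m × Fin 2)) [IsFiniteMeasure Q] (w : Fin 2) :
    Measurable (densityRatio Q w) := by
  have := measurable_propensity Q
  unfold densityRatio
  split_ifs <;> fun_prop

end Measurability

lemma labelProb_pos_iff {m : ℕ} (Q : Measure (Cov m × Fin 2)) [IsFiniteMeasure Q] (v : Fin 2) :
    0 < labelProb Q v ↔ Q (Set.univ ×ˢ {v}) ≠ 0 := by
  rw [labelProb, Measure.real, ENNReal.toReal_pos_iff]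
  exact ⟨fun h => h.1.ne', fun h => ⟨pos_iff_ne_zero.2 h, measure_lt_top _ _⟩⟩

lemma covLaw_apply {m : ℕ} (Q : Measure (Cov m × Fin 2)) [IsFiniteMeasure Q] (v : Fin 2)
    {s : Set (Cov m)} (hs : MeasurableSet s) :
    covLaw Q v s = (Q (Set.univ ×ˢ {v}))⁻¹ * Q (s ×ˢ {v}) := by
  rw [covLaw, Measure.map_apply measurable_fst hs,
    cond_apply (MeasurableSet.univ.prod (measurableSet_singleton v))]
  congr 2
  ext ⟨x, u⟩
  simp [and_comm]

section Sample

variable {Ω : Type*} [MeasurableSpace Ω] {P : Measure Ω} {m n : ℕ}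
  {X : Fin n → Ω → Cov m} {D : Fin n → Ω → Fin 2} {Q : Measure (Cov m × Fin 2)}

lemma prob_label (hs : IsSample P X D Q) (i : Fin n) (w : Fin 2) :
    P.real {ω | D i ω = w} = labelProb Q w := by
  have hXD : Measurable fun ω => (X i ω, D i ω) :=
    (hs.measurable_cov i).prodMk (hs.measurable_label i)
  rw [labelProb, ← hs.law i, Measure.real, Measure.real,
    Measure.map_apply hXD (MeasurableSet.univ.prod (measurableSet_singleton w))]
  congr 2
  ext ω
  simp

variable [IsProbabilityMeasure Q]

lemma isProbabilityMeasure_covLaw {v : Fin 2} (hv : 0 < labelProb Q v) :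
    IsProbabilityMeasure (covLaw Q v) := by
  have := cond_isProbabilityMeasure ((labelProb_pos_iff Q v).1 hv)
  exact Measure.isProbabilityMeasure_map measurable_fst.aemeasurable

/-- Given the labels, the covariates are independent, each with the conditional law of its
label. -/
lemma map_restrict_labels (hs : IsSample P X D Q) (hp : ∀ v, 0 < labelProb Q v)
    (d : Fin n → Fin 2) :
    (P.restrict {ω | ∀ j, D j ω = d j}).map (fun ω j => X j ω) =
      (∏ j, Q (Set.univ ×ˢ {d j})) • Measure.pi fun j => covLaw Q (d j) := by
  have hX : Measurable fun ω j => X j ω := measurable_pi_lambda _ hs.measurable_cov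
  have hXD : ∀ j, Measurable fun ω => (X j ω, D j ω) := fun j =>
    (hs.measurable_cov j).prodMk (hs.measurable_label j)
  have := fun v => isProbabilityMeasure_covLaw (Q := Q) (hp v)
  have hne : ∀ v, Q (Set.univ ×ˢ {v}) ≠ 0 := fun v => (labelProb_pos_iff Q v).1 (hp v)
  set c := ∏ j, Q (Set.univ ×ˢ {d j}) with hc
  have hc0 : c ≠ 0 := Finset.prod_ne_zero_iff.2 fun j _ => hne _
  have hct : c ≠ ⊤ := ENNReal.prod_ne_top fun j _ => measure_ne_top _ _
  have hpi : (Measure.pi fun j => covLaw Q (d j)) =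
      c⁻¹ • (P.restrict {ω | ∀ j, D j ω = d j}).map (fun ω j => X j ω) := by
    refine Measure.pi_eq fun s hsm => ?_
    rw [Measure.smul_apply, Measure.map_apply hX (MeasurableSet.univ_pi hsm),
      Measure.restrict_apply (hX (MeasurableSet.univ_pi hsm)), smul_eq_mul]
    have hset : (fun ω j => X j ω) ⁻¹' Set.univ.pi s ∩ {ω | ∀ j, D j ω = d j} =
        ⋂ j ∈ Finset.univ, (fun ω => (X j ω, D j ω)) ⁻¹' (s j ×ˢ {d j}) := by
      ext ω
      simp [forall_and]
    rw [hset, hs.indep.measure_inter_preimage_eq_mul Finset.univ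
      fun j _ => (hsm j).prod (measurableSet_singleton _)]
    have h1 : ∀ j, P ((fun ω => (X j ω, D j ω)) ⁻¹' (s j ×ˢ {d j})) =
        Q (Set.univ ×ˢ {d j}) * covLaw Q (d j) (s j) := fun j => by
      rw [← Measure.map_apply (hXD j) ((hsm j).prod (measurableSet_singleton _)), hs.law j,
        covLaw_apply Q _ (hsm j), ← mul_assoc, ENNReal.mul_inv_cancel (hne _) (measure_ne_top _ _),
        one_mul]
    rw [Finset.prod_congr rfl fun j _ => h1 j, Finset.prod_mul_distrib, ← hc, ← mul_assoc,
      ENNReal.inv_mul_cancel hc0 hct, one_mul]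
  rw [hpi, smul_smul, ENNReal.mul_inv_cancel hc0 hct, one_smul]

/-- The squared difference between the (scaled) number of matches and its target. -/
noncomputable def scaledError (Q : Measure (Cov m × Fin 2)) [IsFiniteMeasure Q] (M : ℕ)
    (w : Fin 2) (i : Fin n) (d : Fin n → Fin 2) (x : Fin n → Cov m) : ℝ :=
  ((matchedTimes M w i x d : ℝ) / M -
    (groupSize d (1 - w) : ℝ) / groupSize d w * densityRatio Q w (x i)) ^ 2

lemma measurable_scaledError (Q : Measure (Cov m × Fin 2)) [IsFiniteMeasure Q] (M : ℕ)
    (w : Fin 2) (i : Fin n) (d : Fin n → Fin 2) : Measurable (scaledError Q M w i d) :=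
  (((measurable_matchedTimes M w i d).div_const _).sub
    (((measurable_densityRatio Q w).comp (measurable_pi_apply i)).const_mul _)).pow_const 2

/-- The weight in the mean error clears the group sizes from the squared error. If no unit has
the opposite label, both sides vanish. -/
lemma weight_mul_sqError (Q : Measure (Cov m × Fin 2)) [IsFiniteMeasure Q] (M : ℕ) {w : Fin 2}
    {i : Fin n} {d : Fin n → Fin 2} (hi : d i = w) (x : Fin n → Cov m) :
    ((groupSize d (1 - w) : ℝ) / groupSize d w) ^ 2 *
      (ratioEstimator M w i x d - densityRatio Q w (x i)) ^ 2 = scaledError Q M w i d x := by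
  have hw : (groupSize d w : ℝ) ≠ 0 := by
    rw [groupSize_eq_card_peers_add_one hi]; positivity
  rw [scaledError, ratioEstimator, ← mul_pow]
  rcases Nat.eq_zero_or_pos (groupSize d (1 - w)) with h0 | h0
  · have h1 : matchedTimes M w i x d = 0 := by
      have := matchedTimes_le_groupSize M w i x d
      omega
    simp [h0, h1]
  · have h1 : (groupSize d (1 - w) : ℝ) ≠ 0 := by positivity
    congr 1
    rw [mul_sub, ← mul_assoc, div_mul_div_cancel₀ hw, div_self h1, one_mul]

variable [IsProbabilityMeasure P]

/-- The mean error is the average over the label vectors with `d i = w` of the error for fixed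
labels. -/
lemma meanError_eq_sum (hs : IsSample P X D Q) (hp : ∀ v, 0 < labelProb Q v) (M : ℕ) (w : Fin 2)
    (i : Fin n) (hint : Integrable (sqError X D Q M w i) P) :
    meanError P X D Q M w i = (labelProb Q w)⁻¹ *
      ∑ d ∈ Finset.univ.filter (fun d : Fin n → Fin 2 => d i = w),
        (∏ j, labelProb Q (d j)) *
          ∫ x, scaledError Q M w i d x ∂(Measure.pi fun j => covLaw Q (d j)) := by
  have hX : Measurable fun ω j => X j ω := measurable_pi_lambda _ hs.measurable_cov
  have hD : Measurable fun ω j => D j ω := measurable_pi_lambda _ hs.measurable_label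
  have hm : labelSigma D ≤ (inferInstance : MeasurableSpace Ω) := hD.comap_le
  set f := sqError X D Q M w i with hf
  set G : (Fin n → Fin 2) → ℝ := fun d =>
    if d i = w then ((groupSize d (1 - w) : ℝ) / groupSize d w) ^ 2 else 0 with hG
  have hSi : MeasurableSet {ω | D i ω = w} := hs.measurable_label i (measurableSet_singleton w)
  have hGm : StronglyMeasurable[labelSigma D] fun ω => G fun j => D j ω := by
    refine Measurable.stronglyMeasurable ?_
    exact (measurable_of_finite G).comp (comap_measurable fun ω j => D j ω)
  obtain ⟨C, hC⟩ : ∃ C, ∀ d, ‖G d‖ ≤ C := by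
    obtain ⟨C, hC⟩ := (Set.finite_range fun d => ‖G d‖).bddAbove
    exact ⟨C, fun d => hC ⟨d, rfl⟩⟩
  have hpull : ∫ ω, G (fun j => D j ω) * (P[f | labelSigma D]) ω ∂P =
      ∫ ω, G (fun j => D j ω) * f ω ∂P := by
    have h1 := condExp_stronglyMeasurable_mul_of_bound hm hGm hint C
      (Eventually.of_forall fun ω => hC fun j => D j ω)
    rw [← integral_condExp hm (f := fun ω => G (fun j => D j ω) * f ω)]
    exact integral_congr_ae h1.symm
  have hstart : meanError P X D Q M w i =
      (labelProb Q w)⁻¹ * ∫ ω, G (fun j => D j ω) * (P[f | labelSigma D]) ω ∂P := by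
    rw [meanError, ProbabilityTheory.cond, integral_smul_measure, ENNReal.toReal_inv,
      smul_eq_mul]
    congr 1
    · rw [← prob_label hs i w]; rfl
    · rw [← integral_indicator hSi]
      refine integral_congr_ae (Eventually.of_forall fun ω => ?_)
      by_cases hω : D i ω = w
      · have hpos : 0 < groupSize (fun j => D j ω) w := by
          rw [groupSize_eq_card_peers_add_one (d := fun j => D j ω) hω]; omega
        simp only [hG]
        rw [Set.indicator_of_mem (show ω ∈ {ω | D i ω = w} from hω), if_pos hpos, if_pos hω,
          mul_one]
      · simp only [hG]
        rw [Set.indicator_of_notMem (show ω ∉ {ω | D i ω = w} from hω), if_neg hω, zero_mul]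
  rw [hstart, hpull]
  congr 1
  have hSd : ∀ d : Fin n → Fin 2, MeasurableSet {ω | ∀ j, D j ω = d j} := fun d => by
    have : {ω | ∀ j, D j ω = d j} = (fun ω j => D j ω) ⁻¹' {d} := by
      ext ω; simp [funext_iff]
    rw [this]
    exact hD (measurableSet_singleton d)
  have hsplit : ∀ ω, G (fun j => D j ω) * f ω =
      ∑ d : Fin n → Fin 2, {ω | ∀ j, D j ω = d j}.indicator (fun ω => G d * f ω) ω := by
    intro ω
    rw [Finset.sum_eq_single (fun j => D j ω)]
    · rw [Set.indicator_of_mem (by simp)]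
    · intro d _ hd
      rw [Set.indicator_of_notMem]
      exact fun h => hd (funext fun j => (h j).symm)
    · intro h; exact absurd (Finset.mem_univ _) h
  simp_rw [hsplit]
  rw [integral_finsetSum _ fun d _ => (hint.const_mul (G d)).indicator (hSd d), Finset.sum_filter]
  refine Finset.sum_congr rfl fun d _ => ?_
  rw [integral_indicator (hSd d)]
  by_cases hd : d i = w
  · rw [if_pos hd]
    have h1 : ∫ ω in {ω | ∀ j, D j ω = d j}, G d * f ω ∂P =
        ∫ ω in {ω | ∀ j, D j ω = d j}, scaledError Q M w i d (fun j => X j ω) ∂P := by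
      refine setIntegral_congr_fun (hSd d) fun ω hω => ?_
      have hDω : (fun j => D j ω) = d := funext hω
      simp only [hG, if_pos hd, hf, sqError, hDω]
      exact weight_mul_sqError Q M hd _
    rw [h1, ← integral_map (μ := P.restrict {ω | ∀ j, D j ω = d j}) (φ := fun ω j => X j ω)
      (f := scaledError Q M w i d) hX.aemeasurable
      (measurable_scaledError Q M w i d).aestronglyMeasurable, map_restrict_labels hs hp d,
      integral_smul_measure, ENNReal.toReal_prod, smul_eq_mul]
    rfl
  · simp [hd, hG]

end Sample

/-! ### The population -/

section Population

variable {m : ℕ} {Q : Measure (Cov m × Fin 2)} [IsProbabilityMeasure Q] {𝕏 : Set (Cov m)}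
  {gmin gmax : ℝ} {gLow gUp : Fin 2 → ℝ} {L a H η : ℝ}

/-- Disintegration of the joint law along the covariate. -/
lemma measure_prod_label (Q : Measure (Cov m × Fin 2)) [IsProbabilityMeasure Q]
    {s : Set (Cov m)} (hs : MeasurableSet s) (v : Fin 2) :
    Q (s ×ˢ {v}) = ∫⁻ x in s, Q.condKernel x {v} ∂Q.fst := by
  conv_lhs => rw [← Q.disintegrate Q.condKernel]
  rw [Measure.compProd_apply_prod hs (measurableSet_singleton v)]

lemma propensity_eq_zero_label (Q : Measure (Cov m × Fin 2)) [IsProbabilityMeasure Q]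
    (x : Cov m) : 1 - propensity Q x = (Q.condKernel x).real {0} := by
  have h : ({1} : Set (Fin 2))ᶜ = {0} := by ext v; fin_cases v <;> simp
  rw [propensity, ← probReal_compl_eq_one_sub (measurableSet_singleton 1), h]

lemma densityRatio_eq (Q : Measure (Cov m × Fin 2)) [IsProbabilityMeasure Q] (w : Fin 2)
    (x : Cov m) : densityRatio Q w x = labelProb Q w / labelProb Q (1 - w) *
      ((Q.condKernel x).real {1 - w} / (Q.condKernel x).real {w}) := by
  have h0 := propensity_eq_zero_label Q x
  rcases eq_label_or w 0 with rfl | rfl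
  · simp only [densityRatio, if_true, h0]
    rfl
  · have h1 : (1 - 0 : Fin 2) ≠ 0 := by decide
    simp only [densityRatio, if_neg h1, h0]
    rfl

namespace DataAssumptions

lemma overlap_label (hA : DataAssumptions Q 𝕏 gmin gmax gLow gUp L a H η) (v : Fin 2) :
    ∀ᵐ x ∂Q.fst, η ≤ (Q.condKernel x).real {v} ∧ (Q.condKernel x).real {v} ≤ 1 - η := by
  filter_upwards [hA.overlap] with x hx
  rcases eq_label_or v 1 with rfl | rfl
  · exact hx
  · have h := propensity_eq_zero_label Q x
    have h1 : (1 - 1 : Fin 2) = 0 := rfl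
    rw [h1, ← h]
    exact ⟨by linarith [hx.2], by linarith [hx.1]⟩

lemma mul_fst_le (hA : DataAssumptions Q 𝕏 gmin gmax gLow gUp L a H η) {s : Set (Cov m)}
    (hs : MeasurableSet s) (v : Fin 2) : ENNReal.ofReal η * Q.fst s ≤ Q (s ×ˢ {v}) := by
  rw [measure_prod_label Q hs, ← setLIntegral_const]
  refine lintegral_mono_ae (ae_restrict_of_ae ?_)
  filter_upwards [hA.overlap_label v] with x hx
  rw [← ofReal_measureReal]
  exact ENNReal.ofReal_le_ofReal hx.1

lemma le_labelProb (hA : DataAssumptions Q 𝕏 gmin gmax gLow gUp L a H η) (hη : 0 < η)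
    (v : Fin 2) : η ≤ labelProb Q v := by
  have h := ENNReal.toReal_mono (measure_ne_top _ _) (hA.mul_fst_le MeasurableSet.univ v)
  rwa [measure_univ, mul_one, ENNReal.toReal_ofReal hη.le] at h

lemma labelProb_pos (hA : DataAssumptions Q 𝕏 gmin gmax gLow gUp L a H η) (hη : 0 < η)
    (v : Fin 2) : 0 < labelProb Q v := hη.trans_le (hA.le_labelProb hη v)

lemma labelProb_add (Q : Measure (Cov m × Fin 2)) [IsProbabilityMeasure Q] (w : Fin 2) :
    labelProb Q w + labelProb Q (1 - w) = 1 := by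
  have h : (Set.univ ×ˢ {1 - w} : Set (Cov m × Fin 2)) = (Set.univ ×ˢ {w})ᶜ := by
    ext ⟨x, v⟩
    rcases eq_label_or v w with rfl | rfl
    · simp [label_ne v]
    · simp [(label_ne w).symm]
  rw [labelProb, labelProb, h,
    probReal_compl_eq_one_sub (MeasurableSet.univ.prod (measurableSet_singleton w))]
  ring

lemma covLaw_absolutelyContinuous (v : Fin 2) : covLaw Q v ≪ Q.fst := by
  refine Measure.AbsolutelyContinuous.mk fun s hs h0 => ?_
  have h1 : Q (s ×ˢ {v}) = 0 := by
    refine measure_mono_null (fun z hz => ?_) ((Measure.fst_apply hs).symm.trans h0)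
    exact hz.1
  rw [covLaw_apply Q v hs, h1, mul_zero]

/-- By overlap, each label has positive conditional probability almost everywhere. -/
lemma fst_absolutelyContinuous (hA : DataAssumptions Q 𝕏 gmin gmax gLow gUp L a H η)
    (hη : 0 < η) (v : Fin 2) : Q.fst ≪ covLaw Q v := by
  refine Measure.AbsolutelyContinuous.mk fun s hs h0 => ?_
  rw [covLaw_apply Q v hs, mul_eq_zero] at h0
  have h1 : Q (s ×ˢ {v}) = 0 :=
    h0.resolve_left (ENNReal.inv_ne_zero.2 (measure_ne_top _ _))
  have h2 := hA.mul_fst_le hs v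
  rw [h1, nonpos_iff_eq_zero, mul_eq_zero, ENNReal.ofReal_eq_zero] at h2
  exact h2.resolve_left (not_le.2 hη)

/-- Overlap forces both conditional laws to have the same support as the covariate. -/
lemma support_covLaw (hA : DataAssumptions Q 𝕏 gmin gmax gLow gUp L a H η) (hη : 0 < η)
    (v : Fin 2) : (covLaw Q v).support = 𝕏 := by
  rw [← hA.support_eq]
  exact Set.Subset.antisymm (covLaw_absolutelyContinuous v).support_mono
    (hA.fst_absolutelyContinuous hη v).support_mono

lemma covLaw_compl (hA : DataAssumptions Q 𝕏 gmin gmax gLow gUp L a H η) (hη : 0 < η)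
    (v : Fin 2) : covLaw Q v 𝕏ᶜ = 0 := by
  rw [← hA.support_covLaw hη v]
  exact Measure.measure_compl_support

/-- A convex set with empty interior is a null set, but `𝕏` carries a law with a density. -/
lemma interior_nonempty (hA : DataAssumptions Q 𝕏 gmin gmax gLow gUp L a H η) :
    (interior 𝕏).Nonempty := by
  by_contra hne
  rw [Set.not_nonempty_iff_eq_empty] at hne
  obtain ⟨g, -, hg, -⟩ := hA.density
  have h1 : (volume : Measure (Cov m)) 𝕏 = 0 := by
    refine measure_mono_null ?_ (hA.convex.addHaar_frontier volume)
    rw [frontier, hne, Set.sdiff_empty]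
    exact subset_closure
  have h2 : Q.fst 𝕏 = 0 := by
    have hac : Q.fst ≪ volume := hg ▸ withDensity_absolutelyContinuous _ _
    exact hac h1
  have h3 : Q.fst 𝕏ᶜ = 0 := by
    rw [← hA.support_eq]; exact Measure.measure_compl_support
  have h4 : Q.fst Set.univ ≤ 0 := by
    rw [← Set.union_compl_self 𝕏]
    exact (measure_union_le _ _).trans (by rw [h2, h3, add_zero])
  rw [measure_univ] at h4
  exact absurd h4 (by simp)

/-- By Bayes' formula the target of the estimator is the ratio of the conditional densities. -/
lemma exists_densityPair (hA : DataAssumptions Q 𝕏 gmin gmax gLow gUp L a H η) (hη : 0 < η)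
    (hm : 1 ≤ m) (hgmin : 0 < gmin) (hgLow : ∀ w, 0 < gLow w) (hL : 0 < L) (ha : 0 < a)
    {b : ℝ} (hb : 0 ≤ b)
    (hlayer : ∀ ε : ℝ, 0 ≤ ε →
      (volume : Measure (Cov m)).real {x | x ∈ 𝕏 ∧ ¬ Metric.closedBall x ε ⊆ 𝕏} ≤ b * ε)
    (w : Fin 2) :
    ∃ g g' : Cov m → ℝ, DensityPair 𝕏 (covLaw Q w) (covLaw Q (1 - w)) g g'
        (min (gLow 0) (gLow 1)) (max (gUp 0) (gUp 1)) L a b ∧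
      ∀ᵐ x ∂(covLaw Q w), densityRatio Q w x = DensityPair.ratio 𝕏 g g' x := by
  have hprob := fun v => isProbabilityMeasure_covLaw (hA.labelProb_pos hη v)
  obtain ⟨g₀, hg₀m, hg₀, hg₀b⟩ := hA.density
  choose g hgm hg hlip hbd using hA.condDensity
  simp only [hA.support_covLaw hη] at hlip hbd
  have hlow : ∀ v, min (gLow 0) (gLow 1) ≤ gLow v := fun v => by
    fin_cases v
    · exact min_le_left _ _
    · exact min_le_right _ _
  have hup : ∀ v, gUp v ≤ max (gUp 0) (gUp 1) := fun v => by
    fin_cases v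
    · exact le_max_left _ _
    · exact le_max_right _ _
  have hball : ∀ z ∈ 𝕏, ∀ δ : ℝ, 0 < δ → δ ≤ Metric.diam 𝕏 →
      ENNReal.ofReal a * volume (Metric.closedBall z δ) ≤
        volume (Metric.closedBall z δ ∩ 𝕏) := fun z hz δ h1 h2 => by
    have h := hA.ballVolume 0 z
    simp only [hA.support_covLaw hη] at h
    exact h hz δ h1 h2
  refine ⟨g w, g (1 - w), ?_, ?_⟩
  · exact {
      one_le_dim := hm
      l_pos := lt_min (hgLow 0) (hgLow 1)
      L_pos := hL
      a_pos := ha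
      b_nonneg := hb
      compact := hA.compact
      prob := hprob w
      prob' := hprob (1 - w)
      meas := hgm w
      meas' := hgm (1 - w)
      dens := hg w
      dens' := hg (1 - w)
      null := hA.covLaw_compl hη w
      null' := hA.covLaw_compl hη (1 - w)
      bounds := fun x hx => ⟨(hlow w).trans (hbd w x hx).1, (hbd w x hx).2.trans (hup w)⟩
      bounds' := fun x hx =>
        ⟨(hlow (1 - w)).trans (hbd (1 - w) x hx).1, (hbd (1 - w) x hx).2.trans (hup (1 - w))⟩
      lip := fun x hx z hz => by rw [dist_eq_norm]; exact hlip w w x hx z hz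
      lip' := fun x hx z hz => by rw [dist_eq_norm]; exact hlip (1 - w) w x hx z hz
      ball := hball
      layer := hlayer }
  · -- the two expressions for the joint density of `X` and `D` agree almost everywhere
    have hbayes : ∀ v, ∀ᵐ x ∂(volume : Measure (Cov m)),
        ENNReal.ofReal (g₀ x) * Q.condKernel x {v} =
          Q (Set.univ ×ˢ {v}) * ENNReal.ofReal (g v x) := by
      intro v
      have hκ : Measurable fun x => Q.condKernel x {v} :=
        Kernel.measurable_coe Q.condKernel (measurableSet_singleton v)
      have hne : Q (Set.univ ×ˢ {v}) ≠ 0 := (labelProb_pos_iff Q v).1 (hA.labelProb_pos hη v)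
      have h1 : (volume : Measure (Cov m)).withDensity
          ((fun x => ENNReal.ofReal (g₀ x)) * fun x => Q.condKernel x {v}) =
          volume.withDensity (Q (Set.univ ×ˢ {v}) • fun x => ENNReal.ofReal (g v x)) := by
        rw [withDensity_mul _ hg₀m.ennreal_ofReal hκ, ← hg₀,
          withDensity_smul _ (hgm v).ennreal_ofReal, ← hg v]
        ext s hs
        rw [withDensity_apply _ hs, ← measure_prod_label Q hs, Measure.smul_apply,
          covLaw_apply Q v hs, smul_eq_mul, ← mul_assoc,
          ENNReal.mul_inv_cancel hne (measure_ne_top _ _), one_mul]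
      have h2 : ∫⁻ x, ((fun x => ENNReal.ofReal (g₀ x)) * fun x => Q.condKernel x {v}) x
          ∂(volume : Measure (Cov m)) ≠ ⊤ := by
        rw [← setLIntegral_univ, ← withDensity_apply _ MeasurableSet.univ,
          withDensity_mul _ hg₀m.ennreal_ofReal hκ, ← hg₀, withDensity_apply _ MeasurableSet.univ,
          ← measure_prod_label Q MeasurableSet.univ]
        exact measure_ne_top _ _
      exact (withDensity_eq_iff (hg₀m.ennreal_ofReal.mul hκ).aemeasurable
        ((hgm v).ennreal_ofReal.const_smul _).aemeasurable h2).1 h1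
    have hac : covLaw Q w ≪ volume := by
      rw [hg w]; exact withDensity_absolutelyContinuous _ _
    have hmem : ∀ᵐ x ∂(covLaw Q w), x ∈ 𝕏 := ae_iff.2 (hA.covLaw_compl hη w)
    filter_upwards [hmem, hac.ae_le (hbayes w), hac.ae_le (hbayes (1 - w))] with x hx h1 h2
    have hpos : ∀ v, 0 < g v x := fun v => (hgLow v).trans_le (hbd v x hx).1
    have hg0 : 0 < g₀ x := hgmin.trans_le (hg₀b x hx).1
    have hreal : ∀ v, ENNReal.ofReal (g₀ x) * Q.condKernel x {v} =
        Q (Set.univ ×ˢ {v}) * ENNReal.ofReal (g v x) →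
        (Q.condKernel x).real {v} = labelProb Q v * g v x / g₀ x := fun v h => by
      have := congrArg ENNReal.toReal h
      rw [ENNReal.toReal_mul, ENNReal.toReal_mul, ENNReal.toReal_ofReal hg0.le,
        ENNReal.toReal_ofReal (hpos v).le] at this
      rw [eq_div_iff hg0.ne', mul_comm]
      exact this
    rw [densityRatio_eq, hreal w h1, hreal (1 - w) h2, DensityPair.ratio,
      Set.indicator_of_mem hx]
    have hp1 := hA.labelProb_pos hη w
    have hp2 := hA.labelProb_pos hη (1 - w)
    have hgw := hpos w
    field_simp

/-- The estimator is bounded for fixed `n`, and overlap bounds the density ratio. -/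
lemma integrable_sqError (hA : DataAssumptions Q 𝕏 gmin gmax gLow gUp L a H η) (hη : 0 < η)
    {Ω : Type*} [MeasurableSpace Ω] {P : Measure Ω} [IsProbabilityMeasure P] {n : ℕ}
    {X : Fin n → Ω → Cov m} {D : Fin n → Ω → Fin 2} (hs : IsSample P X D Q) (M : ℕ) (w : Fin 2)
    (i : Fin n) : Integrable (sqError X D Q M w i) P := by
  set R := labelProb Q w / labelProb Q (1 - w) * (1 / η) with hR
  have hR0 : 0 ≤ R := by
    have := hA.labelProb_pos hη w
    have := hA.labelProb_pos hη (1 - w)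
    positivity
  have hbound : ∀ᵐ x ∂Q.fst, |densityRatio Q w x| ≤ R := by
    filter_upwards [hA.overlap_label w] with x hx
    have h1 := hA.labelProb_pos hη w
    have h2 := hA.labelProb_pos hη (1 - w)
    have h3 : (Q.condKernel x).real {1 - w} ≤ 1 := measureReal_le_one
    rw [densityRatio_eq, abs_of_nonneg (by positivity), hR]
    refine mul_le_mul_of_nonneg_left ?_ (by positivity)
    exact div_le_div₀ zero_le_one h3 hη hx.1
  have hXD : Measurable fun ω => (X i ω, D i ω) :=
    (hs.measurable_cov i).prodMk (hs.measurable_label i)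
  have hlaw : P.map (X i) = Q.fst := by
    rw [← hs.law i, Measure.fst, Measure.map_map measurable_fst hXD]
    rfl
  have hboundΩ : ∀ᵐ ω ∂P, |densityRatio Q w (X i ω)| ≤ R := by
    rw [← hlaw] at hbound
    exact ae_of_ae_map (hs.measurable_cov i).aemeasurable hbound
  have hmeas : Measurable (sqError X D Q M w i) :=
    ((measurable_ratioEstimator M w i hs.measurable_cov hs.measurable_label).sub
      ((measurable_densityRatio Q w).comp (hs.measurable_cov i))).pow_const 2
  refine Integrable.of_bound hmeas.aestronglyMeasurable (((n : ℝ) * n + R) ^ 2) ?_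
  filter_upwards [hboundΩ] with ω hω
  rw [sqError, norm_pow, Real.norm_eq_abs]
  refine pow_le_pow_left₀ (abs_nonneg _) ((abs_sub _ _).trans ?_) 2
  exact add_le_add (abs_ratioEstimator_le M w i _ _) hω

end DataAssumptions

end Population

/-! ### The bound on the mean error -/

lemma DensityPair.fixedLabelConst_nonneg {m : ℕ} {𝕏 : Set (Cov m)} {ν ν' : Measure (Cov m)}
    {g g' : Cov m → ℝ} {l u L a b : ℝ} (h : DensityPair 𝕏 ν ν' g g' l u L a b) :
    0 ≤ fixedLabelConst m l u L a b := by
  have hl := h.l_pos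
  have hL := h.L_pos
  have hu := h.u_pos
  have := h.squareConst_nonneg
  have := massRadius_nonneg (m := m) hl h.a_pos zero_le_one
  unfold fixedLabelConst; positivity

/-- The bound for fixed labels in terms of `s = n * p_w / n_w`, whose third moment is bounded. -/
lemma fixedLabel_bound_le {m n N N' M : ℕ} {p η C : ℝ} (hm : 1 ≤ m) (hM : 1 ≤ M) (hN : 1 ≤ N)
    (hNn : N ≤ n) (hN' : N' ≤ n) (hη : 0 < η) (hηp : η ≤ p) (hC : 0 ≤ C) :
    (N' : ℝ) / N / M + ((N' : ℝ) / N) ^ 2 * (C * (1 / M + ((M : ℝ) / N) ^ (1 / (m : ℝ)))) ≤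
      (1 + ((n : ℝ) * p / N) ^ 3) *
        (((1 + C) * (1 / M) + 2 * C * ((M : ℝ) / (n * η)) ^ (1 / (m : ℝ))) / p ^ 2) := by
  have hp : 0 < p := hη.trans_le hηp
  have hM' : (0 : ℝ) < M := by exact_mod_cast hM
  have hN0 : (0 : ℝ) < N := by exact_mod_cast hN
  have hNn' : (N : ℝ) ≤ n := by exact_mod_cast hNn
  have hN'n : (N' : ℝ) ≤ n := by exact_mod_cast hN'
  have hn0 : (0 : ℝ) < n := hN0.trans_le hNn'
  set c := (N' : ℝ) / N
  have hc0 : 0 ≤ c := by positivity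
  set s := (n : ℝ) * p / N with hs
  have hs0 : 0 < s := by positivity
  have hcs : c ≤ s / p := by
    rw [hs]
    calc c ≤ (n : ℝ) / N := div_le_div_of_nonneg_right hN'n hN0.le
      _ = _ := by field_simp
  have h1s : 1 ≤ s / p := by
    rw [hs, show (n : ℝ) * p / N / p = n / N by field_simp, one_le_div hN0]
    exact hNn'
  have hτ0 : (0 : ℝ) < M / (n * η) := by positivity
  have hθ := rpow_inv_le_mul_one_add_div hm (t := (M : ℝ) / N) (by positivity) hτ0
  set θ := ((M : ℝ) / (n * η)) ^ (1 / (m : ℝ))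
  have hθ0 : 0 ≤ θ := by positivity
  have hratio : (M : ℝ) / N / (M / (n * η)) ≤ s := by
    rw [hs, show (M : ℝ) / N / (M / (n * η)) = n * η / N by field_simp]
    gcongr
  have hcM : c ≤ (s / p) ^ 2 := hcs.trans (le_self_pow₀ h1s (by norm_num))
  have hc2 : c ^ 2 ≤ (s / p) ^ 2 := pow_le_pow_left₀ hc0 hcs 2
  have hs2 : s ^ 2 ≤ 1 + s ^ 3 := by
    nlinarith [sq_nonneg (s - 1), mul_nonneg hs0.le (sq_nonneg (s - 1))]
  calc c / M + c ^ 2 * (C * (1 / M + ((M : ℝ) / N) ^ (1 / (m : ℝ))))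
      ≤ (s / p) ^ 2 / M + (s / p) ^ 2 * (C * (1 / M + θ * (1 + s))) := by
        gcongr
        exact hθ.trans (by gcongr)
    _ = s ^ 2 * (((1 + C) * (1 / M)) / p ^ 2) + (s ^ 2 + s ^ 3) * (C * θ / p ^ 2) := by
        field_simp; ring
    _ ≤ (1 + s ^ 3) * (((1 + C) * (1 / M)) / p ^ 2) + (2 * (1 + s ^ 3)) * (C * θ / p ^ 2) := by
        gcongr
        linarith
    _ = _ := by ring

namespace DataAssumptions

variable {m : ℕ} {Q : Measure (Cov m × Fin 2)} [IsProbabilityMeasure Q] {𝕏 : Set (Cov m)}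
  {gmin gmax : ℝ} {gLow gUp : Fin 2 → ℝ} {L a H η : ℝ}

/-- Insert the bound for fixed labels and average over the labels; `η ≤ P(D = w)` turns the powers
of the label probability into powers of `η`. -/
lemma meanError_le (hA : DataAssumptions Q 𝕏 gmin gmax gLow gUp L a H η) (hη : 0 < η)
    {Ω : Type*} [MeasurableSpace Ω] {P : Measure Ω} [IsProbabilityMeasure P] {n : ℕ}
    {X : Fin n → Ω → Cov m} {D : Fin n → Ω → Fin 2} (hs : IsSample P X D Q) {M : ℕ} (hM : 1 ≤ M)
    {w : Fin 2} (i : Fin n) {g g' : Cov m → ℝ} {l u b : ℝ}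
    (h : DensityPair 𝕏 (covLaw Q w) (covLaw Q (1 - w)) g g' l u L a b)
    (hratio : ∀ᵐ x ∂(covLaw Q w), densityRatio Q w x = DensityPair.ratio 𝕏 g g' x) :
    meanError P X D Q M w i ≤ 7 * (1 + 2 * fixedLabelConst m l u L a b) *
      (1 / η ^ 2 * ((M : ℝ) / (n * η)) ^ (1 / (m : ℝ)) + 1 / (η ^ 2 * M)) := by
  have hprob := fun v => isProbabilityMeasure_covLaw (hA.labelProb_pos hη v)
  have hp := hA.labelProb_pos hη
  set C := fixedLabelConst m l u L a b
  have hC : 0 ≤ C := h.fixedLabelConst_nonneg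
  have hM' : (0 : ℝ) < M := by exact_mod_cast hM
  rw [meanError_eq_sum hs hp M w i (hA.integrable_sqError hη hs M w i)]
  set p := labelProb Q w
  have hηp : η ≤ p := hA.le_labelProb hη w
  have hp0 : 0 < p := hp w
  set θ := ((M : ℝ) / (n * η)) ^ (1 / (m : ℝ))
  have hθ0 : 0 ≤ θ := by positivity
  set B := ((1 + C) * (1 / M) + 2 * C * θ) / p ^ 2 with hB
  have hB0 : 0 ≤ B := by positivity
  have hfix : ∀ d : Fin n → Fin 2, d i = w →
      ∫ x, scaledError Q M w i d x ∂(Measure.pi fun j => covLaw Q (d j)) ≤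
        (1 + ((n : ℝ) * p / groupSize d w) ^ 3) * B := by
    intro d hd
    have hae : ∀ᵐ x ∂(Measure.pi fun j => covLaw Q (d j)), scaledError Q M w i d x =
        ((matchedTimes M w i x d : ℝ) / M - (groupSize d (1 - w) : ℝ) / groupSize d w *
          DensityPair.ratio 𝕏 g g' (x i)) ^ 2 := by
      have h1 : ∀ᵐ x ∂(Measure.pi fun j => covLaw Q (d j)),
          densityRatio Q w (x i) = DensityPair.ratio 𝕏 g g' (x i) := by
        refine ae_of_ae_map (f := fun x : Fin n → Cov m => x i)
          (p := fun y => densityRatio Q w y = DensityPair.ratio 𝕏 g g' y)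
          (measurable_pi_apply i).aemeasurable ?_
        rw [map_eval_pi (fun j => covLaw Q (d j)) i, hd]
        exact hratio
      filter_upwards [h1] with x hx
      rw [scaledError, hx]
    rw [integral_congr_ae hae]
    refine (integral_sq_matchedTimes_sub_le (ρ := covLaw Q) hd h hM).trans ?_
    refine fixedLabel_bound_le h.one_le_dim hM ?_ (groupSize_le d w) (groupSize_le d (1 - w)) hη
      hηp hC
    rw [groupSize_eq_card_peers_add_one hd]; omega
  have hsum := sum_labels_one_add_cube_le i w (p := labelProb Q) hp0 (labelProb_add Q w)
    (hp (1 - w)).le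
  calc _ ≤ p⁻¹ * ∑ d ∈ Finset.univ.filter (fun d : Fin n → Fin 2 => d i = w),
        ((∏ j, labelProb Q (d j)) * (1 + ((n : ℝ) * p / groupSize d w) ^ 3)) * B := by
        refine mul_le_mul_of_nonneg_left (Finset.sum_le_sum fun d hd => ?_)
          (inv_nonneg.2 hp0.le)
        rw [mul_assoc]
        exact mul_le_mul_of_nonneg_left (hfix d (Finset.mem_filter.1 hd).2)
          (Finset.prod_nonneg fun j _ => (hp _).le)
    _ ≤ p⁻¹ * (7 * p * B) := by
        rw [← Finset.sum_mul]
        gcongr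
    _ = 7 * ((1 + C) * (1 / M) + 2 * C * θ) / p ^ 2 := by rw [hB]; field_simp
    _ ≤ 7 * ((1 + C) * (1 / M) + 2 * C * θ) / η ^ 2 := by gcongr
    _ ≤ 7 * ((1 + 2 * C) * (1 / M) + (1 + 2 * C) * θ) / η ^ 2 := by
        gcongr <;> linarith
    _ = _ := by field_simp; ring

end DataAssumptions

section ErrorBound

variable {m n M : ℕ} {r₀ η : ℝ}

lemma expTerm_nonneg : 0 ≤ expTerm r₀ n M η := by unfold expTerm; positivity

/-- The bound on the mean error keeps two of the terms of `errorBound`; the others are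
nonnegative. -/
lemma le_errorBound (hη : 0 < η) :
    1 / η ^ 2 * ((M : ℝ) / (n * η)) ^ (1 / (m : ℝ)) + 1 / (η ^ 2 * M) ≤
      errorBound m r₀ n M η := by
  have hE := expTerm_nonneg (r₀ := r₀) (n := n) (M := M) (η := η)
  have h1 : 0 ≤ deltaH1 r₀ n M η := by unfold deltaH1; positivity
  have h2 : 0 ≤ deltaH2 m r₀ n M η := by unfold deltaH2; positivity
  have h3 : 0 ≤ deltaH3 n M η := by unfold deltaH3; positivity
  have h4 : 0 ≤ deltaH2 m r₀ n M η * (1 / (η ^ 2 * M)) := by positivity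
  unfold errorBound
  linarith

end ErrorBound

/-- The constant involves `𝕏` only through its volume and the radius of a ball inside it. -/
theorem exists_meanError_le_errorBound {m : ℕ} (hm : 1 ≤ m) (𝕏 : Set (Cov m))
    {gmin : ℝ} (gmax : ℝ) {gLow : Fin 2 → ℝ} (gUp : Fin 2 → ℝ) {L a : ℝ} (H C₀ C₁ r₀ : ℝ)
    (hgmin : 0 < gmin) (hgLow : ∀ w, 0 < gLow w) (hL : 0 < L) (ha : 0 < a) :
    ∃ C : ℝ, 0 < C ∧
      ∀ (n M : ℕ) (η : ℝ) (hs : SizeAssumptions C₀ C₁ n M η)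
        (Q : Measure (Cov m × Fin 2)) [IsProbabilityMeasure Q]
        (_ : DataAssumptions Q 𝕏 gmin gmax gLow gUp L a H η)
        (Ω : Type*) [MeasurableSpace Ω] (P : Measure Ω) [IsProbabilityMeasure P]
        (X : Fin n → Ω → Cov m) (D : Fin n → Ω → Fin 2)
        (_ : IsSample P X D Q) (w : Fin 2),
        Integrable (sqError X D Q M w ⟨0, lt_of_lt_of_le (by norm_num) hs.nine_le⟩) P ∧
        meanError P X D Q M w ⟨0, lt_of_lt_of_le (by norm_num) hs.nine_le⟩ ≤
          C * errorBound m r₀ n M η := by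
  by_cases hX : IsCompact 𝕏 ∧ Convex ℝ 𝕏 ∧ (interior 𝕏).Nonempty
  · obtain ⟨hcomp, hconv, z, hz⟩ := hX
    obtain ⟨ρ, hρ, hball⟩ := Metric.nhds_basis_closedBall.mem_iff.1 (mem_interior_iff_mem_nhds.1 hz)
    set b := m / ρ * (volume : Measure (Cov m)).real 𝕏
    have hb : 0 ≤ b := by positivity
    set l := min (gLow 0) (gLow 1)
    set u := max (gUp 0) (gUp 1)
    -- `max` gives the sign of the constant before any law is at hand
    set C := max (fixedLabelConst m l u L a b) 0
    have hC : 0 ≤ C := le_max_right _ _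
    refine ⟨7 * (1 + 2 * C), by positivity, ?_⟩
    intro n M η hs Q _ hA Ω _ P _ X D hS w
    have hη := hs.eta_pos
    refine ⟨hA.integrable_sqError hη hS M w _, ?_⟩
    obtain ⟨g, g', hpair, hratio⟩ := hA.exists_densityPair hη hm hgmin hgLow hL ha hb
      (fun ε hε => volume_boundary_layer_le hm hcomp hconv hρ hball hε) w
    refine (hA.meanError_le hη hS hs.one_le _ hpair hratio).trans ?_
    refine mul_le_mul ?_ (le_errorBound hη) (by positivity) (by positivity)
    have := le_max_left (fixedLabelConst m l u L a b) 0
    linarith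
  -- otherwise no law satisfies the assumptions
  · refine ⟨1, one_pos, ?_⟩
    intro n M η hs Q _ hA
    exact absurd ⟨hA.compact, hA.convex, hA.interior_nonempty⟩ hX

/-! ### Asymptotics of the bound -/

section Asymptotics

variable {m n M : ℕ} {r₀ η η₀ : ℝ}

/-- If the exponential terms are smaller than `n⁻⁴`, the bound simplifies. -/
lemma errorBound_le_simpleBound (hm : 1 ≤ m) (hM : 1 ≤ M) (hMn : M ≤ n) (hη₀ : 0 < η₀)
    (hη : η₀ ≤ η) (hη' : η ≤ 1 / 2) (hE : expTerm r₀ n M η ≤ 2 / (n : ℝ) ^ 4)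
    (hq : Real.exp (-(1 - Real.log 2) * M) ≤ 1 / (n : ℝ) ^ 4) :
    errorBound m r₀ n M η ≤ ((1 / η₀) ^ 3 + (1 / η₀) ^ 4 + 8 * (1 / η₀) ^ 2 + 2 * (1 / η₀) ^ 3) *
      simpleBound m n M := by
  have hη0 : 0 < η := hη₀.trans_le hη
  have hM' : (1 : ℝ) ≤ M := by exact_mod_cast hM
  have hMn' : (M : ℝ) ≤ n := by exact_mod_cast hMn
  have hn : (1 : ℝ) ≤ n := hM'.trans hMn'
  have hm' : (1 : ℝ) ≤ m := by exact_mod_cast hm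
  have hn0 : (0 : ℝ) < n := by linarith
  have hM0 : (0 : ℝ) < M := by linarith
  have hE0 := expTerm_nonneg (r₀ := r₀) (n := n) (M := M) (η := η)
  set e := 1 / η₀ with he
  have he0 : 0 < e := by positivity
  have hηe : 1 / η ≤ e := one_div_le_one_div_of_le hη₀ hη
  set φ := ((M : ℝ) / n) ^ (1 / (m : ℝ)) with hφ
  have hφ0 : 0 ≤ φ := by positivity
  have hφ1 : φ ≤ 1 := Real.rpow_le_one (by positivity) ((div_le_one hn0).2 hMn') (by positivity)
  have hnM : (1 : ℝ) / n ≤ 1 / M := one_div_le_one_div_of_le hM0 hMn'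
  have hk : ∀ k : ℕ, 1 ≤ k → 1 / (n : ℝ) ^ k ≤ 1 / M := fun k hk =>
    (one_div_le_one_div_of_le hn0 (le_self_pow₀ hn (by omega))).trans hnM
  have hθ : ((M : ℝ) / (n * η)) ^ (1 / (m : ℝ)) ≤ e * φ := by
    have h1 : (M : ℝ) / (n * η) = (1 / η) * (M / n) := by field_simp
    have h2 : (1 : ℝ) ≤ 1 / η := by rw [one_le_div hη0]; linarith
    have h3 : (1 / η) ^ (1 / (m : ℝ)) ≤ e := by
      calc (1 / η) ^ (1 / (m : ℝ)) ≤ (1 / η) ^ (1 : ℝ) :=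
            Real.rpow_le_rpow_of_exponent_le h2 (by rw [div_le_one (by linarith)]; exact hm')
        _ = 1 / η := Real.rpow_one _
        _ ≤ e := hηe
    rw [h1, Real.mul_rpow (by positivity) (by positivity)]
    gcongr
  set θ := ((M : ℝ) / (n * η)) ^ (1 / (m : ℝ))
  have hsq : (1 : ℝ) / η ^ 2 ≤ e ^ 2 := by
    rw [← one_div_pow]; exact pow_le_pow_left₀ (by positivity) hηe 2
  have hnMη : (n : ℝ) / (M * η) ≤ n * e := by
    calc (n : ℝ) / (M * η) = n * (1 / η) / M := by field_simp
      _ ≤ n * (1 / η) := div_le_self (by positivity) hM'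
      _ ≤ n * e := by gcongr
  have hnMη2 : ((n : ℝ) / (M * η)) ^ 2 ≤ n ^ 2 * e ^ 2 := by
    rw [← mul_pow]; exact pow_le_pow_left₀ (by positivity) hnMη 2
  have t1 : 1 / η ^ 2 * θ ≤ e ^ 3 * φ := by
    calc 1 / η ^ 2 * θ ≤ e ^ 2 * (e * φ) := by gcongr
      _ = _ := by ring
  have t2 : deltaH1 r₀ n M η ≤ (e ^ 4 + 4 * e ^ 2) * (1 / M) := by
    have h1 : 1 / ((n : ℝ) ^ 2 * η ^ 4) ≤ e ^ 4 * (1 / M) := by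
      calc 1 / ((n : ℝ) ^ 2 * η ^ 4) = (1 / η) ^ 4 * (1 / (n : ℝ) ^ 2) := by field_simp
        _ ≤ e ^ 4 * (1 / M) := by
          have := hk 2 (by norm_num)
          gcongr
    have h2 : ((n : ℝ) / (M * η)) ^ 2 * expTerm r₀ n M η ^ 2 ≤ 4 * e ^ 2 * (1 / M) := by
      calc _ ≤ (n : ℝ) ^ 2 * e ^ 2 * (2 / (n : ℝ) ^ 4) ^ 2 := by gcongr
        _ = 4 * e ^ 2 * (1 / (n : ℝ) ^ 6) := by field_simp; norm_num
        _ ≤ _ := by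
          have := hk 6 (by norm_num)
          gcongr
    unfold deltaH1
    linarith
  have t3 : deltaH2 m r₀ n M η + 1 ≤ 2 * e + 3 := by
    have h1 : θ ≤ e := hθ.trans (mul_le_of_le_one_right he0.le hφ1)
    have h2 : 1 / ((n : ℝ) * η) ≤ e := by
      calc 1 / ((n : ℝ) * η) = 1 / η * (1 / n) := by field_simp
        _ ≤ 1 / η := mul_le_of_le_one_right (by positivity) ((div_le_one hn0).2 hn)
        _ ≤ e := hηe
    have h3 : (n : ℝ) / M * expTerm r₀ n M η ≤ 2 := by
      calc _ ≤ (n : ℝ) * (2 / (n : ℝ) ^ 4) := by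
            gcongr
            exact div_le_self hn0.le hM'
        _ = 2 * (1 / (n : ℝ) ^ 3) := by field_simp
        _ ≤ 2 * 1 := by
            gcongr
            rw [div_le_one (by positivity)]
            exact one_le_pow₀ hn
        _ = 2 := by norm_num
    have h4 : deltaH2 m r₀ n M η =
        θ + 1 / ((n : ℝ) * η) + (n : ℝ) / M * expTerm r₀ n M η := rfl
    rw [h4]
    linarith
  have t3' : (deltaH2 m r₀ n M η + 1) * (1 / (η ^ 2 * M)) ≤ (2 * e + 3) * e ^ 2 * (1 / M) := by
    have h1 : 1 / (η ^ 2 * M) = 1 / η ^ 2 * (1 / M) := by field_simp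
    rw [h1, mul_assoc]
    gcongr
  have t4 : deltaH3 n M η ≤ e ^ 2 * (1 / M) := by
    unfold deltaH3
    calc _ ≤ (n : ℝ) ^ 2 * e ^ 2 * (1 / (n : ℝ) ^ 4) := by gcongr
      _ = e ^ 2 * (1 / (n : ℝ) ^ 2) := by field_simp
      _ ≤ _ := by
        have := hk 2 (by norm_num)
        gcongr
  have hM1 : (0 : ℝ) ≤ 1 / M := by positivity
  have h5 : 0 ≤ ((1 / η₀) ^ 4 + 8 * (1 / η₀) ^ 2 + 2 * (1 / η₀) ^ 3) * φ := by positivity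
  have h6 : 0 ≤ e ^ 3 * (1 / (M : ℝ)) := by positivity
  rw [errorBound, simpleBound, ← hφ]
  calc _ ≤ e ^ 3 * φ + (e ^ 4 + 4 * e ^ 2) * (1 / M) + (2 * e + 3) * e ^ 2 * (1 / M) +
        e ^ 2 * (1 / M) := by gcongr
    _ = e ^ 3 * φ + (e ^ 4 + 8 * e ^ 2 + 2 * e ^ 3) * (1 / M) := by ring
    _ ≤ e ^ 3 * φ + (e ^ 4 + 8 * e ^ 2 + 2 * e ^ 3) * (1 / M) +
        ((e ^ 4 + 8 * e ^ 2 + 2 * e ^ 3) * φ + e ^ 3 * (1 / M)) := by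
        rw [← he] at h5; linarith
    _ = _ := by ring

/-- For `u ≥ 16` the linear term dominates the logarithm. -/
lemma one_add_log_le_half {u : ℝ} (hu : 16 ≤ u) : 1 + Real.log u ≤ u / 2 := by
  have h1 : Real.log u = Real.log 16 + Real.log (u / 16) := by
    rw [← Real.log_mul (by norm_num) (by positivity)]; congr 1; field_simp
  have h2 := Real.log_le_sub_one_of_pos (show 0 < u / 16 by linarith)
  have h3 : Real.log 16 = 4 * Real.log 2 := by
    rw [show (16 : ℝ) = 2 ^ 4 by norm_num, Real.log_pow]; norm_num
  have h4 := Real.log_two_lt_d9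
  linarith

/-- With `s = r₀ n η`, the second exponent is `-M * (s / M - 1 - log (s / M)) ≤ -s / 2` as soon as
`16 * M ≤ s`. -/
lemma expTerm_le (hM : 1 ≤ M) (hn : 1 ≤ n) {s : ℝ} (hs : s = r₀ * n * η)
    (h16 : 16 * (M : ℝ) ≤ s) (hlog : 8 * Real.log n ≤ s)
    (hq : 4 * Real.log n ≤ (1 - Real.log 2) * M) :
    Real.exp (-(1 - Real.log 2) * M) ≤ 1 / (n : ℝ) ^ 4 ∧
      expTerm r₀ n M η ≤ 2 / (n : ℝ) ^ 4 := by
  have hM0 : (0 : ℝ) < M := by exact_mod_cast hM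
  have hn0 : (0 : ℝ) < n := by exact_mod_cast hn
  have hs0 : 0 < s := by linarith
  have hpow : Real.exp (-(4 * Real.log n)) = 1 / (n : ℝ) ^ 4 := by
    rw [Real.exp_neg, ← one_div, show (4 : ℝ) * Real.log n = (4 : ℕ) * Real.log n by norm_num,
      Real.exp_nat_mul, Real.exp_log hn0]
  have h1 : Real.exp (-(1 - Real.log 2) * M) ≤ 1 / (n : ℝ) ^ 4 := by
    rw [← hpow]; exact Real.exp_le_exp.2 (by linarith)
  refine ⟨h1, ?_⟩
  have h2 : Real.exp (M - r₀ * n * η - M * Real.log M + M * Real.log (r₀ * n * η)) ≤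
      1 / (n : ℝ) ^ 4 := by
    rw [← hpow, ← hs]
    refine Real.exp_le_exp.2 ?_
    have h3 := one_add_log_le_half (u := s / M) (by rw [le_div_iff₀ hM0]; exact h16)
    rw [Real.log_div hs0.ne' hM0.ne'] at h3
    have h4 := mul_le_mul_of_nonneg_left h3 hM0.le
    have h5 : (M : ℝ) * (s / M / 2) = s / 2 := by field_simp
    rw [h5] at h4
    linarith
  unfold expTerm
  calc _ ≤ 1 / (n : ℝ) ^ 4 + 1 / (n : ℝ) ^ 4 := add_le_add h1 h2
    _ = _ := by ring

lemma eventually_errorBound_le {m : ℕ} (hm : 1 ≤ m) {r₀ η₀ : ℝ} (hr₀ : 0 < r₀) (hη₀ : 0 < η₀)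
    (C₀ C₁ : ℝ) {M : ℕ → ℕ}
    (h1 : Tendsto (fun n : ℕ => Real.log n / (M n : ℝ)) atTop (𝓝 0))
    (h2 : Tendsto (fun n : ℕ => (M n : ℝ) * Real.log n / (n : ℝ)) atTop (𝓝 0)) :
    ∀ᶠ n in atTop, ∀ η : ℝ, η₀ ≤ η → SizeAssumptions C₀ C₁ n (M n) η →
      errorBound m r₀ n (M n) η ≤
        ((1 / η₀) ^ 3 + (1 / η₀) ^ 4 + 8 * (1 / η₀) ^ 2 + 2 * (1 / η₀) ^ 3) *
          simpleBound m n (M n) := by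
  have hlog2 : 0 < 1 - Real.log 2 := by have := Real.log_two_lt_d9; linarith
  have hκ : 0 < r₀ * η₀ := by positivity
  have h3 : Tendsto (fun n : ℕ => Real.log n / (n : ℝ)) atTop (𝓝 0) := by
    have := (Real.isLittleO_log_id_atTop.tendsto_div_nhds_zero).comp tendsto_natCast_atTop_atTop
    exact this
  have e1 := h1.eventually (gt_mem_nhds (show 0 < (1 - Real.log 2) / 4 by positivity))
  have e2 := h2.eventually (gt_mem_nhds (show 0 < r₀ * η₀ / 16 by positivity))
  have e3 := h3.eventually (gt_mem_nhds (show 0 < r₀ * η₀ / 8 by positivity))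
  filter_upwards [e1, e2, e3] with n e1 e2 e3 η hη hs
  have hM := hs.one_le
  have hM0 : (0 : ℝ) < M n := by exact_mod_cast hM
  have h9 := hs.nine_le
  have hn0 : (0 : ℝ) < n := by exact_mod_cast (by omega : 0 < n)
  have hlogn : 1 ≤ Real.log n := by
    rw [Real.le_log_iff_exp_le hn0]
    have : (9 : ℝ) ≤ n := by exact_mod_cast h9
    linarith [Real.exp_one_lt_d9]
  have hsn : r₀ * η₀ * n ≤ r₀ * n * η := by
    calc r₀ * η₀ * n = r₀ * n * η₀ := by ring
      _ ≤ _ := by gcongr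
  rw [div_lt_iff₀ hM0] at e1
  rw [div_lt_iff₀ hn0] at e2 e3
  have hMlog : (M n : ℝ) ≤ M n * Real.log n := le_mul_of_one_le_right hM0.le hlogn
  obtain ⟨hq, hE⟩ := expTerm_le (r₀ := r₀) (η := η) hM (by omega : 1 ≤ n) rfl (by linarith)
    (by linarith) (by linarith)
  exact errorBound_le_simpleBound hm hM hs.le_n hη₀ hη hs.eta_le hE hq

lemma simpleBound_nonneg (m n M : ℕ) : 0 ≤ simpleBound m n M := by
  unfold simpleBound; positivity

end Asymptotics
end Matching

theorem mainTheorem7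
    (m : ℕ) (hm : 1 ≤ m) (𝕏 : Set (Matching.Cov m))
    (gmin gmax : ℝ) (gLow gUp : Fin 2 → ℝ) (L a H C₀ C₁ r₀ : ℝ)
    (hgmin : 0 < gmin) (hgmax : gmin ≤ gmax)
    (hgLow : ∀ w, 0 < gLow w) (hgUp : ∀ w, gLow w ≤ gUp w) (hL : 0 < L)
    (ha0 : 0 < a) (ha1 : a < 1) (hH : 0 < H)
    (hC₀ : 0 < C₀) (hC₁ : 0 < C₁)
    (hC₀' : C₀ ≤ max
      ((gLow 0 / 4) ^ (m + 1) * (Matching.unitBallVolume m / (2 * L ^ m)))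
      ((gLow 1 / 4) ^ (m + 1) * (Matching.unitBallVolume m / (2 * L ^ m))))
    (hr₀ : Matching.rRatio gLow gUp ≤ r₀) (hr₀' : r₀ ≤ 1) :
    -- the non-asymptotic bounds; `w = 0` is the first one and `w = 1` the symmetric one
    (∃ C : ℝ, 0 < C ∧
      ∀ (n M : ℕ) (η : ℝ) (hs : Matching.SizeAssumptions C₀ C₁ n M η)
        (Q : Measure (Matching.Cov m × Fin 2)) [IsProbabilityMeasure Q]
        (_ : Matching.DataAssumptions Q 𝕏 gmin gmax gLow gUp L a H η)
        (Ω : Type*) [MeasurableSpace Ω] (P : Measure Ω) [IsProbabilityMeasure P]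
        (X : Fin n → Ω → Matching.Cov m) (D : Fin n → Ω → Fin 2)
        (_ : Matching.IsSample P X D Q) (w : Fin 2),
        Integrable
          (Matching.sqError X D Q M w ⟨0, lt_of_lt_of_le (by norm_num) hs.nine_le⟩) P ∧
        Matching.meanError P X D Q M w ⟨0, lt_of_lt_of_le (by norm_num) hs.nine_le⟩ ≤
          C * Matching.errorBound m r₀ n M η) ∧
    -- the simplified bounds when `log n / M → 0`, `M log n / n → 0` and `η ≥ η₀ > 0`
    (∀ η₀ : ℝ, 0 < η₀ → ∃ C : ℝ, 0 < C ∧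
      ∀ M : ℕ → ℕ, (∀ᶠ n in atTop, 1 ≤ M n) →
        Tendsto (fun n : ℕ => Real.log n / (M n : ℝ)) atTop (𝓝 0) →
        Tendsto (fun n : ℕ => (M n : ℝ) * Real.log n / (n : ℝ)) atTop (𝓝 0) →
        ∀ᶠ n in atTop, ∀ η : ℝ, η₀ ≤ η →
          ∀ hs : Matching.SizeAssumptions C₀ C₁ n (M n) η,
          Matching.errorBound m r₀ n (M n) η ≤ C * Matching.simpleBound m n (M n) ∧
          ∀ (Q : Measure (Matching.Cov m × Fin 2)) [IsProbabilityMeasure Q]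
            (_ : Matching.DataAssumptions Q 𝕏 gmin gmax gLow gUp L a H η)
            (Ω : Type*) [MeasurableSpace Ω] (P : Measure Ω) [IsProbabilityMeasure P]
            (X : Fin n → Ω → Matching.Cov m) (D : Fin n → Ω → Fin 2)
            (_ : Matching.IsSample P X D Q) (w : Fin 2),
            Matching.meanError P X D Q (M n) w
                ⟨0, lt_of_lt_of_le (by norm_num) hs.nine_le⟩ ≤
              C * Matching.simpleBound m n (M n)) := by
  have hr₀pos : 0 < r₀ := by
    refine lt_of_lt_of_le ?_ hr₀
    exact lt_max_of_lt_left (div_pos (hgLow 0) ((hgLow 0).trans_le (hgUp 0)))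
  refine ⟨Matching.exists_meanError_le_errorBound hm 𝕏 gmax gUp H C₀ C₁ r₀ hgmin hgLow hL ha0,
    fun η₀ hη₀ => ?_⟩
  -- the sample spaces of the two parts may live in different universes, so the first bound is
  -- taken anew
  obtain ⟨B, hB, hmean⟩ :=
    Matching.exists_meanError_le_errorBound hm 𝕏 gmax gUp H C₀ C₁ r₀ hgmin hgLow hL ha0
  set K := (1 / η₀) ^ 3 + (1 / η₀) ^ 4 + 8 * (1 / η₀) ^ 2 + 2 * (1 / η₀) ^ 3
  have hK : 0 < K := by positivity
  refine ⟨(1 + B) * K, by positivity, fun M _ h1 h2 => ?_⟩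
  filter_upwards [Matching.eventually_errorBound_le hm hr₀pos hη₀ C₀ C₁ h1 h2] with n hn η hη hs
  have hb := hn η hη hs
  have hKS := mul_nonneg hK.le (Matching.simpleBound_nonneg m n (M n))
  refine ⟨by nlinarith [mul_nonneg hB.le hKS], fun Q _ hA Ω _ P _ X D hS w => ?_⟩
  have hle := (hmean n (M n) η hs Q hA Ω P X D hS w).2.trans (mul_le_mul_of_nonneg_left hb hB.le)
  refine hle.trans ?_
  linarith
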